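/- **Setting.** For $N\ge 1$ and $a>0$ consider the periodic chain with sites $j\in\mathbb Z/N$ and Hamiltonian $H=H_0+H_1$ on $\mathbb R^{2N}$, $$H_0=\tfrac12\sum_j\big[y_j^2+x_j^2+a(x_j-x_{j-1})^2\big],\qquad H_1=\tfrac14\sum_j x_j^4 ,$$ and let $\langle\cdot\rangle$ be the average with respect to the Gibbs measure $e^{-\beta H}dx\,dy/\int e^{-\beta H}dx\,dy$. Put $\omega^2=1+2a$, $\mu=a/\omega^2$ and $A=\omega^2[\mathbb I-\mu(\tau+\tau^{\top})]$, where $\tau$ is the cyclic permutation matrix, so that $H_0=\frac12 y\cdot y+\frac12 x\cdot Ax$; let $\Omega$ be the average of the square roots of the eigenvalues of $A$. In the canonical variables $q=A^{1/4}x$, $p=A^{-1/4}y$ write $H_\Omega=\frac\Omega2\sum_j(q_j^2+p_j^2)$ and $Z_0=H_0-H_\Omega$. **The remainder.** For an integer $r\ge0$, a normal form of order $r$ consists of cyclically symmetric homogeneous polynomials $\mathcal X_s,Z_s$ of degree $2s+2$ in $(q,p)$, $1\le s\le r$, with $\mathcal X_s$ in the range and $Z_s$ in the kernel of $\{H_\Omega,\cdot\}$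 on the homogeneous polynomials of degree $2s+2$, such that, with $E_0=\mathbb I$ and $E_s=\sum_{j=1}^s\frac js\{\mathcal X_j,E_{s-j}\,\cdot\,\}$, $$E_sH_0+\sum_{l=1}^{s}E_{s-l}Z_l=\begin{cases}H_1& s=1\\ 0&2\le s\le r.\end{cases}$$ Put $\Phi^{(r)}=\sum_{s=0}^rE_sH_\Omega$ and $R=\{\Phi^{(r)},H\}$, as functions of $(x,y)$. **Classes.** The norm $\|f\|$ of a polynomial is the sum of the absolute values of its coefficients. A cyclically symmetric $F$, homogeneous of degree $d$, has a seed of class $\mathcal D(C,\sigma)$ if $F=\sum_{m=0}^{N-1}\sum_{s\in\mathbb Z/N}\tau^sf^{(m)}$ with $f^{(m)}$ homogeneous of degree $d$, depending only on the variables of the sites $0,\dots,m$, and $\|f^{(m)}\|\le Ce^{-\sigma m}$; here $\tau^s$ translates all sites by $s$. **Constants depending on $a$.** Put $\sigma_0=-\ln(2\mu)$, $\sigma_1=\sigma_0/2$, $\sigma_*=\sigma_0/4$, $\mu_\flat=e^{-\sigma_*}$, $A_1=\sqrt{1+4a}$, $A_2=\sqrt{1-2a}$, and $$\tilde C=\frac{2\cdot\frac12\left|\ln\frac{\omega^2}{1-2\mu}\right|}{(1-e^{-\sigma_0})(1-e^{-(\sigma_0-\sigma_*)})}.$$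 **Statement.** There are constants $\beta_0>0$, $0<a_0<\frac12$, $K_1>2$ and functions $C_0(a),C_1(a)$, bounded as $a\to0^+$ and positive for $0<a<a_0$, all independent of $N$, $\beta$, $r$ and $\nu$, such that: (a) for all $\beta>\beta_0$, $0<a<a_0$, the configurational partition functions $Z_l$ and $\mathcal Z_l$ of the chain of $l$ sites with periodic and with free ends satisfy $Z_l\ge Z_{l-1}\frac1{K_1}\sqrt{2\pi/\beta}$ for $l\ge2$ and $\mathcal Z_l\le(2K_1)^{1+4a_0}Z_l$ for $l\ge1$; (b) for all $0<a<a_0$ and $N\ge1$, in the variables $(q,p)$, $Z_0$ has a seed of class $\mathcal D(C_0(a),\sigma_0)$ whose component $f^{(0)}$ vanishes, and $H_1$ has a seed of class $\mathcal D(C_1(a),\sigma_1)$; (c) with $$\mu_*=\frac{\Omega(1-e^{-\sigma_0})(1-e^{-(\sigma_0-\sigma_*)})}{8C_0e^{\sigma_1}},\qquad D=\frac{K_1A_1}{1-\frac3{4\beta^2}},\qquad \beta^*=\frac{2^6e^{\tilde C-1}}{(1-\mu_\flat^2)(1-\mu_\flat)A_2^2}\,\frac{C_1}{\Omega},$$ $$K_2=\frac{4(2K_1)^{2+8a_0}}{(1-2a_0)^4(1-a_0)^6},\qquad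 K_3=2^8K_1^4K_2,\qquad K_4=K_3\frac{3^3e^6\Omega^6}{2^9C_1^2},$$ the following holds for every $N\ge1$, every $0<a<\min\{a_0,\frac14\}$ and every $\beta$ with $D^2\mu_\flat<1$. 1. Let $\nu\in(0,1]$, let $r$ be an integer with $1\le r<\mu_*/(2\mu)$, and let $\beta>\max\{\beta_0,(\beta^*r^3)^{1/\nu},\sqrt{3/2}\}$. Then a normal form of order $r$ exists, and for every such normal form $$\langle R^2\rangle\le\frac{N}{\beta^{\lambda_1}}\left[\frac{K_4{\beta^*}^3}{(1-D^2\mu_\flat)^2}\right],\qquad \lambda_1=2r(1-\nu)+4-\nu .$$ 2. Let $\beta\ge\max\{\beta_0,64e\beta^*,\sqrt{3/2}\}$, and put $\kappa=\frac32\sqrt[3]{\beta/(e\beta^*)}$ if $\beta<e\beta^*(\mu_*/\mu)^3$ and $\kappa=\frac32\,\mu_*/\mu$ otherwise. Then, with $r=\lfloor\kappa/3\rfloor$, a normal form of order $r$ exists, and for every such normal form $$\langle R^2\rangle\le N\,\frac{e^{-\kappa}}{\kappa^9}\left[\frac{3^8K_4}{2e^4(1-D^2\mu_\flat)^2}\right].$$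 In both cases $R^2$ is integrable with respect to the Gibbs measure. -/

import Mathlib

open MvPolynomial MeasureTheory Filter
open scoped Topology BigOperators

namespace KleinGordon

noncomputable section

/-! ### Polynomial observables on the phase space of a periodic chain

The sites of the chain are the elements of `ZMod N`.  The variable `Sum.inl j` is the position
and `Sum.inr j` is the momentum of the site `j`. -/

/-- Indices of the canonical variables. -/
abbrev Var (N : ℕ) : Type := ZMod N ⊕ ZMod N

/-- Real polynomials in the canonical variables. -/
abbrev Poly (N : ℕ) : Type := MvPolynomial (Var N) ℝ

/-- The site to which a canonical variable belongs. -/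
def site {N : ℕ} : Var N → ZMod N := Sum.elim id id

/-- The Poisson bracket `{f, g} = ∑ l, (∂f/∂x_l ∂g/∂y_l - ∂f/∂y_l ∂g/∂x_l)`. -/
def poisson {N : ℕ} [NeZero N] (f g : Poly N) : Poly N :=
  ∑ l : ZMod N, (pderiv (Sum.inl l) f * pderiv (Sum.inr l) g
    - pderiv (Sum.inr l) f * pderiv (Sum.inl l) g)

/-- The translation `τ^s`, acting by `x_j ↦ x_{j+s}`, `y_j ↦ y_{j+s}`. -/
def shift {N : ℕ} (s : ZMod N) (f : Poly N) : Poly N :=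
  rename (Sum.map (fun j => j + s) (fun j => j + s)) f

/-- Cyclic symmetry (extensivity): `τ F = F`. -/
def CyclicallySymmetric {N : ℕ} (F : Poly N) : Prop := shift 1 F = F

/-- The extensive function `f^⊕ = ∑_s τ^s f` generated by the seed `f`. -/
def extensive {N : ℕ} [NeZero N] (f : Poly N) : Poly N := ∑ s : ZMod N, shift s f

/-- The polynomial norm: the sum of the absolute values of the coefficients. -/
def polyNorm {N : ℕ} (f : Poly N) : ℝ := ∑ d ∈ f.support, |f.coeff d|

/-- `F` is extensive with a seed `∑_m f m` of class `𝓓(C, σ)`: each `f m` is homogeneous of degree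
`d`, left aligned with interaction range at most `m` (it only involves the sites `0, …, m`), and
has norm at most `C e^{-σ m}`. -/
def SeedOfClass {N : ℕ} [NeZero N] (d : ℕ) (F : Poly N) (f : ℕ → Poly N) (C σ : ℝ) : Prop :=
  F = ∑ m ∈ Finset.range N, extensive (f m) ∧
  ∀ m < N, (f m).IsHomogeneous d ∧ (∀ i ∈ (f m).vars, (site i).val ≤ m) ∧
    polyNorm (f m) ≤ C * Real.exp (-σ * m)

/-! ### The Klein-Gordon chain -/

/-- The quadratic part `H₀ = ½ ∑ (y_j² + x_j² + a (x_j - x_{j-1})²)`. -/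
def H0 (N : ℕ) [NeZero N] (a : ℝ) : Poly N :=
  C (1 / 2) * ∑ j : ZMod N, (X (Sum.inr j) ^ 2 + X (Sum.inl j) ^ 2
    + C a * (X (Sum.inl j) - X (Sum.inl (j - 1))) ^ 2)

/-- The quartic part `H₁ = ¼ ∑ x_j⁴`. -/
def H1 (N : ℕ) [NeZero N] : Poly N := C (1 / 4) * ∑ j : ZMod N, X (Sum.inl j) ^ 4

/-- The Hamiltonian of the chain. -/
def hamiltonian (N : ℕ) [NeZero N] (a : ℝ) : Poly N := H0 N a + H1 N

/-- The Gibbs measure `e^{-β H} dz / ∫ e^{-β H} dz`. -/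
def gibbs (N : ℕ) [NeZero N] (a β : ℝ) : Measure (Var N → ℝ) :=
  (volume : Measure (Var N → ℝ)).tilted (fun z => -β * eval z (hamiltonian N a))

/-- Configurational partition function of the periodic chain with `l` sites. -/
def partitionPeriodic (l : ℕ) [NeZero l] (β a : ℝ) : ℝ :=
  ∫ x : ZMod l → ℝ, Real.exp (-β * ∑ j : ZMod l,
    (x j ^ 2 / 2 + a / 2 * (x j - x (j - 1)) ^ 2 + x j ^ 4 / 4))

/-- Configurational partition function of the chain with `l` sites and free ends: the spring
between the last site and the first one is removed. -/
def partitionFree (l : ℕ) [NeZero l] (β a : ℝ) : ℝ :=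
  ∫ x : ZMod l → ℝ, Real.exp (-β * ∑ j : ZMod l,
    (x j ^ 2 / 2 + (if j = 0 then 0 else a / 2 * (x j - x (j - 1)) ^ 2) + x j ^ 4 / 4))

/-- The bounds on partition functions which characterize the constants `β₀`, `a₀`, `K₁`. -/
def PartitionBounds (β₀ a₀ K₁ : ℝ) : Prop :=
  ∀ β a : ℝ, β₀ < β → 0 < a → a < a₀ → ∀ l : ℕ,
    partitionPeriodic (l + 1) β a * (1 / K₁ * √(2 * Real.pi / β)) ≤
      partitionPeriodic (l + 2) β a ∧
    partitionFree (l + 1) β a ≤ partitionPeriodic (l + 1) β a * (2 * K₁) ^ (1 + 4 * a₀)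

/-! ### The linear normalizing transformation -/

/-- `ω² = 1 + 2a`. -/
def omegaSq (a : ℝ) : ℝ := 1 + 2 * a

/-- The coupling parameter `μ = a / ω²`. -/
def mu (a : ℝ) : ℝ := a / omegaSq a

/-- The permutation matrix `τ`. -/
def tauMatrix (N : ℕ) : Matrix (ZMod N) (ZMod N) ℝ :=
  Matrix.of fun i j => if i = j + 1 then 1 else 0

/-- The matrix `A = ω² (1 - μ (τ + τᵀ))` of the quadratic form of the potential. -/
def matA (N : ℕ) (a : ℝ) : Matrix (ZMod N) (ZMod N) ℝ :=
  omegaSq a • (1 - mu a • (tauMatrix N + (tauMatrix N).transpose))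

/-- The power `A^p` of the symmetric positive definite matrix `A`. -/
def powA (N : ℕ) [NeZero N] (a p : ℝ) : Matrix (ZMod N) (ZMod N) ℝ :=
  cfc (fun t : ℝ => t ^ p) (matA N a)

/-- `Ω`, the average of the square roots of the eigenvalues of `A`. -/
def Omega (N : ℕ) [NeZero N] (a : ℝ) : ℝ := (powA N a (1 / 2)).trace / N

/-- Substitution of `M x` for the positions and of `M' y` for the momenta. -/
def linSubst {N : ℕ} [NeZero N] (M M' : Matrix (ZMod N) (ZMod N) ℝ) (f : Poly N) : Poly N :=
  aeval (Sum.elim (fun i => ∑ j, C (M i j) * (X (Sum.inl j) : Poly N))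
    (fun i => ∑ j, C (M' i j) * (X (Sum.inr j) : Poly N))) f

/-- A function of the original variables `(x, y)`, written in the variables
`q = A^{1/4} x`, `p = A^{-1/4} y`. -/
def toNormal {N : ℕ} [NeZero N] (a : ℝ) (f : Poly N) : Poly N :=
  linSubst (powA N a (-(1 / 4))) (powA N a (1 / 4)) f

/-- A function of the variables `(q, p)`, written in the original variables `(x, y)`. -/
def toOriginal {N : ℕ} [NeZero N] (a : ℝ) (f : Poly N) : Poly N :=
  linSubst (powA N a (1 / 4)) (powA N a (-(1 / 4))) f

/-- `H_Ω = (Ω/2) ∑ (q_j² + p_j²)`, in the variables `(q, p)`. -/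
def HOmega (N : ℕ) [NeZero N] (a : ℝ) : Poly N :=
  C (Omega N a / 2) * ∑ j : ZMod N, (X (Sum.inl j) ^ 2 + X (Sum.inr j) ^ 2)

/-- `Z₀ = H₀ - H_Ω`, in the variables `(q, p)`. -/
def Z0 (N : ℕ) [NeZero N] (a : ℝ) : Poly N := toNormal a (H0 N a) - HOmega N a

/-! ### The truncated first integral -/

/-- The operators of the Lie transform with generating sequence `χ₁, χ₂, …`:
`E₀ = 1` and `E_s = ∑_{j=1}^{s} (j/s) {χ_j, E_{s-j} ·}`. -/
def lieE {N : ℕ} [NeZero N] (χ : ℕ → Poly N) : ℕ → Poly N → Poly N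
  | 0, f => f
  | s + 1, f => ∑ j : Fin (s + 1),
      C (((j : ℕ) + 1 : ℝ) / (s + 1)) * poisson (χ (j + 1)) (lieE χ (s - j) f)
  termination_by s => s
  decreasing_by omega

/-- `χ₁, …, χ_r` is a generating sequence which brings `H` into normal form up to order `r`, in the
variables `(q, p)`.  All terms are extensive; `χ_s` and `Z_s` are homogeneous of degree `2s + 2`,
`Z_s` is in the kernel and `χ_s` in the range of `{H_Ω, ·}` on homogeneous polynomials of that
degree; and the terms of order `1, …, r` of `T_χ Z = H`, where `T_χ = ∑ E_s` and
`Z = H₀ + Z_1 + ⋯ + Z_r`, hold. -/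
structure IsNormalForm (N : ℕ) [NeZero N] (a : ℝ) (r : ℕ) (χ Z : ℕ → Poly N) : Prop where
  zero : Z 0 = toNormal a (H0 N a)
  chi_cyclic : ∀ s, 1 ≤ s → s ≤ r → CyclicallySymmetric (χ s)
  chi_range : ∀ s, 1 ≤ s → s ≤ r →
    ∃ g : Poly N, g.IsHomogeneous (2 * s + 2) ∧ χ s = poisson (HOmega N a) g
  Z_cyclic : ∀ s, 1 ≤ s → s ≤ r → CyclicallySymmetric (Z s)
  Z_homogeneous : ∀ s, 1 ≤ s → s ≤ r → (Z s).IsHomogeneous (2 * s + 2)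
  Z_kernel : ∀ s, 1 ≤ s → s ≤ r → poisson (HOmega N a) (Z s) = 0
  order : ∀ s, 1 ≤ s → s ≤ r →
    ∑ l ∈ Finset.range (s + 1), lieE χ (s - l) (Z l) =
      if s = 1 then toNormal a (H1 N) else 0

/-- `Φ^{(r)} = ∑_{s ≤ r} E_s H_Ω`, written in the original variables. -/
def Phi (N : ℕ) [NeZero N] (a : ℝ) (r : ℕ) (χ : ℕ → Poly N) : Poly N :=
  toOriginal a (∑ s ∈ Finset.range (r + 1), lieE χ s (HOmega N a))

/-- The remainder `R = {Φ^{(r)}, H}`. -/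
def remainder (N : ℕ) [NeZero N] (a : ℝ) (r : ℕ) (χ : ℕ → Poly N) : Poly N :=
  poisson (Phi N a r χ) (hamiltonian N a)

/-- The normal form of order `r` exists, and `⟨R²⟩ ≤ b` for the remainder that it defines. -/
def RemainderBound (N : ℕ) [NeZero N] (a β : ℝ) (r : ℕ) (b : ℝ) : Prop :=
  (∃ χ Z : ℕ → Poly N, IsNormalForm N a r χ Z) ∧
  ∀ χ Z : ℕ → Poly N, IsNormalForm N a r χ Z →
    Integrable (fun z => eval z (remainder N a r χ) ^ 2) (gibbs N a β) ∧
    ∫ z, eval z (remainder N a r χ) ^ 2 ∂(gibbs N a β) ≤ b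

/-! ### The constants -/

/-- `σ₀ = -ln (2μ)`. -/
def sigma0 (a : ℝ) : ℝ := -Real.log (2 * mu a)

/-- `σ₁ = σ₀ / 2`. -/
def sigma1 (a : ℝ) : ℝ := sigma0 a / 2

/-- `σ_* = σ₀ / 4`. -/
def sigmaStar (a : ℝ) : ℝ := sigma0 a / 4

/-- `μ_♭ = e^{-σ_*}`. -/
def muFlat (a : ℝ) : ℝ := Real.exp (-sigmaStar a)

/-- `μ_*`, where `C₀` is the constant in the class of `Z₀`. -/
def muStar (N : ℕ) [NeZero N] (a C₀ : ℝ) : ℝ :=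
  Omega N a * (1 - Real.exp (-sigma0 a)) * (1 - Real.exp (-(sigma0 a - sigmaStar a))) /
    (8 * C₀ * Real.exp (sigma1 a))

/-- `A₂² = 1 - 2a`. -/
def A2sq (a : ℝ) : ℝ := √(1 - 2 * a) ^ 2

/-- `D = K₁ A₁ / B` with `A₁ = √(1 + 4a)` and `B = 1 - 3 / (4 β²)`. -/
def constD (K₁ a β : ℝ) : ℝ := K₁ * √(1 + 4 * a) / (1 - 3 / (4 * β ^ 2))

/-- `C̃`, the constant of the estimate of the transformation back to the original variables.  The
number `½ |ln (ω² / (1 - 2μ))|` is the constant in the class of the generating function of the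
linear transformation. -/
def Ctilde (a : ℝ) : ℝ :=
  2 * (1 / 2 * |Real.log (omegaSq a / (1 - 2 * mu a))|) /
    ((1 - Real.exp (-sigma0 a)) * (1 - Real.exp (-(sigma0 a - sigmaStar a))))

/-- `β^*`, where `C₁` is the constant in the class of `H₁`. -/
def betaStar (N : ℕ) [NeZero N] (a C₁ : ℝ) : ℝ :=
  2 ^ 6 * Real.exp (Ctilde a - 1) / ((1 - muFlat a ^ 2) * (1 - muFlat a) * A2sq a) *
    (C₁ / Omega N a)

/-- `K₂`. -/
def constK2 (a₀ K₁ : ℝ) : ℝ :=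
  4 * (2 * K₁) ^ (2 + 8 * a₀) / ((1 - 2 * a₀) ^ 4 * (1 - a₀) ^ 6)

/-- `K₃ = 2⁸ K₁⁴ K₂`. -/
def constK3 (a₀ K₁ : ℝ) : ℝ := 2 ^ 8 * K₁ ^ 4 * constK2 a₀ K₁

/-- `K₄ = K₃ 3³ e⁶ Ω⁶ / (2⁹ C₁²)`. -/
def constK4 (N : ℕ) [NeZero N] (a a₀ K₁ C₁ : ℝ) : ℝ :=
  constK3 a₀ K₁ * (3 ^ 3 * Real.exp 6 * Omega N a ^ 6 / (2 ^ 9 * C₁ ^ 2))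

/-- `λ₁ = 2r(1 - ν) + 4 - ν`. -/
def lambda1 (r : ℕ) (ν : ℝ) : ℝ := 2 * r * (1 - ν) + 4 - ν

/-- `κ = (3/2) (β / (e β^*))^{1/3}`, capped at `(3/2) μ_* / μ`. -/
def kappa (N : ℕ) [NeZero N] (a β C₀ C₁ : ℝ) : ℝ :=
  if β < Real.exp 1 * betaStar N a C₁ * (muStar N a C₀ / mu a) ^ 3 then
    3 / 2 * (β / (Real.exp 1 * betaStar N a C₁)) ^ (1 / 3 : ℝ)
  else 3 / 2 * (muStar N a C₀ / mu a)

end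

end KleinGordon

/-! The constants are existential, so it is enough to prove ⟨R²⟩ ≤ N M^r r^{6r} / β^{2r+4} with an
absolute M (`exists_second_moment_remainder_le`) and then to take C₁ ≥ M. Since β^* ≥ C₁ and C₁² K₄
≥ 1, the powers of β^* absorb M^r, and the conditions on β turn the bound into the power law and the
exponential (`power_law_bound`, `exponential_bound`). The factor (1 - D² μ_♭)^{-2} is at least 1 and
only weakens the claim.

Algebra. The operators E_s obey the Leibniz rule for the bracket (`lieE_pb`), so {H_Ω, Z_s} = 0
makes every order of {Φ, H} cancel except the last: R = {E_r H_Ω, H₁}, homogeneous of degree 2r + 4.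
In suitable complex coordinates {H_Ω, ·} is diagonal on monomials, with eigenvalues in iΩℤ, and {Z₀,
·} is a perturbation of size O(μ) times the degree. While this stays below Ω/2 the homological
equation has at most one solution, hence, by counting dimensions, exactly one. Uniqueness transfers
the symmetries of H to every normal form: invariance under translations, and under reversal of the
momenta, which makes R odd.

Size, uniformly in N. Polynomials are measured by `gn`, the largest ℓ¹ norm of a partial derivative.
A bracket costs only its degree in this norm (`gn_pb_le`), with no factor N, and the change of
variables is bounded because the entries of the powers of A decay exponentially. A majorant argument
then gives `gn` R ≤ (c r²)^r.

Probability. Integration by parts at the site with the largest moment gives Gaussian moments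
⟨z_i^{2k}⟩ ≤ (2k-1)!!/β^k for any attractive coupling (`Dissipative.moment_le`). Each monomial of R
contains some momentum to an odd power, and is uncorrelated with the monomials that do not contain
that momentum. Hence ⟨R²⟩ is controlled by the product of the ℓ¹ norm and `gn` R, which is linear in
N, and not by the square of the ℓ¹ norm. The powers r^{4r} from `gn` R squared and r^{2r} from the
moment make r^{6r}. The second moments also yield the bounds on the partition functions. -/

namespace KleinGordon

noncomputable section

set_option linter.unusedSectionVars false

/-! ### Coefficient norms of polynomials -/

section Norms

variable {σ τ K : Type*} [RCLike K]

/-- The sum of the absolute values of the coefficients. -/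
def l1 (f : MvPolynomial σ K) : ℝ := ∑ d ∈ f.support, ‖f.coeff d‖

theorem polyNorm_eq_l1 {N : ℕ} (f : Poly N) : polyNorm f = l1 f := rfl

theorem l1_eq_sum_of_subset {f : MvPolynomial σ K} {S : Finset (σ →₀ ℕ)} (h : f.support ⊆ S) :
    l1 f = ∑ d ∈ S, ‖f.coeff d‖ :=
  Finset.sum_subset h fun d _ hd => by simp [notMem_support_iff.1 hd]

theorem l1_nonneg (f : MvPolynomial σ K) : 0 ≤ l1 f := Finset.sum_nonneg fun _ _ => norm_nonneg _

@[simp] theorem l1_zero : l1 (0 : MvPolynomial σ K) = 0 := by simp [l1]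

theorem l1_neg (f : MvPolynomial σ K) : l1 (-f) = l1 f := by simp [l1]

theorem l1_add_le (f g : MvPolynomial σ K) : l1 (f + g) ≤ l1 f + l1 g := by
  classical
  rw [l1_eq_sum_of_subset (support_add (p := f) (q := g)),
    l1_eq_sum_of_subset (Finset.subset_union_left (s₁ := f.support) (s₂ := g.support)),
    l1_eq_sum_of_subset (Finset.subset_union_right (s₁ := f.support) (s₂ := g.support)),
    ← Finset.sum_add_distrib]
  exact Finset.sum_le_sum fun d _ => by simpa using norm_add_le _ _

theorem l1_sub_le (f g : MvPolynomial σ K) : l1 (f - g) ≤ l1 f + l1 g := by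
  rw [sub_eq_add_neg, ← l1_neg g]; exact l1_add_le _ _

theorem l1_sum_le {ι : Type*} (s : Finset ι) (f : ι → MvPolynomial σ K) :
    l1 (∑ i ∈ s, f i) ≤ ∑ i ∈ s, l1 (f i) := by
  classical
  induction s using Finset.induction_on with
  | empty => simp
  | insert a s ha ih =>
    rw [Finset.sum_insert ha, Finset.sum_insert ha]
    exact (l1_add_le _ _).trans (by gcongr)

theorem l1_monomial (d : σ →₀ ℕ) (c : K) : l1 (monomial d c) = ‖c‖ := by
  classical
  rw [l1_eq_sum_of_subset (support_monomial_subset (s := d) (a := c))]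
  simp

@[simp] theorem l1_C (c : K) : l1 (C c : MvPolynomial σ K) = ‖c‖ := l1_monomial 0 c

@[simp] theorem l1_X (v : σ) : l1 (X v : MvPolynomial σ K) = 1 := by
  simp [X, l1_monomial]

theorem l1_mul_le (f g : MvPolynomial σ K) : l1 (f * g) ≤ l1 f * l1 g := by
  conv_lhs => rw [f.as_sum, g.as_sum, Finset.sum_mul_sum]
  refine (l1_sum_le _ _).trans ?_
  rw [l1, l1, Finset.sum_mul_sum]
  refine Finset.sum_le_sum fun d _ => (l1_sum_le _ _).trans (Finset.sum_le_sum fun e _ => ?_)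
  rw [monomial_mul, l1_monomial, norm_mul]

theorem l1_C_mul (c : K) (f : MvPolynomial σ K) : l1 (C c * f) = ‖c‖ * l1 f := by
  rcases eq_or_ne c 0 with rfl | hc
  · simp
  · have : (C c * f).support = f.support := by
      ext d; simp [mem_support_iff, coeff_C_mul, hc]
    simp [l1, this, coeff_C_mul, Finset.mul_sum]

theorem l1_pow_le (f : MvPolynomial σ K) (n : ℕ) : l1 (f ^ n) ≤ l1 f ^ n := by
  induction n with
  | zero => simp [← C_1, -map_one]
  | succ n ih =>
    rw [pow_succ, pow_succ]
    exact (l1_mul_le _ _).trans (mul_le_mul_of_nonneg_right ih (l1_nonneg _))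

theorem l1_prod_le {ι : Type*} (s : Finset ι) (f : ι → MvPolynomial σ K) :
    l1 (∏ i ∈ s, f i) ≤ ∏ i ∈ s, l1 (f i) := by
  classical
  induction s using Finset.induction_on with
  | empty => simp [← C_1, -map_one]
  | insert a s ha ih =>
    rw [Finset.prod_insert ha, Finset.prod_insert ha]
    exact (l1_mul_le _ _).trans (mul_le_mul_of_nonneg_left ih (l1_nonneg _))

theorem eq_zero_of_l1_eq_zero {f : MvPolynomial σ K} (h : l1 f = 0) : f = 0 := by
  by_contra hf
  obtain ⟨d, hd⟩ := support_nonempty.2 hf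
  have := (Finset.sum_eq_zero_iff_of_nonneg fun _ _ => norm_nonneg _).1 h d hd
  exact (mem_support_iff.1 hd) (norm_eq_zero.1 this)

/-- Differentiation shifts the monomials that contain v injectively, so no two terms merge and the
norm is computed exactly. -/
theorem l1_pderiv (v : σ) (f : MvPolynomial σ K) :
    l1 (pderiv v f) = ∑ d ∈ f.support, (d v : ℝ) * ‖f.coeff d‖ := by
  classical
  have h1 : ∑ d ∈ f.support, (d v : ℝ) * ‖f.coeff d‖
      = ∑ d ∈ f.support with d v ≠ 0, (d v : ℝ) * ‖f.coeff d‖ := by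
    rw [Finset.sum_filter]
    refine Finset.sum_congr rfl fun d _ => ?_
    split_ifs with h
    · rfl
    · simp [not_not.1 h]
  rw [h1, l1]
  refine Finset.sum_nbij' (fun d => d + Finsupp.single v 1) (fun d => d - Finsupp.single v 1)
    ?_ ?_ ?_ ?_ ?_
  · intro d hd
    rw [mem_support_iff, coeff_pderiv] at hd
    simp only [Finset.mem_filter, mem_support_iff]
    exact ⟨left_ne_zero_of_mul hd, by simp⟩
  · intro d hd
    simp only [Finset.mem_filter, mem_support_iff] at hd
    have : d - Finsupp.single v 1 + Finsupp.single v 1 = d :=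
      tsub_add_cancel_of_le (Finsupp.single_le_iff.2 (Nat.one_le_iff_ne_zero.2 hd.2))
    rw [mem_support_iff, coeff_pderiv, this]
    exact mul_ne_zero hd.1 (Nat.cast_add_one_ne_zero _)
  · intro d _; simp
  · intro d hd
    simp only [Finset.mem_filter, mem_support_iff] at hd
    exact tsub_add_cancel_of_le (Finsupp.single_le_iff.2 (Nat.one_le_iff_ne_zero.2 hd.2))
  · intro d _
    rw [coeff_pderiv, norm_mul]
    have : ‖((d v : K) + 1)‖ = (d v : ℝ) + 1 := by
      have h2 := RCLike.norm_natCast (K := K) (d v + 1)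
      push_cast at h2
      exact h2
    rw [this, Finsupp.add_apply, Finsupp.single_eq_same]; push_cast; ring

theorem l1_pderiv_mono {f g : MvPolynomial σ K} (h : ∀ d, ‖f.coeff d‖ ≤ ‖g.coeff d‖) (v : σ) :
    l1 (pderiv v f) ≤ l1 (pderiv v g) := by
  have hs : f.support ⊆ g.support := fun d hd => by
    rw [mem_support_iff] at hd ⊢
    intro h0
    have := h d
    rw [h0, norm_zero] at this
    exact hd (norm_le_zero_iff.1 this)
  rw [l1_pderiv, l1_pderiv]
  refine (Finset.sum_le_sum_of_subset_of_nonneg hs fun _ _ _ => by positivity).trans ?_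
  exact Finset.sum_le_sum fun d _ => mul_le_mul_of_nonneg_left (h d) (by positivity)

/-- Euler's identity for the absolute values of the coefficients. -/
theorem sum_l1_pderiv [Fintype σ] {f : MvPolynomial σ K} {n : ℕ} (hf : f.IsHomogeneous n) :
    ∑ v, l1 (pderiv v f) = n * l1 f := by
  simp_rw [l1_pderiv]
  rw [Finset.sum_comm, l1, Finset.mul_sum]
  refine Finset.sum_congr rfl fun d hd => ?_
  rw [← Finset.sum_mul]
  congr 1
  have := hf (mem_support_iff.1 hd)
  rw [← this]
  simp [Finsupp.weight_apply, Finsupp.sum_fintype]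

variable [Fintype σ] [Nonempty σ]

/-- The largest norm of a partial derivative. -/
def gn (f : MvPolynomial σ K) : ℝ := Finset.univ.sup' Finset.univ_nonempty fun v => l1 (pderiv v f)

theorem l1_pderiv_le_gn (f : MvPolynomial σ K) (v : σ) : l1 (pderiv v f) ≤ gn f :=
  Finset.le_sup' (fun v => l1 (pderiv v f)) (Finset.mem_univ v)

theorem gn_le {f : MvPolynomial σ K} {c : ℝ} (h : ∀ v, l1 (pderiv v f) ≤ c) : gn f ≤ c :=
  Finset.sup'_le _ _ fun v _ => h v

theorem gn_nonneg (f : MvPolynomial σ K) : 0 ≤ gn f :=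
  (l1_nonneg _).trans (l1_pderiv_le_gn f (Classical.arbitrary σ))

@[simp] theorem gn_zero : gn (0 : MvPolynomial σ K) = 0 :=
  le_antisymm (gn_le fun v => by simp) (gn_nonneg _)

theorem gn_neg (f : MvPolynomial σ K) : gn (-f) = gn f := by
  simp [gn, l1_neg]

theorem gn_add_le (f g : MvPolynomial σ K) : gn (f + g) ≤ gn f + gn g :=
  gn_le fun v => by
    rw [map_add]
    exact (l1_add_le _ _).trans (add_le_add (l1_pderiv_le_gn _ _) (l1_pderiv_le_gn _ _))

theorem gn_sub_le (f g : MvPolynomial σ K) : gn (f - g) ≤ gn f + gn g := by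
  rw [sub_eq_add_neg, ← gn_neg g]; exact gn_add_le _ _

theorem gn_sum_le {ι : Type*} (s : Finset ι) (f : ι → MvPolynomial σ K) :
    gn (∑ i ∈ s, f i) ≤ ∑ i ∈ s, gn (f i) := by
  classical
  induction s using Finset.induction_on with
  | empty => simp
  | insert a s ha ih =>
    rw [Finset.sum_insert ha, Finset.sum_insert ha]
    exact (gn_add_le _ _).trans (by gcongr)

theorem gn_mono {f g : MvPolynomial σ K} (h : ∀ d, ‖f.coeff d‖ ≤ ‖g.coeff d‖) : gn f ≤ gn g :=
  gn_le fun v => (l1_pderiv_mono h v).trans (l1_pderiv_le_gn g v)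

theorem gn_C_mul_le (c : K) (f : MvPolynomial σ K) : gn (C c * f) ≤ ‖c‖ * gn f :=
  gn_le fun v => by
    rw [pderiv_C_mul, l1_C_mul]
    exact mul_le_mul_of_nonneg_left (l1_pderiv_le_gn _ _) (norm_nonneg _)

/-- Passing from `gn` back to `l1` costs the number of variables. This is where the single factor N
of the final estimate comes from. -/
theorem mul_l1_le_gn {f : MvPolynomial σ K} {n : ℕ} (hf : f.IsHomogeneous n) :
    n * l1 f ≤ Fintype.card σ * gn f := by
  rw [← sum_l1_pderiv hf]
  refine (Finset.sum_le_sum fun v _ => l1_pderiv_le_gn f v).trans ?_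
  simp

theorem eq_zero_of_gn_eq_zero {f : MvPolynomial σ K} {n : ℕ} (hf : f.IsHomogeneous n)
    (hn : n ≠ 0) (h : gn f = 0) : f = 0 := by
  have h1 := mul_l1_le_gn hf
  rw [h, mul_zero] at h1
  have : (0 : ℝ) < n := by positivity
  exact eq_zero_of_l1_eq_zero (le_antisymm (by nlinarith) (l1_nonneg f))

end Norms

/-! ### Norms under substitution -/

section ChainRule

variable {σ τ K : Type*} [RCLike K]

theorem derivation_algHom_apply {R B : Type*} [CommRing R] [CommRing B] [Algebra R B] [Fintype σ]
    (φ : MvPolynomial σ R →ₐ[R] B) (D : Derivation R B B) (f : MvPolynomial σ R) :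
    D (φ f) = ∑ v, φ (pderiv v f) * D (φ (X v)) := by
  classical
  induction f using MvPolynomial.induction_on with
  | C a =>
    have : φ (C a) = algebraMap R B a := φ.commutes a
    simp [this]
  | add f g hf hg => simp [hf, hg, add_mul, Finset.sum_add_distrib]
  | mul_X f w hf =>
    simp only [map_mul, Derivation.leibniz, hf, smul_eq_mul, map_add, add_mul,
      Finset.sum_add_distrib, pderiv_X, Finset.mul_sum]
    congr 1
    · rw [Finset.sum_eq_single w]
      · simp
      · intro b _ hb; simp [hb.symm]
      · simp
    · exact Finset.sum_congr rfl fun v _ => by ring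

variable {L : Type*} [RCLike L] [Algebra K L] [NormSMulClass K L]

theorem l1_algHom_le [Fintype σ] (φ : MvPolynomial σ K →ₐ[K] MvPolynomial τ L) {c : ℝ}
    (hc : ∀ v, l1 (φ (X v)) ≤ c) {f : MvPolynomial σ K} {n : ℕ} (hf : f.IsHomogeneous n) :
    l1 (φ f) ≤ c ^ n * l1 f := by
  conv_lhs => rw [f.as_sum, map_sum]
  refine (l1_sum_le _ _).trans ?_
  rw [l1, Finset.mul_sum]
  refine Finset.sum_le_sum fun d hd => ?_
  have h1 : φ (monomial d (f.coeff d))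
      = C (algebraMap K L (f.coeff d)) * ∏ v, φ (X v) ^ d v := by
    rw [monomial_eq, map_mul, Finsupp.prod_fintype _ _ (by simp), map_prod]
    congr 1
    · rw [← algebraMap_eq, φ.commutes]
      rfl
    · simp
  rw [h1, l1_C_mul, mul_comm]
  have hn : ∑ v, d v = n := by
    rw [← hf (mem_support_iff.1 hd)]
    simp [Finsupp.weight_apply, Finsupp.sum_fintype]
  have h2 : l1 (∏ v, φ (X v) ^ d v) ≤ c ^ n := by
    refine (l1_prod_le _ _).trans ?_
    rw [← hn, ← Finset.prod_pow_eq_pow_sum]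
    refine Finset.prod_le_prod (fun v _ => l1_nonneg _) fun v _ => ?_
    exact (l1_pow_le _ _).trans (pow_le_pow_left₀ (l1_nonneg _) (hc v) _)
  have h3 : ‖algebraMap K L (f.coeff d)‖ = ‖f.coeff d‖ := by
    rw [Algebra.algebraMap_eq_smul_one, norm_smul, norm_one, mul_one]
  rw [h3]
  exact mul_le_mul_of_nonneg_right h2 (norm_nonneg _)

/-- By the chain rule, all factors but one are estimated by the row sums c of the substitution and
the differentiated one by its column sums c'. Both are independent of N for matrices with decaying
entries. Allowing K and L to differ covers the passage to complex coordinates. -/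
theorem gn_algHom_le [Fintype σ] [Nonempty σ] [Fintype τ] [Nonempty τ]
    (φ : MvPolynomial σ K →ₐ[K] MvPolynomial τ L) {c c' : ℝ}
    (hc : ∀ v, l1 (φ (X v)) ≤ c) (hc' : ∀ w, ∑ v, l1 (pderiv w (φ (X v))) ≤ c')
    {f : MvPolynomial σ K} {n : ℕ} (hf : f.IsHomogeneous n) :
    gn (φ f) ≤ c' * c ^ (n - 1) * gn f := by
  have hc0 : 0 ≤ c := (l1_nonneg _).trans (hc (Classical.arbitrary σ))
  refine gn_le fun w => ?_
  have := derivation_algHom_apply φ ((pderiv w : Derivation L _ _).restrictScalars K) f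
  simp only [Derivation.restrictScalars_apply] at this
  rw [this]
  refine (l1_sum_le _ _).trans ?_
  calc ∑ v, l1 (φ (pderiv v f) * pderiv w (φ (X v)))
      ≤ ∑ v, (c ^ (n - 1) * gn f) * l1 (pderiv w (φ (X v))) :=
        Finset.sum_le_sum fun v _ => (l1_mul_le _ _).trans
          (mul_le_mul_of_nonneg_right ((l1_algHom_le φ hc hf.pderiv).trans
            (mul_le_mul_of_nonneg_left (l1_pderiv_le_gn f v) (by positivity))) (l1_nonneg _))
    _ = (c ^ (n - 1) * gn f) * ∑ v, l1 (pderiv w (φ (X v))) := by rw [Finset.mul_sum]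
    _ ≤ (c ^ (n - 1) * gn f) * c' :=
        mul_le_mul_of_nonneg_left (hc' w) (mul_nonneg (by positivity) (gn_nonneg _))
    _ = _ := by ring

end ChainRule

/-! ### Algebra of the Poisson bracket -/

section Bracket

variable {N : ℕ} [NeZero N] {R S : Type*} [CommRing R] [CommRing S]

theorem pderiv_comm {σ : Type*} (v w : σ) (f : MvPolynomial σ R) :
    pderiv v (pderiv w f) = pderiv w (pderiv v f) := by
  classical
  have : ⁅(pderiv v : Derivation R (MvPolynomial σ R) (MvPolynomial σ R)),
      (pderiv w : Derivation R (MvPolynomial σ R) (MvPolynomial σ R))⁆ = 0 := by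
    refine derivation_ext fun i => ?_
    simp only [Derivation.commutator_apply, pderiv_X, Derivation.zero_apply]
    rcases eq_or_ne i v with rfl | h1 <;> rcases eq_or_ne i w with rfl | h2 <;>
      simp [*]
  have h := congrArg (fun D => D f) this
  simpa [Derivation.commutator_apply, sub_eq_zero] using h

/-- The Poisson bracket with coefficients in an arbitrary commutative ring, as a derivation of its
second argument. -/
def pbD (f : MvPolynomial (Var N) R) :
    Derivation R (MvPolynomial (Var N) R) (MvPolynomial (Var N) R) :=
  ∑ l : ZMod N, (pderiv (Sum.inl l) f • pderiv (Sum.inr l)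
    - pderiv (Sum.inr l) f • pderiv (Sum.inl l))

/-- The Poisson bracket with coefficients in an arbitrary commutative ring. -/
def pb (f g : MvPolynomial (Var N) R) : MvPolynomial (Var N) R :=
  ∑ l : ZMod N, (pderiv (Sum.inl l) f * pderiv (Sum.inr l) g
    - pderiv (Sum.inr l) f * pderiv (Sum.inl l) g)

theorem poisson_eq_pb (f g : Poly N) : poisson f g = pb f g := rfl

theorem pbD_apply (f g : MvPolynomial (Var N) R) : pbD f g = pb f g := by
  have h : ∀ (s : Finset (ZMod N)) (D : ZMod N → Derivation R (MvPolynomial (Var N) R)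
      (MvPolynomial (Var N) R)), (∑ l ∈ s, D l) g = ∑ l ∈ s, D l g := fun s D => by
    classical
    induction s using Finset.induction_on with
    | empty => simp
    | insert a s ha ih => rw [Finset.sum_insert ha, Finset.sum_insert ha, Derivation.add_apply, ih]
  rw [pbD, h]
  simp [pb]

theorem pb_antisymm (f g : MvPolynomial (Var N) R) : pb f g = -pb g f := by
  rw [pb, pb, ← Finset.sum_neg_distrib]
  exact Finset.sum_congr rfl fun l _ => by ring

theorem pb_add_right (f g h : MvPolynomial (Var N) R) : pb f (g + h) = pb f g + pb f h := by
  simp [← pbD_apply]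

theorem pb_sub_right (f g h : MvPolynomial (Var N) R) : pb f (g - h) = pb f g - pb f h := by
  simp [← pbD_apply]

theorem pb_neg_right (f g : MvPolynomial (Var N) R) : pb f (-g) = -pb f g := by
  simp [← pbD_apply]

@[simp] theorem pb_zero_right (f : MvPolynomial (Var N) R) : pb f 0 = 0 := by
  simp [← pbD_apply]

theorem pb_sum_right {ι : Type*} (s : Finset ι) (f : MvPolynomial (Var N) R)
    (g : ι → MvPolynomial (Var N) R) : pb f (∑ i ∈ s, g i) = ∑ i ∈ s, pb f (g i) := by
  simp [← pbD_apply]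

theorem pb_C_mul_right (c : R) (f g : MvPolynomial (Var N) R) :
    pb f (C c * g) = C c * pb f g := by
  simp only [← pbD_apply, C_mul', Derivation.map_smul]

theorem pb_mul_right (f g h : MvPolynomial (Var N) R) :
    pb f (g * h) = g * pb f h + h * pb f g := by
  simp [← pbD_apply]

theorem pb_add_left (f g h : MvPolynomial (Var N) R) : pb (f + g) h = pb f h + pb g h := by
  rw [pb_antisymm, pb_add_right, pb_antisymm h f, pb_antisymm h g]; ring

theorem pb_sub_left (f g h : MvPolynomial (Var N) R) : pb (f - g) h = pb f h - pb g h := by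
  rw [pb_antisymm, pb_sub_right, pb_antisymm h f, pb_antisymm h g]; ring

theorem pb_neg_left (f g : MvPolynomial (Var N) R) : pb (-f) g = -pb f g := by
  rw [pb_antisymm, pb_neg_right, pb_antisymm g f, neg_neg]

theorem pb_sum_left {ι : Type*} (s : Finset ι) (f : ι → MvPolynomial (Var N) R)
    (g : MvPolynomial (Var N) R) : pb (∑ i ∈ s, f i) g = ∑ i ∈ s, pb (f i) g := by
  rw [pb_antisymm, pb_sum_right, ← Finset.sum_neg_distrib]
  exact Finset.sum_congr rfl fun i _ => (pb_antisymm _ _).symm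

theorem pb_C_mul_left (c : R) (f g : MvPolynomial (Var N) R) :
    pb (C c * f) g = C c * pb f g := by
  rw [pb_antisymm, pb_C_mul_right, pb_antisymm g f]; ring

theorem pb_mul_left (f g h : MvPolynomial (Var N) R) :
    pb (f * g) h = f * pb g h + g * pb f h := by
  rw [pb_antisymm, pb_mul_right, pb_antisymm h f, pb_antisymm h g]; ring

theorem pb_X_inr_right (f : MvPolynomial (Var N) R) (l : ZMod N) :
    pb f (X (Sum.inr l)) = pderiv (Sum.inl l) f := by
  rw [pb, Finset.sum_eq_single l]
  · rw [pderiv_X_self, pderiv_X_of_ne (by simp)]; ring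
  · intro b _ hb
    rw [pderiv_X_of_ne (by simpa using hb.symm), pderiv_X_of_ne (by simp)]; ring
  · simp

theorem pb_X_inl_right (f : MvPolynomial (Var N) R) (l : ZMod N) :
    pb f (X (Sum.inl l)) = -pderiv (Sum.inr l) f := by
  rw [pb, Finset.sum_eq_single l]
  · rw [pderiv_X_self, pderiv_X_of_ne (by simp)]; ring
  · intro b _ hb
    rw [pderiv_X_of_ne (by simp), pderiv_X_of_ne (by simpa using hb.symm)]; ring
  · simp

theorem pb_X_inl_inl (i j : ZMod N) :
    pb (X (Sum.inl i) : MvPolynomial (Var N) R) (X (Sum.inl j)) = 0 := by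
  rw [pb_X_inl_right, pderiv_X_of_ne (by simp), neg_zero]

theorem pb_X_inr_inr (i j : ZMod N) :
    pb (X (Sum.inr i) : MvPolynomial (Var N) R) (X (Sum.inr j)) = 0 := by
  rw [pb_X_inr_right, pderiv_X_of_ne (by simp)]

theorem pb_X_inl_inr (i j : ZMod N) :
    pb (X (Sum.inl i) : MvPolynomial (Var N) R) (X (Sum.inr j)) = if i = j then 1 else 0 := by
  rw [pb_X_inr_right]
  split_ifs with h
  · rw [h, pderiv_X_self]
  · rw [pderiv_X_of_ne (by simpa using h)]

theorem pderiv_pb (v : Var N) (f g : MvPolynomial (Var N) R) :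
    pderiv v (pb f g) = pb (pderiv v f) g + pb f (pderiv v g) := by
  simp only [pb, map_sum, map_sub, pderiv_mul, ← Finset.sum_add_distrib]
  refine Finset.sum_congr rfl fun l _ => ?_
  rw [pderiv_comm v (Sum.inl l) f, pderiv_comm v (Sum.inr l) f, pderiv_comm v (Sum.inl l) g,
    pderiv_comm v (Sum.inr l) g]
  ring

/-- The commutator of the derivations {f, ·} and {g, ·} is a derivation, so it suffices to compare
it with {{f, g}, ·} on the variables, where the claim is the Leibniz rule for ∂_v of a bracket. -/
theorem pb_jacobi (f g h : MvPolynomial (Var N) R) :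
    pb f (pb g h) = pb (pb f g) h + pb g (pb f h) := by
  have : ⁅pbD f, pbD g⁆ = pbD (pb f g) := by
    refine derivation_ext fun i => ?_
    rw [Derivation.commutator_apply, pbD_apply, pbD_apply, pbD_apply, pbD_apply, pbD_apply]
    rcases i with l | l
    · rw [pb_X_inl_right, pb_X_inl_right, pb_X_inl_right, pderiv_pb, pb_neg_right, pb_neg_right,
        pb_antisymm g]
      ring
    · rw [pb_X_inr_right, pb_X_inr_right, pb_X_inr_right, pderiv_pb, pb_antisymm g]
      ring
  have h1 := congrArg (fun D => D h) this
  simp only [Derivation.commutator_apply, pbD_apply] at h1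
  rw [← h1]; ring

theorem isHomogeneous_pb {f g : MvPolynomial (Var N) R} {m n : ℕ} (hf : f.IsHomogeneous (m + 1))
    (hg : g.IsHomogeneous (n + 1)) : (pb f g).IsHomogeneous (m + n) := by
  refine IsHomogeneous.sum _ _ _ fun l _ => ?_
  have h1 : ∀ v, (pderiv v f).IsHomogeneous m := fun v => hf.pderiv
  have h2 : ∀ v, (pderiv v g).IsHomogeneous n := fun v => hg.pderiv
  exact ((h1 _).mul (h2 _)).sub ((h1 _).mul (h2 _))

/-- A substitution that respects the brackets of the coordinates respects all brackets, by the chain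
rule in each argument. The factor ε is there for the reversal of the momenta, which has ε = -1. -/
theorem pb_algHom [Algebra R S] (φ : MvPolynomial (Var N) R →ₐ[R] MvPolynomial (Var N) S)
    (ε : MvPolynomial (Var N) S)
    (h1 : ∀ i j, pb (φ (X (Sum.inl i))) (φ (X (Sum.inl j))) = 0)
    (h2 : ∀ i j, pb (φ (X (Sum.inr i))) (φ (X (Sum.inr j))) = 0)
    (h3 : ∀ i j, pb (φ (X (Sum.inl i))) (φ (X (Sum.inr j))) = if i = j then ε else 0)
    (f g : MvPolynomial (Var N) R) : pb (φ f) (φ g) = ε * φ (pb f g) := by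
  have key : ∀ (F : MvPolynomial (Var N) S) (g : MvPolynomial (Var N) R),
      pb F (φ g) = ∑ v, φ (pderiv v g) * pb F (φ (X v)) := fun F g => by
    have := derivation_algHom_apply φ ((pbD F).restrictScalars R) g
    simpa [Derivation.restrictScalars_apply, pbD_apply] using this
  have e1 : ∀ j, pb (φ f) (φ (X (Sum.inr j))) = ε * φ (pderiv (Sum.inl j) f) := fun j => by
    rw [pb_antisymm, key, Fintype.sum_sum_type]
    have h3' : ∀ i, pb (φ (X (Sum.inr j))) (φ (X (Sum.inl i))) = if i = j then -ε else 0 :=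
      fun i => by rw [pb_antisymm, h3]; split_ifs <;> simp
    simp [h2, h3', mul_comm]
  have e2 : ∀ j, pb (φ f) (φ (X (Sum.inl j))) = -(ε * φ (pderiv (Sum.inr j) f)) := fun j => by
    rw [pb_antisymm, key, Fintype.sum_sum_type]
    simp [h1, h3, mul_comm]
  rw [key, Fintype.sum_sum_type, pb, map_sum, Finset.mul_sum, ← Finset.sum_add_distrib]
  refine Finset.sum_congr rfl fun l _ => ?_
  rw [e1, e2, map_sub, map_mul, map_mul]
  ring

end Bracket

/-! ### Norm of a bracket -/

section BracketNorm

variable {N : ℕ} [NeZero N] {K : Type*} [RCLike K]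

/-- The derivatives of g are bounded uniformly by `gn g`, and those of f are summed over all
variables by Euler's identity. -/
theorem l1_pb_le {f g : MvPolynomial (Var N) K} {m : ℕ} (hf : f.IsHomogeneous m) :
    l1 (pb f g) ≤ m * l1 f * gn g := by
  rw [← sum_l1_pderiv hf, Fintype.sum_sum_type, ← Finset.sum_add_distrib, Finset.sum_mul]
  refine (l1_sum_le _ _).trans (Finset.sum_le_sum fun l _ => (l1_sub_le _ _).trans ?_)
  rw [add_mul]
  exact add_le_add
    ((l1_mul_le _ _).trans (mul_le_mul_of_nonneg_left (l1_pderiv_le_gn _ _) (l1_nonneg _)))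
    ((l1_mul_le _ _).trans (mul_le_mul_of_nonneg_left (l1_pderiv_le_gn _ _) (l1_nonneg _)))

/-- The bracket estimate: the norm `gn` loses only the degree of the bracket. -/
theorem gn_pb_le {f g : MvPolynomial (Var N) K} {m n : ℕ} (hf : f.IsHomogeneous (m + 1))
    (hg : g.IsHomogeneous (n + 1)) : gn (pb f g) ≤ (m + n) * gn f * gn g := by
  refine gn_le fun v => ?_
  -- The factor hit by ∂_v has bounded ℓ¹ norm even when the whole polynomial does not, so
  -- `l1_pb_le` is applied with that factor in first position. The sum over sites is thereby done by
  -- Euler's identity, without a factor N.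
  rw [pderiv_pb, pb_antisymm f]
  refine (l1_add_le _ _).trans ?_
  rw [l1_neg]
  have h1 : l1 (pb (pderiv v f) g) ≤ m * gn f * gn g :=
    (l1_pb_le (m := m) hf.pderiv).trans
      (mul_le_mul_of_nonneg_right (mul_le_mul_of_nonneg_left (l1_pderiv_le_gn _ _)
        (by positivity)) (gn_nonneg _))
  have h2 : l1 (pb (pderiv v g) f) ≤ n * gn g * gn f :=
    (l1_pb_le (m := n) hg.pderiv).trans
      (mul_le_mul_of_nonneg_right (mul_le_mul_of_nonneg_left (l1_pderiv_le_gn _ _)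
        (by positivity)) (gn_nonneg _))
  nlinarith

end BracketNorm

/-! ### Translations, reversal of the momenta, linear canonical maps -/

section Symmetries

variable {N : ℕ} [NeZero N]

theorem shift_pb (s : ZMod N) (f g : Poly N) : shift s (pb f g) = pb (shift s f) (shift s g) := by
  have := pb_algHom (rename (Sum.map (fun j => j + s) (fun j => j + s)) : Poly N →ₐ[ℝ] Poly N) 1
    (fun i j => by simp [pb_X_inl_inl]) (fun i j => by simp [pb_X_inr_inr])
    (fun i j => by simp [pb_X_inl_inr]) f g
  rw [one_mul] at this
  exact this.symm

/-- Reversal of the momenta. -/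
def reversal : Poly N →ₐ[ℝ] Poly N :=
  aeval (Sum.elim (fun i => X (Sum.inl i)) (fun i => -X (Sum.inr i)))

@[simp] theorem reversal_X_inl (i : ZMod N) :
    reversal (X (Sum.inl i) : Poly N) = X (Sum.inl i) := by simp [reversal]

@[simp] theorem reversal_X_inr (i : ZMod N) :
    reversal (X (Sum.inr i) : Poly N) = -X (Sum.inr i) := by simp [reversal]

theorem pb_reversal (f g : Poly N) : pb (reversal f) (reversal g) = -reversal (pb f g) := by
  rw [pb_algHom reversal (-1) (fun i j => by simp [pb_X_inl_inl])
    (fun i j => by simp [pb_neg_left, pb_neg_right, pb_X_inr_inr])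
    (fun i j => by
      rw [reversal_X_inl, reversal_X_inr, pb_neg_right, pb_X_inl_inr]; split_ifs <;> simp)]
  ring

/-- `linSubst` as an algebra homomorphism. -/
def linSubstHom (M M' : Matrix (ZMod N) (ZMod N) ℝ) : Poly N →ₐ[ℝ] Poly N :=
  aeval (Sum.elim (fun i => ∑ j, C (M i j) * (X (Sum.inl j) : Poly N))
    (fun i => ∑ j, C (M' i j) * (X (Sum.inr j) : Poly N)))

theorem linSubst_eq (M M' : Matrix (ZMod N) (ZMod N) ℝ) (f : Poly N) :
    linSubst M M' f = linSubstHom M M' f := rfl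

@[simp] theorem linSubstHom_X_inl (M M' : Matrix (ZMod N) (ZMod N) ℝ) (i : ZMod N) :
    linSubstHom M M' (X (Sum.inl i)) = ∑ j, C (M i j) * X (Sum.inl j) := by simp [linSubstHom]

@[simp] theorem linSubstHom_X_inr (M M' : Matrix (ZMod N) (ZMod N) ℝ) (i : ZMod N) :
    linSubstHom M M' (X (Sum.inr i)) = ∑ j, C (M' i j) * X (Sum.inr j) := by simp [linSubstHom]

theorem linSubstHom_C (M M' : Matrix (ZMod N) (ZMod N) ℝ) (c : ℝ) :
    linSubstHom M M' (C c) = C c := by simp [linSubstHom]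

theorem linSubstHom_comp (M M' L L' : Matrix (ZMod N) (ZMod N) ℝ) (f : Poly N) :
    linSubstHom L L' (linSubstHom M M' f) = linSubstHom (M * L) (M' * L') f := by
  have : (linSubstHom L L').comp (linSubstHom M M') = linSubstHom (M * L) (M' * L') := by
    refine algHom_ext fun v => ?_
    rcases v with i | i <;>
    · simp only [AlgHom.comp_apply, linSubstHom_X_inl, linSubstHom_X_inr, map_sum, map_mul,
        linSubstHom_C, Finset.mul_sum, Matrix.mul_apply, Finset.sum_mul]
      rw [Finset.sum_comm]
      exact Finset.sum_congr rfl fun j _ => Finset.sum_congr rfl fun k _ => by ring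
  exact congrArg (fun φ => φ f) this

theorem linSubstHom_one (f : Poly N) : linSubstHom 1 1 f = f := by
  have : linSubstHom (1 : Matrix (ZMod N) (ZMod N) ℝ) 1 = AlgHom.id ℝ (Poly N) := by
    refine algHom_ext fun v => ?_
    rcases v with i | i <;> simp [Matrix.one_apply, ite_mul]
  exact congrArg (fun φ => φ f) this

/-- The hypothesis makes M' the inverse transpose of M, which is the condition for the map to be
symplectic. -/
theorem pb_linSubstHom {M M' : Matrix (ZMod N) (ZMod N) ℝ} (h : M * M'.transpose = 1)
    (f g : Poly N) : pb (linSubstHom M M' f) (linSubstHom M M' g) = linSubstHom M M' (pb f g) := by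
  rw [pb_algHom (linSubstHom M M') 1, one_mul]
  · intro i j
    simp [pb_sum_left, pb_sum_right, pb_C_mul_left, pb_C_mul_right, pb_X_inl_inl]
  · intro i j
    simp [pb_sum_left, pb_sum_right, pb_C_mul_left, pb_C_mul_right, pb_X_inr_inr]
  · intro i j
    simp only [linSubstHom_X_inl, linSubstHom_X_inr, pb_sum_left, pb_sum_right, pb_C_mul_left,
      pb_C_mul_right, pb_X_inl_inr, mul_ite, mul_one, mul_zero, Finset.sum_ite_eq',
      Finset.mem_univ, if_true]
    have h1 := congrFun (congrFun h i) j
    rw [Matrix.mul_apply, Matrix.one_apply] at h1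
    simp only [Matrix.transpose_apply] at h1
    simp only [← map_mul, ← map_sum]
    simp_rw [mul_comm (M' j _)]
    rw [h1]
    split_ifs <;> simp

theorem reversal_linSubstHom (M M' : Matrix (ZMod N) (ZMod N) ℝ) (f : Poly N) :
    reversal (linSubstHom M M' f) = linSubstHom M M' (reversal f) := by
  have : (reversal.comp (linSubstHom M M')) = (linSubstHom M M').comp reversal := by
    refine algHom_ext fun v => ?_
    rcases v with i | i <;> simp
  exact congrArg (fun φ => φ f) this

/-- `shift` as an algebra homomorphism. -/
def shiftHom (s : ZMod N) : Poly N →ₐ[ℝ] Poly N :=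
  rename (Sum.map (fun j => j + s) (fun j => j + s))

theorem shift_eq (s : ZMod N) (f : Poly N) : shift s f = shiftHom s f := rfl

@[simp] theorem shiftHom_X_inl (s i : ZMod N) :
    shiftHom s (X (Sum.inl i)) = X (Sum.inl (i + s)) := by simp [shiftHom]

@[simp] theorem shiftHom_X_inr (s i : ZMod N) :
    shiftHom s (X (Sum.inr i)) = X (Sum.inr (i + s)) := by simp [shiftHom]

theorem shiftHom_C (s : ZMod N) (c : ℝ) : shiftHom s (C c) = C c := by simp [shiftHom]

theorem shiftHom_shiftHom (s t : ZMod N) (f : Poly N) :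
    shiftHom s (shiftHom t f) = shiftHom (t + s) f := by
  have : (shiftHom s).comp (shiftHom t) = shiftHom (N := N) (t + s) := by
    refine algHom_ext fun v => ?_
    rcases v with i | i <;> simp [add_assoc]
  exact congrArg (fun φ => φ f) this

theorem shiftHom_linSubstHom {M M' : Matrix (ZMod N) (ZMod N) ℝ}
    (hM : ∀ i j, M (i + 1) (j + 1) = M i j) (hM' : ∀ i j, M' (i + 1) (j + 1) = M' i j) (f : Poly N) :
    shiftHom 1 (linSubstHom M M' f) = linSubstHom M M' (shiftHom 1 f) := by
  have : (shiftHom 1).comp (linSubstHom M M') = (linSubstHom M M').comp (shiftHom 1) := by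
    refine algHom_ext fun v => ?_
    rcases v with i | i
    · simp only [AlgHom.comp_apply, linSubstHom_X_inl, map_sum, map_mul, shiftHom_C,
        shiftHom_X_inl]
      exact Fintype.sum_equiv (Equiv.addRight 1) _ _ fun j => by simp [hM]
    · simp only [AlgHom.comp_apply, linSubstHom_X_inr, map_sum, map_mul, shiftHom_C,
        shiftHom_X_inr]
      exact Fintype.sum_equiv (Equiv.addRight 1) _ _ fun j => by simp [hM']
  exact congrArg (fun φ => φ f) this

theorem shiftHom_pb (s : ZMod N) (f g : Poly N) :
    shiftHom s (pb f g) = pb (shiftHom s f) (shiftHom s g) := shift_pb s f g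

end Symmetries

/-! ### Distance on the ring and geometric sums -/

section CyclicDistance

variable {N : ℕ} [NeZero N]

/-- The distance of a site from the origin, along the ring. -/
def zd (k : ZMod N) : ℕ := k.valMinAbs.natAbs

@[simp] theorem zd_zero : zd (0 : ZMod N) = 0 := by simp [zd]

theorem zd_neg (k : ZMod N) : zd (-k) = zd k := ZMod.natAbs_valMinAbs_neg k

theorem zd_add_le (k l : ZMod N) : zd (k + l) ≤ zd k + zd l :=
  (ZMod.natAbs_valMinAbs_add_le k l).trans (Int.natAbs_add_le _ _)

theorem zd_one_le : zd (1 : ZMod N) ≤ 1 := by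
  rw [zd, ZMod.valMinAbs_natAbs_eq_min]
  exact (min_le_left _ _).trans (by
    have := ZMod.val_one_eq_one_mod N
    rw [this]; exact Nat.mod_le _ _)

theorem sum_pow_val_le {x : ℝ} (h0 : 0 ≤ x) (h1 : x < 1) :
    ∑ k : ZMod N, x ^ k.val ≤ (1 - x)⁻¹ := by
  rw [← Finset.sum_image (f := fun n : ℕ => x ^ n) (g := ZMod.val)
    (fun a _ b _ h => ZMod.val_injective N h)]
  exact Summable.sum_le_tsum _ (fun _ _ => by positivity) (summable_geometric_of_lt_one h0 h1)
    |>.trans_eq (tsum_geometric_of_lt_one h0 h1)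

/-- The distance is the smaller of the representatives of k and -k, so each term is at most the sum
of two terms of geometric series. Omitting k = 0 gains the factor x that makes Z₀ small. -/
theorem sum_pow_zd_ne_zero_le {x : ℝ} (h0 : 0 ≤ x) (h1 : x < 1) :
    ∑ k : ZMod N, (if k = 0 then 0 else x ^ zd k) ≤ 2 * (x / (1 - x)) := by
  have hx : (1 - x)⁻¹ - 1 = x / (1 - x) := by
    have : 1 - x ≠ 0 := by linarith
    field_simp; ring
  have e1 : ∑ k : ZMod N, (if k = 0 then 0 else x ^ k.val) ≤ x / (1 - x) := by
    have h2 : ∑ k : ZMod N, (if k = 0 then (0 : ℝ) else x ^ k.val)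
        = ∑ k : ZMod N, x ^ k.val - 1 := by
      rw [← Finset.sum_erase_add _ _ (Finset.mem_univ (0 : ZMod N)),
        ← Finset.sum_erase_add (Finset.univ : Finset (ZMod N)) _ (Finset.mem_univ (0 : ZMod N))]
      simp only [if_true, ZMod.val_zero, pow_zero, add_zero, add_sub_cancel_right]
      exact Finset.sum_congr rfl fun k hk => by rw [if_neg (Finset.ne_of_mem_erase hk)]
    rw [h2, ← hx]
    linarith [sum_pow_val_le (N := N) h0 h1]
  have e2 : ∑ k : ZMod N, (if k = 0 then 0 else x ^ (-k).val) ≤ x / (1 - x) := by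
    refine le_trans (le_of_eq ?_) e1
    exact Fintype.sum_equiv (Equiv.neg (ZMod N)) _ _ fun k => by simp
  refine le_trans ?_ (le_trans (add_le_add e1 e2) (by rw [two_mul]))
  rw [← Finset.sum_add_distrib]
  refine Finset.sum_le_sum fun k _ => ?_
  split_ifs with hk
  · simp
  · rw [zd, ZMod.valMinAbs_natAbs_eq_min]
    have : (-k).val = N - k.val := by rw [ZMod.neg_val, if_neg hk]
    rw [this]
    rcases min_choice k.val (N - k.val) with h | h <;> rw [h]
    · linarith [pow_nonneg h0 (N - k.val)]
    · linarith [pow_nonneg h0 k.val]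

theorem sum_pow_zd_le {x : ℝ} (h0 : 0 ≤ x) (h1 : x < 1) :
    ∑ k : ZMod N, x ^ zd k ≤ 2 / (1 - x) := by
  have h2 : ∑ k : ZMod N, x ^ zd k = 1 + ∑ k : ZMod N, (if k = 0 then 0 else x ^ zd k) := by
    rw [← Finset.sum_erase_add _ _ (Finset.mem_univ (0 : ZMod N)),
      ← Finset.sum_erase_add (Finset.univ : Finset (ZMod N)) (fun k => if k = 0 then (0 : ℝ) else _)
        (Finset.mem_univ (0 : ZMod N))]
    simp only [zd_zero, pow_zero, if_true, add_zero]
    rw [add_comm]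
    congr 1
    exact Finset.sum_congr rfl fun k hk => by rw [if_neg (Finset.ne_of_mem_erase hk)]
  have := sum_pow_zd_ne_zero_le (N := N) h0 h1
  have h3 : 0 < 1 - x := by linarith
  rw [h2]
  refine (add_le_add_right this 1).trans ?_
  rw [le_div_iff₀ h3]
  field_simp
  linarith

end CyclicDistance

/-! ### Powers of A and their exponential decay -/

section Matrices

variable {N : ℕ} [NeZero N] {a : ℝ}

theorem mu_pos (ha : 0 < a) : 0 < mu a := by unfold mu omegaSq; positivity

theorem mu_le (ha : 0 < a) : mu a ≤ a := by
  unfold mu omegaSq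
  exact div_le_self ha.le (by linarith)

theorem omegaSq_mul_mu (ha : 0 < a) : omegaSq a * mu a = a := by
  unfold mu omegaSq
  field_simp

/-- The hopping matrix `μ (τ + τᵀ)`. -/
def hop (N : ℕ) (a : ℝ) : Matrix (ZMod N) (ZMod N) ℝ :=
  mu a • (tauMatrix N + (tauMatrix N).transpose)

theorem hop_apply (i j : ZMod N) :
    hop N a i j = mu a * ((if i = j + 1 then 1 else 0) + if i = j - 1 then 1 else 0) := by
  simp [hop, tauMatrix, Matrix.transpose_apply, eq_sub_iff_add_eq, eq_comm (a := j)]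

theorem hop_pow_succ_apply (m : ℕ) (i j : ZMod N) :
    (hop N a ^ (m + 1)) i j = mu a * ((hop N a ^ m) i (j + 1) + (hop N a ^ m) i (j - 1)) := by
  rw [pow_succ, Matrix.mul_apply]
  simp only [hop_apply]
  have : ∀ k, (hop N a ^ m) i k * (mu a * ((if k = j + 1 then 1 else 0) + if k = j - 1 then 1 else 0))
      = mu a * ((if k = j + 1 then (hop N a ^ m) i k else 0)
        + if k = j - 1 then (hop N a ^ m) i k else 0) := fun k => by
    split_ifs <;> ring
  simp_rw [this, ← Finset.mul_sum, Finset.sum_add_distrib]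
  simp

theorem hop_pow_nonneg (ha : 0 < a) (m : ℕ) (i j : ZMod N) : 0 ≤ (hop N a ^ m) i j := by
  induction m generalizing j with
  | zero => rw [pow_zero, Matrix.one_apply]; split_ifs <;> norm_num
  | succ m ih =>
    rw [hop_pow_succ_apply]
    exact mul_nonneg (mu_pos ha).le (add_nonneg (ih _) (ih _))

theorem hop_pow_le (ha : 0 < a) (m : ℕ) (i j : ZMod N) :
    (hop N a ^ m) i j ≤ (2 * mu a) ^ m := by
  induction m generalizing j with
  | zero => rw [pow_zero, Matrix.one_apply]; split_ifs <;> norm_num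
  | succ m ih =>
    rw [hop_pow_succ_apply, pow_succ]
    have := mu_pos ha
    nlinarith [ih (j + 1), ih (j - 1)]

/-- Finite propagation: one factor of the hopping matrix moves by at most one site. -/
theorem hop_pow_eq_zero (m : ℕ) (i j : ZMod N) (h : m < zd (i - j)) : (hop N a ^ m) i j = 0 := by
  induction m generalizing j with
  | zero =>
    rw [pow_zero, Matrix.one_apply, if_neg]
    rintro rfl
    simp at h
  | succ m ih =>
    have h1 : zd (i - j) ≤ zd (i - (j + 1)) + 1 := by
      have := zd_add_le (i - (j + 1)) 1
      rw [show i - (j + 1) + 1 = i - j by ring] at this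
      linarith [zd_one_le (N := N)]
    have h2 : zd (i - j) ≤ zd (i - (j - 1)) + 1 := by
      have := zd_add_le (i - (j - 1)) (-1)
      rw [show i - (j - 1) + -1 = i - j by ring, zd_neg] at this
      linarith [zd_one_le (N := N)]
    rw [hop_pow_succ_apply, ih _ (by omega), ih _ (by omega)]
    ring

theorem hop_pow_translate (m : ℕ) (i j : ZMod N) :
    (hop N a ^ m) (i + 1) (j + 1) = (hop N a ^ m) i j := by
  induction m generalizing j with
  | zero => simp [Matrix.one_apply]
  | succ m ih =>
    rw [hop_pow_succ_apply, hop_pow_succ_apply, ih, show j + 1 - 1 = (j - 1) + 1 by ring, ih]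

theorem matA_eq : matA N a = omegaSq a • (1 - hop N a) := rfl

theorem matA_isHermitian : (matA N a).IsHermitian := by
  rw [Matrix.IsHermitian, Matrix.conjTranspose_eq_transpose_of_trivial]
  simp [matA, add_comm]

theorem matA_mulVec (ha : 0 < a) (v : ZMod N → ℝ) (i : ZMod N) :
    (matA N a).mulVec v i = omegaSq a * v i - a * (v (i - 1) + v (i + 1)) := by
  rw [matA_eq, Matrix.smul_mulVec, Matrix.sub_mulVec, Matrix.one_mulVec]
  have : (hop N a).mulVec v i = mu a * (v (i - 1) + v (i + 1)) := by
    simp only [Matrix.mulVec, dotProduct, hop_apply, mul_assoc, ← Finset.mul_sum, add_mul, ite_mul,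
      one_mul, zero_mul, Finset.sum_add_distrib]
    have e1 : ∀ j, (i = j + 1) = (j = i - 1) := fun j => by
      rw [eq_sub_iff_add_eq]; exact propext eq_comm
    have e2 : ∀ j, (i = j - 1) = (j = i + 1) := fun j => by
      rw [eq_sub_iff_add_eq]; exact propext eq_comm
    simp [e1, e2]
  simp only [Pi.smul_apply, Pi.sub_apply, this, smul_eq_mul]
  rw [mul_sub, ← mul_assoc, omegaSq_mul_mu ha]

/-- Gershgorin: the eigenvalue equation is read at a site where the eigenvector is largest in
absolute value. -/
theorem eigenvalue_bounds (ha : 0 < a) (k : ZMod N) :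
    1 ≤ (matA_isHermitian (N := N) (a := a)).eigenvalues k ∧
      (matA_isHermitian (N := N) (a := a)).eigenvalues k ≤ 1 + 4 * a := by
  set hA := matA_isHermitian (N := N) (a := a)
  have hv := hA.mulVec_eigenvectorBasis k
  set v : ZMod N → ℝ := ⇑(hA.eigenvectorBasis k) with hvd
  obtain ⟨i, hi⟩ := Finite.exists_max fun i => |v i|
  have hpos : 0 < |v i| := by
    by_contra h
    have h0 : ∀ j, v j = 0 := fun j => abs_eq_zero.1 (le_antisymm ((hi j).trans (not_lt.1 h))
      (abs_nonneg _))
    have h1 := hA.eigenvectorBasis.orthonormal.ne_zero k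
    exact h1 (by ext j; exact h0 j)
  have h2 := congrFun hv i
  rw [matA_mulVec ha] at h2
  simp only [Pi.smul_apply, smul_eq_mul] at h2
  have h3 : |(omegaSq a - hA.eigenvalues k)| * |v i| ≤ 2 * a * |v i| := by
    rw [← abs_mul, show (omegaSq a - hA.eigenvalues k) * v i = a * (v (i - 1) + v (i + 1)) by
      linarith, abs_mul, abs_of_pos ha]
    have := abs_add_le (v (i - 1)) (v (i + 1))
    nlinarith [hi (i - 1), hi (i + 1)]
  have h4 := abs_le.1 (le_of_mul_le_mul_right h3 hpos)
  unfold omegaSq at h4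
  constructor <;> linarith [h4.1, h4.2]

/-- Entries of functions of the matrix `A` in terms of its spectral decomposition. -/
theorem cfc_matA_apply (f : ℝ → ℝ) (i j : ZMod N) :
    cfc f (matA N a) i j = ∑ k, (matA_isHermitian (N := N) (a := a)).eigenvectorUnitary.1 i k *
      f ((matA_isHermitian (N := N) (a := a)).eigenvalues k) *
      (matA_isHermitian (N := N) (a := a)).eigenvectorUnitary.1 j k := by
  rw [(matA_isHermitian (N := N) (a := a)).cfc_eq, Matrix.IsHermitian.cfc,
    Unitary.conjStarAlgAut_apply, Matrix.mul_apply]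
  refine Finset.sum_congr rfl fun k _ => ?_
  rw [Matrix.mul_diagonal]
  simp [Matrix.star_apply]

theorem spectrum_matA_bounds (ha : 0 < a) {t : ℝ} (ht : t ∈ spectrum ℝ (matA N a)) :
    1 ≤ t ∧ t ≤ 1 + 4 * a := by
  rw [(matA_isHermitian (N := N) (a := a)).spectrum_real_eq_range_eigenvalues] at ht
  obtain ⟨k, rfl⟩ := ht
  exact eigenvalue_bounds ha k

theorem continuousOn_spectrum_matA (f : ℝ → ℝ) : ContinuousOn f (spectrum ℝ (matA N a)) :=
  (Matrix.finite_real_spectrum (A := matA N a)).continuousOn f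

theorem powA_mul (ha : 0 < a) (p q : ℝ) : powA N a p * powA N a q = powA N a (p + q) := by
  rw [powA, powA, powA, ← cfc_mul _ _ _ (continuousOn_spectrum_matA _)
    (continuousOn_spectrum_matA _)]
  refine cfc_congr fun t ht => ?_
  have := spectrum_matA_bounds ha ht
  exact (Real.rpow_add (by linarith) p q).symm

theorem powA_zero : powA N a 0 = 1 := by
  have hA : IsSelfAdjoint (matA N a) := matA_isHermitian
  simp only [powA, Real.rpow_zero]
  exact cfc_const_one ℝ (matA N a)

theorem powA_one : powA N a 1 = matA N a := by
  have hA : IsSelfAdjoint (matA N a) := matA_isHermitian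
  simp only [powA, Real.rpow_one]
  exact cfc_id' ℝ (matA N a)

theorem powA_transpose (p : ℝ) : (powA N a p).transpose = powA N a p := by
  ext i j
  rw [Matrix.transpose_apply, powA, cfc_matA_apply, cfc_matA_apply]
  exact Finset.sum_congr rfl fun k _ => by ring

theorem powA_symm (p : ℝ) (i j : ZMod N) : powA N a p i j = powA N a p j i :=
  congrFun (congrFun (powA_transpose p) j) i

/-- The eigenvectors are normalized, so the trace of the square root of A is the sum of the square
roots of the eigenvalues. -/
theorem Omega_bounds (ha : 0 < a) : 1 ≤ Omega N a ∧ Omega N a ≤ √(1 + 4 * a) := by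
  set hA := matA_isHermitian (N := N) (a := a)
  have hU : ∀ k, ∑ i, hA.eigenvectorUnitary.1 i k * hA.eigenvectorUnitary.1 i k = 1 := fun k => by
    have h := congrFun (congrFun (Unitary.coe_star_mul_self hA.eigenvectorUnitary) k) k
    rw [Matrix.mul_apply] at h
    simpa [Matrix.star_apply] using h
  have htr : (powA N a (1 / 2)).trace = ∑ k, √(hA.eigenvalues k) := by
    simp only [Matrix.trace, Matrix.diag_apply, powA, cfc_matA_apply]
    rw [Finset.sum_comm]
    refine Finset.sum_congr rfl fun k _ => ?_
    rw [← Real.sqrt_eq_rpow]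
    calc _ = ∑ i, √(hA.eigenvalues k) *
          (hA.eigenvectorUnitary.1 i k * hA.eigenvectorUnitary.1 i k) :=
          Finset.sum_congr rfl fun i _ => by ring
      _ = _ := by rw [← Finset.mul_sum, hU, mul_one]
  have hN : (0 : ℝ) < N := by exact_mod_cast Nat.pos_of_ne_zero (NeZero.ne N)
  have hc : (Fintype.card (ZMod N) : ℝ) = N := by rw [ZMod.card]
  rw [Omega, htr, le_div_iff₀ hN, div_le_iff₀ hN]
  constructor
  · calc (1 : ℝ) * N = ∑ _k : ZMod N, (1 : ℝ) := by simp
      _ ≤ _ := Finset.sum_le_sum fun k _ => by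
        rw [Real.one_le_sqrt]; exact (eigenvalue_bounds ha k).1
  · calc _ ≤ ∑ _k : ZMod N, √(1 + 4 * a) := Finset.sum_le_sum fun k _ =>
          Real.sqrt_le_sqrt (eigenvalue_bounds ha k).2
      _ = _ := by simp [mul_comm]

theorem hop_pow_eq_cfc (ha : 0 < a) (m : ℕ) :
    hop N a ^ m = cfc (fun t : ℝ => (1 - t / omegaSq a) ^ m) (matA N a) := by
  have hA : IsSelfAdjoint (matA N a) := matA_isHermitian
  have hw : omegaSq a ≠ 0 := by unfold omegaSq; positivity
  rw [cfc_pow _ _ _ (continuousOn_spectrum_matA _)]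
  congr 1
  rw [cfc_sub _ _ _ (continuousOn_spectrum_matA _) (continuousOn_spectrum_matA _),
    cfc_const_one ℝ (matA N a)]
  simp only [div_eq_inv_mul]
  rw [cfc_const_mul_id _ _ hA]
  rw [matA_eq, smul_smul, inv_mul_cancel₀ hw, one_smul, sub_sub_cancel]

/-- Induction through (m+1) C(p, m+1) = (p - m) C(p, m), where |p - m| ≤ m + 1. -/
theorem abs_choose_le_one {p : ℝ} (hp : |p| ≤ 1) (m : ℕ) : |Ring.choose p m| ≤ 1 := by
  induction m with
  | zero => simp
  | succ m ih =>
    have h := Ring.choose_smul_choose p (Nat.le_succ m)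
    rw [Nat.succ_eq_add_one, Nat.choose_succ_self_right, add_tsub_cancel_left, Ring.choose_one_right,
      nsmul_eq_mul] at h
    have h1 : |p - m| ≤ m + 1 := by
      have := abs_sub p (m : ℝ)
      rw [Nat.abs_cast] at this
      linarith
    have h2 : (0 : ℝ) < ((m + 1 : ℕ) : ℝ) := by positivity
    have h3 : ((m + 1 : ℕ) : ℝ) * |Ring.choose p (m + 1)| ≤ ((m + 1 : ℕ) : ℝ) * 1 := by
      rw [← abs_of_pos h2, ← abs_mul, abs_of_pos h2, h, abs_mul, mul_one, Nat.cast_succ]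
      have := abs_nonneg (p - m)
      nlinarith
    exact le_of_mul_le_mul_left h3 h2

/-- This is the binomial series of A = ω² (1 - hop). It converges on the spectrum because the
eigenvalues lie in [1, 1 + 4a], inside the interval (0, 2ω²). -/
theorem powA_hasSum (ha : 0 < a) (ha' : a < 1 / 4) (p : ℝ) (i j : ZMod N) :
    HasSum (fun m : ℕ => omegaSq a ^ p * (Ring.choose p m * (-1) ^ m) * (hop N a ^ m) i j)
      (powA N a p i j) := by
  have hw : 0 < omegaSq a := by unfold omegaSq; positivity
  simp only [hop_pow_eq_cfc ha, powA, cfc_matA_apply, Finset.mul_sum]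
  refine hasSum_sum fun k _ => ?_
  set hA := matA_isHermitian (N := N) (a := a)
  obtain ⟨h1, h2⟩ := eigenvalue_bounds (N := N) ha k
  set t := hA.eigenvalues k
  have hx : ‖t / omegaSq a - 1‖ < 1 := by
    rw [Real.norm_eq_abs, abs_lt, lt_sub_iff_add_lt, sub_lt_iff_lt_add, div_lt_iff₀ hw]
    constructor
    · have : 0 < t / omegaSq a := by positivity
      linarith
    · unfold omegaSq; linarith
  have hs := (Real.one_add_rpow_hasFPowerSeriesOnBall_zero (a := p)).hasSum
    (y := t / omegaSq a - 1) (by simpa [← enorm_eq_nnnorm, ← ofReal_norm] using hx)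
  simp only [zero_add, add_sub_cancel] at hs
  have e : ((t / omegaSq a) ^ p) = t ^ p / omegaSq a ^ p := Real.div_rpow (by linarith) hw.le p
  have hwp : omegaSq a ^ p ≠ 0 := (Real.rpow_pos_of_pos hw p).ne'
  have hs2 := hs.mul_left (omegaSq a ^ p * (hA.eigenvectorUnitary.1 i k * hA.eigenvectorUnitary.1 j k))
  rw [e] at hs2
  refine Eq.mp (congrArg₂ (fun f s => HasSum f s) (funext fun m => ?_) ?_) hs2
  · rw [binomialSeries_apply, List.ofFn_const, List.prod_replicate, smul_eq_mul,
      show 1 - t / omegaSq a = (-1) * (t / omegaSq a - 1) by ring, mul_pow]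
    have : ((-1 : ℝ) ^ m) * (-1) ^ m = 1 := by rw [← mul_pow]; norm_num
    linear_combination (-(omegaSq a ^ p * Ring.choose p m * hA.eigenvectorUnitary.1 i k
      * hA.eigenvectorUnitary.1 j k * (t / omegaSq a - 1) ^ m)) * this
  · field_simp

/-- Finite propagation removes the terms of the binomial series of order below the distance of i and
j. The rest is a geometric tail of ratio 2μ ≤ 1/2, and the constant is 2 · 2, from ω^{2p} ≤ 2 and
from the sum of the tail. -/
theorem abs_powA_le (ha : 0 < a) (ha' : a < 1 / 4) {p : ℝ} (hp : |p| ≤ 1) (i j : ZMod N) :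
    |powA N a p i j| ≤ 4 * (2 * mu a) ^ zd (i - j) := by
  have hμ := mu_pos ha
  have hμ' := mu_le ha
  have hw1 : 1 ≤ omegaSq a := by unfold omegaSq; linarith
  have hwp : omegaSq a ^ p ≤ 2 := by
    calc omegaSq a ^ p ≤ omegaSq a ^ (1 : ℝ) :=
          Real.rpow_le_rpow_of_exponent_le hw1 (abs_le.1 hp).2
      _ ≤ 2 := by rw [Real.rpow_one]; unfold omegaSq; linarith
  have hwp0 : 0 ≤ omegaSq a ^ p := Real.rpow_nonneg (by linarith) p
  set d := zd (i - j)
  set x := 2 * mu a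
  have hx0 : 0 ≤ x := by positivity
  have hx1 : x ≤ 1 / 2 := by simp only [x]; linarith
  have hg : HasSum (fun m : ℕ => if m < d then 0 else 2 * x ^ m) (2 * x ^ d * (1 - x)⁻¹) := by
    have h1 := (hasSum_geometric_of_lt_one hx0 (by linarith)).mul_left (2 * x ^ d)
    rw [← hasSum_nat_add_iff' d]
    have : ∑ m ∈ Finset.range d, (if m < d then (0 : ℝ) else 2 * x ^ m) = 0 :=
      Finset.sum_eq_zero fun m hm => by rw [if_pos (Finset.mem_range.1 hm)]
    rw [this, sub_zero]
    refine Eq.mp (congrArg (fun f => HasSum f _) (funext fun m => ?_)) h1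
    rw [if_neg (by omega), pow_add]; ring
  have h := powA_hasSum ha ha' p i j
  have hb : ‖powA N a p i j‖ ≤ 2 * x ^ d * (1 - x)⁻¹ := by
    refine h.norm_le_of_bounded hg fun m => ?_
    split_ifs with hm
    · rw [hop_pow_eq_zero m i j hm]; simp
    · rw [Real.norm_eq_abs, abs_mul, abs_mul, abs_mul, abs_pow, abs_neg, abs_one, one_pow, mul_one,
        abs_of_nonneg hwp0, abs_of_nonneg (hop_pow_nonneg ha m i j)]
      have h3 := abs_choose_le_one hp m
      have h4 := hop_pow_le ha m i j
      have h5 := hop_pow_nonneg ha m i j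
      calc _ ≤ 2 * 1 * x ^ m := by gcongr
        _ = _ := by ring
  rw [Real.norm_eq_abs] at hb
  refine hb.trans ?_
  have h6 : (1 - x)⁻¹ ≤ 2 := by
    rw [inv_le_comm₀ (by linarith) (by norm_num)]; linarith
  have := pow_nonneg hx0 d
  nlinarith

theorem powA_translate (ha : 0 < a) (ha' : a < 1 / 4) (p : ℝ) (i j : ZMod N) :
    powA N a p (i + 1) (j + 1) = powA N a p i j := by
  have h1 := powA_hasSum ha ha' p (i + 1) (j + 1)
  simp only [hop_pow_translate] at h1
  exact h1.unique (powA_hasSum ha ha' p i j)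

theorem sum_abs_powA_le (ha : 0 < a) (ha' : a < 1 / 4) {p : ℝ} (hp : |p| ≤ 1) (i : ZMod N) :
    ∑ j, |powA N a p i j| ≤ 16 := by
  have hμ := mu_pos ha
  have hμ' := mu_le ha
  have h1 : ∑ j, |powA N a p i j| ≤ ∑ j, 4 * (2 * mu a) ^ zd (i - j) :=
    Finset.sum_le_sum fun j _ => abs_powA_le ha ha' hp i j
  refine h1.trans ?_
  rw [← Finset.mul_sum, Fintype.sum_equiv (Equiv.subLeft i) (fun j => (2 * mu a) ^ zd (i - j))
    (fun k => (2 * mu a) ^ zd k) (fun j => rfl)]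
  have h2 := sum_pow_zd_le (N := N) (x := 2 * mu a) (by positivity) (by linarith)
  have h3 : 2 / (1 - 2 * mu a) ≤ 4 := by rw [div_le_iff₀ (by linarith)]; linarith
  linarith

/-- Translation invariance makes the diagonal constant, hence equal to its average Ω. This is why
subtracting H_Ω leaves no on-site term in Z₀. -/
theorem powA_half_diag (ha : 0 < a) (ha' : a < 1 / 4) (i : ZMod N) :
    powA N a (1 / 2) i i = Omega N a := by
  have h : ∀ n : ℕ, powA N a (1 / 2) (n : ZMod N) (n : ZMod N) = powA N a (1 / 2) 0 0 := fun n => by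
    induction n with
    | zero => simp
    | succ n ih => rw [Nat.cast_succ, powA_translate ha ha', ih]
  have h' : ∀ i : ZMod N, powA N a (1 / 2) i i = powA N a (1 / 2) 0 0 := fun i => by
    rw [← h i.val, ZMod.natCast_zmod_val]
  have hN : (N : ℝ) ≠ 0 := by exact_mod_cast NeZero.ne N
  rw [h', Omega, Matrix.trace]
  simp only [Matrix.diag_apply, h']
  simp [hN]

end Matrices

/-! ### The quadratic Hamiltonian in the normal variables -/

section QuadraticForms

variable {N : ℕ} [NeZero N] {a : ℝ}

/-- The quadratic form `½ ∑ M i j (q_i q_j + p_i p_j)`. -/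
def quadForm (M : Matrix (ZMod N) (ZMod N) ℝ) : Poly N :=
  C (1 / 2) * ∑ i, ∑ j, C (M i j) *
    (X (Sum.inl i) * X (Sum.inl j) + X (Sum.inr i) * X (Sum.inr j))

theorem sum_quadratic_subst {B : Type*} [CommRing B] [Algebra ℝ B]
    (M L : Matrix (ZMod N) (ZMod N) ℝ) (Q : ZMod N → B) :
    ∑ i, ∑ j, algebraMap ℝ B (M i j) * ((∑ k, algebraMap ℝ B (L i k) * Q k) *
      ∑ l, algebraMap ℝ B (L j l) * Q l)
      = ∑ k, ∑ l, algebraMap ℝ B ((L.transpose * M * L) k l) * (Q k * Q l) := by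
  simp only [Matrix.mul_apply, Matrix.transpose_apply, Finset.mul_sum, Finset.sum_mul, map_sum,
    map_mul]
  calc _ = ∑ i, ∑ j, ∑ k, ∑ l, algebraMap ℝ B (L i k) * algebraMap ℝ B (M i j) *
          algebraMap ℝ B (L j l) * (Q k * Q l) := by
        refine Finset.sum_congr rfl fun i _ => Finset.sum_congr rfl fun j _ => ?_
        rw [Finset.sum_comm]
        exact Finset.sum_congr rfl fun k _ => Finset.sum_congr rfl fun l _ => by ring
    _ = ∑ i, ∑ k, ∑ j, ∑ l, algebraMap ℝ B (L i k) * algebraMap ℝ B (M i j) *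
          algebraMap ℝ B (L j l) * (Q k * Q l) :=
        Finset.sum_congr rfl fun i _ => Finset.sum_comm
    _ = ∑ k, ∑ i, ∑ j, ∑ l, algebraMap ℝ B (L i k) * algebraMap ℝ B (M i j) *
          algebraMap ℝ B (L j l) * (Q k * Q l) := Finset.sum_comm
    _ = _ := by
        refine Finset.sum_congr rfl fun k _ => ?_
        calc _ = ∑ i, ∑ l, ∑ j, algebraMap ℝ B (L i k) * algebraMap ℝ B (M i j) *
                algebraMap ℝ B (L j l) * (Q k * Q l) :=
              Finset.sum_congr rfl fun i _ => Finset.sum_comm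
          _ = ∑ l, ∑ i, ∑ j, algebraMap ℝ B (L i k) * algebraMap ℝ B (M i j) *
                algebraMap ℝ B (L j l) * (Q k * Q l) := Finset.sum_comm
          _ = _ := Finset.sum_congr rfl fun l _ => Finset.sum_comm

theorem H0_eq (ha : 0 < a) : H0 N a = C (1 / 2) *
    (∑ i, ∑ j, C (matA N a i j) * (X (Sum.inl i) * X (Sum.inl j))
      + ∑ i, ∑ j, C ((1 : Matrix (ZMod N) (ZMod N) ℝ) i j) * (X (Sum.inr i) * X (Sum.inr j))) := by
  have hA : ∀ i j, matA N a i j = (if i = j then omegaSq a else 0)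
      - ((if i = j + 1 then a else 0) + if i = j - 1 then a else 0) := fun i j => by
    rw [matA_eq, Matrix.smul_apply, Matrix.sub_apply, hop_apply, Matrix.one_apply, smul_eq_mul,
      mul_sub, ← mul_assoc, omegaSq_mul_mu ha]
    split_ifs <;> ring
  have e1 : ∑ i, ∑ j, C (matA N a i j) * (X (Sum.inl i) * X (Sum.inl j) : Poly N)
      = ∑ j, (C (omegaSq a) * (X (Sum.inl j) * X (Sum.inl j))
        - C a * (X (Sum.inl (j + 1)) * X (Sum.inl j))
        - C a * (X (Sum.inl (j - 1)) * X (Sum.inl j))) := by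
    rw [Finset.sum_comm]
    refine Finset.sum_congr rfl fun j _ => ?_
    simp only [hA, map_sub, map_add, sub_mul, add_mul, Finset.sum_sub_distrib,
      Finset.sum_add_distrib, apply_ite (C : ℝ → Poly N), map_zero, ite_mul, zero_mul,
      Finset.sum_ite_eq', Finset.mem_univ, if_true]
    ring
  have e2 : ∑ i, ∑ j, C ((1 : Matrix (ZMod N) (ZMod N) ℝ) i j)
      * (X (Sum.inr i) * X (Sum.inr j) : Poly N) = ∑ i, X (Sum.inr i) * X (Sum.inr i) := by
    refine Finset.sum_congr rfl fun i _ => ?_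
    simp [Matrix.one_apply, apply_ite (C : ℝ → Poly N), ite_mul]
  have e3 : ∑ j, C a * (X (Sum.inl (j + 1)) * X (Sum.inl j) : Poly N)
      = ∑ j, C a * (X (Sum.inl j) * X (Sum.inl (j - 1))) :=
    Fintype.sum_equiv (Equiv.addRight 1) _ _ fun j => by simp
  have e4 : ∑ j, C a * (X (Sum.inl (j - 1)) * X (Sum.inl (j - 1)) : Poly N)
      = ∑ j, C a * (X (Sum.inl j) * X (Sum.inl j)) :=
    Fintype.sum_equiv (Equiv.subRight 1) _ _ fun j => by simp
  rw [H0, e1, e2, Finset.sum_sub_distrib, Finset.sum_sub_distrib, e3]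
  congr 1
  have e5 : ∀ j : ZMod N, (X (Sum.inr j) ^ 2 + X (Sum.inl j) ^ 2
      + C a * (X (Sum.inl j) - X (Sum.inl (j - 1))) ^ 2 : Poly N)
      = X (Sum.inr j) * X (Sum.inr j) + X (Sum.inl j) * X (Sum.inl j)
        + C a * (X (Sum.inl j) * X (Sum.inl j))
        + C a * (X (Sum.inl (j - 1)) * X (Sum.inl (j - 1)))
        - C a * (X (Sum.inl j) * X (Sum.inl (j - 1)))
        - C a * (X (Sum.inl (j - 1)) * X (Sum.inl j)) := fun j => by ring
  simp only [e5, Finset.sum_sub_distrib, Finset.sum_add_distrib, e4]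
  have e6 : ∑ j, C (omegaSq a) * (X (Sum.inl j) * X (Sum.inl j) : Poly N)
      = ∑ j, X (Sum.inl j) * X (Sum.inl j) + ∑ j, C a * (X (Sum.inl j) * X (Sum.inl j))
        + ∑ j, C a * (X (Sum.inl j) * X (Sum.inl j)) := by
    rw [← Finset.sum_add_distrib, ← Finset.sum_add_distrib]
    refine Finset.sum_congr rfl fun j _ => ?_
    simp only [omegaSq, map_add, map_mul, map_one, map_ofNat]
    ring
  rw [e6]
  ring

/-- The exponents ∓1/4 balance the two halves: A^{-1/4} A A^{-1/4} and A^{1/4} A^{1/4} are both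
A^{1/2}, so positions and momenta get the same matrix. -/
theorem toNormal_H0 (ha : 0 < a) : toNormal a (H0 N a) = quadForm (powA N a (1 / 2)) := by
  rw [toNormal, linSubst_eq, H0_eq ha, map_mul, map_add, linSubstHom_C, quadForm]
  congr 1
  simp only [map_sum, map_mul, linSubstHom_C, linSubstHom_X_inl, linSubstHom_X_inr]
  have h1 := sum_quadratic_subst (B := Poly N) (matA N a) (powA N a (-(1 / 4)))
    (fun k => X (Sum.inl k))
  have h2 := sum_quadratic_subst (B := Poly N) 1 (powA N a (1 / 4)) (fun k => X (Sum.inr k))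
  rw [powA_transpose] at h1 h2
  rw [← powA_one, powA_mul ha, powA_mul ha, show -(1 / 4) + 1 + -(1 / 4) = (1 / 2 : ℝ) by norm_num]
    at h1
  rw [mul_one, powA_mul ha, show 1 / 4 + 1 / 4 = (1 / 2 : ℝ) by norm_num] at h2
  simp only [algebraMap_eq] at h1 h2
  rw [← powA_one, h1, h2, ← Finset.sum_add_distrib]
  refine Finset.sum_congr rfl fun i _ => ?_
  rw [← Finset.sum_add_distrib]
  exact Finset.sum_congr rfl fun j _ => by ring

theorem HOmega_eq : HOmega N a = quadForm (Omega N a • (1 : Matrix (ZMod N) (ZMod N) ℝ)) := by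
  rw [HOmega, quadForm, div_eq_mul_one_div, mul_comm (Omega N a), map_mul, mul_assoc]
  congr 1
  rw [Finset.mul_sum]
  refine Finset.sum_congr rfl fun i _ => ?_
  simp only [Matrix.smul_apply, Matrix.one_apply, smul_eq_mul, mul_ite, mul_one, mul_zero,
    apply_ite (C : ℝ → Poly N), map_zero, ite_mul, zero_mul, Finset.sum_ite_eq, Finset.mem_univ,
    if_true]
  ring

/-- The coupling matrix of `Z₀`. -/
def couplingMatrix (N : ℕ) [NeZero N] (a : ℝ) : Matrix (ZMod N) (ZMod N) ℝ :=
  powA N a (1 / 2) - Omega N a • 1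

theorem Z0_eq (ha : 0 < a) : Z0 N a = quadForm (couplingMatrix N a) := by
  rw [Z0, toNormal_H0 ha, HOmega_eq, quadForm, quadForm, quadForm, ← mul_sub]
  congr 1
  simp only [← Finset.sum_sub_distrib, couplingMatrix, Matrix.sub_apply, map_sub, sub_mul]

theorem couplingMatrix_diag (ha : 0 < a) (ha' : a < 1 / 4) (i : ZMod N) :
    couplingMatrix N a i i = 0 := by
  simp [couplingMatrix, ← powA_half_diag ha ha' i]

theorem couplingMatrix_translate (ha : 0 < a) (ha' : a < 1 / 4) (i j : ZMod N) :
    couplingMatrix N a (i + 1) (j + 1) = couplingMatrix N a i j := by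
  simp [couplingMatrix, powA_translate ha ha', Matrix.one_apply]

theorem couplingMatrix_symm (i j : ZMod N) : couplingMatrix N a i j = couplingMatrix N a j i := by
  simp [couplingMatrix, powA_symm _ i j, Matrix.one_apply, eq_comm]

theorem abs_couplingMatrix_le (ha : 0 < a) (ha' : a < 1 / 4) (i j : ZMod N) :
    |couplingMatrix N a i j| ≤ if i - j = 0 then 0 else 4 * (2 * mu a) ^ zd (i - j) := by
  split_ifs with h
  · rw [sub_eq_zero.1 h, couplingMatrix_diag ha ha', abs_zero]
  · rw [couplingMatrix, Matrix.sub_apply, Matrix.smul_apply, Matrix.one_apply,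
      if_neg (fun h' => h (sub_eq_zero.2 h')), smul_zero, sub_zero]
    exact abs_powA_le ha ha' (by rw [abs_of_pos] <;> norm_num) i j

/-- The vanishing diagonal makes the geometric sum start at distance one, which gives a bound
proportional to μ, uniform in N. -/
theorem sum_abs_couplingMatrix_le (ha : 0 < a) (ha' : a < 1 / 4) (i : ZMod N) :
    ∑ j, |couplingMatrix N a i j| ≤ 32 * mu a := by
  have hμ := mu_pos ha
  have hμ' := mu_le ha
  refine (Finset.sum_le_sum fun j _ => abs_couplingMatrix_le ha ha' i j).trans ?_
  rw [Fintype.sum_equiv (Equiv.subLeft i)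
    (fun j => if i - j = 0 then 0 else 4 * (2 * mu a) ^ zd (i - j))
    (fun k => 4 * if k = 0 then 0 else (2 * mu a) ^ zd k)
    (fun j => by simp [mul_ite])]
  rw [← Finset.mul_sum]
  have h2 := sum_pow_zd_ne_zero_le (N := N) (x := 2 * mu a) (by positivity) (by linarith)
  have h3 : 2 * mu a / (1 - 2 * mu a) ≤ 4 * mu a := by
    rw [div_le_iff₀ (by linarith)]; nlinarith
  linarith

theorem translate_of_succ {M : ZMod N → ZMod N → ℝ} (h : ∀ i j, M (i + 1) (j + 1) = M i j)
    (i j s : ZMod N) : M (i + s) (j + s) = M i j := by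
  have h' : ∀ n : ℕ, M (i + n) (j + n) = M i j := fun n => by
    induction n with
    | zero => simp
    | succ n ih => rw [Nat.cast_succ, ← add_assoc, ← add_assoc, h, ih]
  simpa using h' s.val

end QuadraticForms

/-! ### Seeds of Z₀ and H₁ -/

section Seeds

variable {N : ℕ} [NeZero N] {a : ℝ}

theorem extensive_shift (t : ZMod N) (f : Poly N) : extensive (shift t f) = extensive f := by
  simp only [extensive, shift_eq, shiftHom_shiftHom]
  exact Fintype.sum_equiv (Equiv.addLeft t) _ _ fun s => rfl

theorem extensive_sum {ι : Type*} (s : Finset ι) (f : ι → Poly N) :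
    extensive (∑ i ∈ s, f i) = ∑ i ∈ s, extensive (f i) := by
  simp only [extensive, shift_eq, map_sum]
  exact Finset.sum_comm

/-- Take the representatives of the k_i nearest to zero and translate by the sum of the sizes of the
negative ones. All of them then lie between 0 and ∑ |k_i|. If that sum is at least N - 1 there is
nothing to do. -/
theorem exists_shift_val_le {ι : Type*} [Fintype ι] (k : ι → ZMod N) :
    ∃ s, ∀ i, (k i + s).val ≤ min (∑ i, zd (k i)) (N - 1) := by
  by_cases h : N - 1 ≤ ∑ i, zd (k i)
  · refine ⟨0, fun i => ?_⟩
    rw [min_eq_right h]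
    have := ZMod.val_lt (k i + 0)
    omega
  · push Not at h
    set n : ℕ := ∑ i, (-(k i).valMinAbs).toNat
    refine ⟨n, fun i => ?_⟩
    rw [min_eq_left h.le]
    have h1 : (-(k i).valMinAbs).toNat ≤ n :=
      Finset.single_le_sum (f := fun i => (-(k i).valMinAbs).toNat) (fun _ _ => Nat.zero_le _)
        (Finset.mem_univ i)
    have h2 : (k i).valMinAbs.toNat + n ≤ ∑ i, zd (k i) := by
      have e : ∀ i, zd (k i) = (-(k i).valMinAbs).toNat + (k i).valMinAbs.toNat := fun i => by
        unfold zd; omega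
      rw [Finset.sum_congr rfl fun i _ => e i, Finset.sum_add_distrib, add_comm]
      exact Nat.add_le_add_left (Finset.single_le_sum (f := fun i => (k i).valMinAbs.toNat)
        (fun _ _ => Nat.zero_le _) (Finset.mem_univ i)) _
    have h3 : k i + n = (((k i).valMinAbs + n).toNat : ZMod N) := by
      have : ((((k i).valMinAbs + n).toNat : ℤ) : ZMod N) = (((k i).valMinAbs + n : ℤ) : ZMod N) := by
        rw [Int.toNat_of_nonneg (by omega)]
      rw [Int.cast_natCast] at this
      rw [this, Int.cast_add, ZMod.coe_valMinAbs, Int.cast_natCast]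
    rw [h3, ZMod.val_natCast_of_lt (by omega)]
    omega

theorem l1_shift_le (s : ZMod N) (f : Poly N) : l1 (shift s f) ≤ l1 f := by
  conv_lhs => rw [f.as_sum, shift_eq, map_sum]
  refine (l1_sum_le _ _).trans (Finset.sum_le_sum fun d _ => ?_)
  rw [shiftHom, rename_monomial, l1_monomial]

/-- A sum of extensive functions, sorted by the interaction range, is a seed. -/
theorem seedOfClass_of_family {ι : Type*} [Fintype ι] {d : ℕ} {F : Poly N} {t : ι → Poly N}
    {m : ι → ℕ} {C σ : ℝ} (hF : F = ∑ i, extensive (t i)) (hm : ∀ i, m i < N)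
    (hom : ∀ i, (t i).IsHomogeneous d) (hv : ∀ i, ∀ v ∈ (t i).vars, (site v).val ≤ m i)
    (hC : ∀ n, ∑ i with m i = n, l1 (t i) ≤ C * Real.exp (-σ * n)) :
    SeedOfClass d F (fun n => ∑ i with m i = n, t i) C σ := by
  classical
  refine ⟨?_, fun n _ => ⟨IsHomogeneous.sum _ _ _ fun i _ => hom i, ?_, ?_⟩⟩
  · rw [hF]
    simp only [extensive_sum]
    exact (Finset.sum_fiberwise_of_maps_to (fun i _ => Finset.mem_range.2 (hm i)) _).symm
  · intro v hv'
    obtain ⟨i, hi, hvi⟩ := Finset.mem_biUnion.1 (vars_sum_subset _ _ hv')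
    exact (hv i v hvi).trans_eq (Finset.mem_filter.1 hi).2
  · rw [polyNorm_eq_l1]
    exact (l1_sum_le _ _).trans (hC n)

theorem exp_neg_sigma0_mul (ha : 0 < a) (m : ℕ) :
    Real.exp (-sigma0 a * m) = (2 * mu a) ^ m := by
  rw [sigma0, neg_neg, mul_comm, Real.exp_nat_mul, Real.exp_log (by linarith [mu_pos ha])]

theorem exp_neg_sigma1_mul (ha : 0 < a) (m : ℕ) :
    Real.exp (-sigma1 a * m) = √(2 * mu a) ^ m := by
  have h : 0 < 2 * mu a := by linarith [mu_pos ha]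
  have : -sigma1 a = Real.log √(2 * mu a) := by
    rw [Real.log_sqrt h.le, sigma1, sigma0]; ring
  rw [this, mul_comm, Real.exp_nat_mul, Real.exp_log (Real.sqrt_pos.2 h)]

theorem zd_lt (k : ZMod N) : zd k < N := by
  have := ZMod.val_lt k
  rw [zd, ZMod.valMinAbs_natAbs_eq_min]
  exact (min_le_left _ _).trans_lt this

theorem card_zd_eq_le (m : ℕ) : (Finset.univ.filter fun k : ZMod N => zd k = m).card ≤ 2 := by
  refine (Finset.card_le_card_of_injOn (t := ({(m : ℤ), -(m : ℤ)} : Finset ℤ))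
    (fun k => k.valMinAbs) (fun k hk => ?_) (fun k _ l _ h => ZMod.injective_valMinAbs h)).trans
    Finset.card_le_two
  have h := (Finset.mem_filter.1 hk).2
  unfold zd at h
  simp only [Finset.coe_insert, Finset.coe_singleton, Set.mem_insert_iff, Set.mem_singleton_iff]
  omega

theorem eq_zero_of_zd_eq_zero {k : ZMod N} (h : zd k = 0) : k = 0 := by
  rwa [zd, Int.natAbs_eq_zero, ZMod.valMinAbs_eq_zero] at h

/-- The pairs (0, k) are sorted by the distance of k and left aligned. At most two k have a given
distance m, each contributing at most 4 (2μ)^m, whence the constant 8. -/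
theorem exists_seed_Z0 (ha : 0 < a) (ha' : a < 1 / 4) :
    ∃ ζ : ℕ → Poly N, ζ 0 = 0 ∧ SeedOfClass 2 (Z0 N a) ζ 8 (sigma0 a) := by
  classical
  have hsh : ∀ k : ZMod N, ∃ s : ZMod N, s.val ≤ zd k ∧ (k + s).val ≤ zd k := fun k => by
    obtain ⟨s, hs⟩ := exists_shift_val_le (fun i : Fin 2 => if i = 0 then 0 else k)
    have e : min (∑ i : Fin 2, zd (if i = 0 then 0 else k)) (N - 1) = zd k := by
      have := zd_lt k
      simp
      omega
    rw [e] at hs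
    exact ⟨s, by simpa using hs 0, by simpa using hs 1⟩
  choose sh hs1 hs2 using hsh
  set u : ZMod N → Poly N := fun k => C (1 / 2 * couplingMatrix N a 0 k) *
    (X (Sum.inl 0) * X (Sum.inl k) + X (Sum.inr 0) * X (Sum.inr k)) with hu
  have hsu : ∀ s k, shift s (u k) = C (1 / 2 * couplingMatrix N a 0 k) *
      (X (Sum.inl s) * X (Sum.inl (k + s)) + X (Sum.inr s) * X (Sum.inr (k + s))) := fun s k => by
    simp [hu, shift_eq]
  have hu0 : u 0 = 0 := by simp [hu, couplingMatrix_diag ha ha']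
  refine ⟨fun n => ∑ k with zd k = n, shift (sh k) (u k), ?_, ?_⟩
  · refine Finset.sum_eq_zero fun k hk => ?_
    rw [eq_zero_of_zd_eq_zero (Finset.mem_filter.1 hk).2, hu0, shift_eq, map_zero]
  · refine seedOfClass_of_family ?_ zd_lt ?_ ?_ ?_
    · simp only [extensive_shift]
      simp only [extensive, hsu]
      rw [Z0_eq ha, quadForm, Finset.mul_sum]
      conv_rhs => rw [Finset.sum_comm]
      refine Finset.sum_congr rfl fun s _ => ?_
      rw [Finset.mul_sum]
      refine (Fintype.sum_equiv (Equiv.addRight s) _ _ fun k => ?_).symm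
      have := translate_of_succ (couplingMatrix_translate (N := N) ha ha') 0 k s
      rw [zero_add] at this
      simp only [Equiv.coe_addRight, this, map_mul]
      ring
    · intro k
      rw [hsu]
      exact (((isHomogeneous_X ℝ _).mul (isHomogeneous_X ℝ _)).add
        ((isHomogeneous_X ℝ _).mul (isHomogeneous_X ℝ _))).C_mul _
    · intro k v hv
      rw [hsu] at hv
      have h1 := vars_mul _ _ hv
      rw [vars_C, Finset.empty_union] at h1
      have h2 := vars_add_subset _ _ h1
      have h3 : ∀ s t : Var N, v ∈ vars (X s * X t : Poly N) → v = s ∨ v = t := fun s t h => by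
        have := vars_mul _ _ h
        simpa using this
      rcases Finset.mem_union.1 h2 with h | h <;> rcases h3 _ _ h with rfl | rfl
      · exact hs1 k
      · exact hs2 k
      · exact hs1 k
      · exact hs2 k
    · intro n
      rw [exp_neg_sigma0_mul ha]
      have hb : ∀ k ∈ Finset.univ.filter (fun k : ZMod N => zd k = n),
          l1 (shift (sh k) (u k)) ≤ 4 * (2 * mu a) ^ n := fun k hk => by
        have hk' := (Finset.mem_filter.1 hk).2
        refine (l1_shift_le _ _).trans ?_
        simp only [hu]
        rw [l1_C_mul, Real.norm_eq_abs, abs_mul, abs_of_pos (by norm_num : (0 : ℝ) < 1 / 2)]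
        have h1 : l1 (X (Sum.inl 0) * X (Sum.inl k) + X (Sum.inr 0) * X (Sum.inr k) : Poly N) ≤ 2 := by
          refine (l1_add_le _ _).trans ?_
          have := l1_mul_le (X (Sum.inl 0) : Poly N) (X (Sum.inl k))
          have := l1_mul_le (X (Sum.inr 0) : Poly N) (X (Sum.inr k))
          simp only [l1_X] at *
          linarith
        have h2 : |couplingMatrix N a 0 k| ≤ 4 * (2 * mu a) ^ n := by
          refine (abs_couplingMatrix_le ha ha' 0 k).trans ?_
          have := mu_pos ha
          split_ifs
          · positivity
          · rw [zero_sub, zd_neg, hk']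
        have := l1_nonneg (X (Sum.inl 0) * X (Sum.inl k) + X (Sum.inr 0) * X (Sum.inr k) : Poly N)
        nlinarith [abs_nonneg (couplingMatrix N a 0 k)]
      refine (Finset.sum_le_card_nsmul _ _ _ hb).trans ?_
      rw [nsmul_eq_mul]
      have h1 : ((Finset.univ.filter fun k : ZMod N => zd k = n).card : ℝ) ≤ 2 := by
        exact_mod_cast card_zd_eq_le n
      have h2 : 0 ≤ (2 * mu a) ^ n := pow_nonneg (by linarith [mu_pos ha]) n
      nlinarith

theorem toNormal_H1 : toNormal a (H1 N) =
    C (1 / 4) * ∑ j, (∑ k, C (powA N a (-(1 / 4)) j k) * X (Sum.inl k)) ^ 4 := by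
  rw [toNormal, linSubst_eq, H1, map_mul, linSubstHom_C, map_sum]
  simp only [map_pow, linSubstHom_X_inl]

/-- Expanding the fourth power gives terms indexed by four sites, of weight (2μ)^S up to constants,
where S is the sum of their distances to 0. With y = √(2μ) this is y^S · y^S: one factor gives the
decay in the range, the other makes the sum over the four sites converge. This is why σ₁ is half of
σ₀. -/
theorem exists_seed_H1 (ha : 0 < a) (ha' : a < 1 / 8) :
    ∃ h : ℕ → Poly N, SeedOfClass 4 (toNormal a (H1 N)) h 16384 (sigma1 a) := by
  classical
  have ha4 : a < 1 / 4 := by linarith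
  have hμ := mu_pos ha
  have hμ' := mu_le ha
  choose sh hs using fun κ : Fin 4 → ZMod N => exists_shift_val_le κ
  set M := powA N a (-(1 / 4)) with hM
  set u : (Fin 4 → ZMod N) → Poly N := fun κ => C (1 / 4 * ∏ i, M 0 (κ i)) * ∏ i, X (Sum.inl (κ i))
    with hu
  have hsu : ∀ s κ, shift s (u κ) = C (1 / 4 * ∏ i, M 0 (κ i)) * ∏ i, X (Sum.inl (κ i + s)) :=
    fun s κ => by
      simp only [hu, shift_eq, map_mul, shiftHom_C, map_prod, shiftHom_X_inl]
  refine ⟨_, seedOfClass_of_family (t := fun κ => shift (sh κ) (u κ))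
    (m := fun κ => min (∑ i, zd (κ i)) (N - 1)) ?_ ?_ ?_ ?_ ?_⟩
  · simp only [extensive_shift]
    simp only [extensive, hsu]
    rw [toNormal_H1, Finset.mul_sum]
    conv_rhs => rw [Finset.sum_comm]
    refine Finset.sum_congr rfl fun s _ => ?_
    rw [Fintype.sum_pow, Finset.mul_sum]
    refine (Fintype.sum_equiv (Equiv.addRight (fun _ : Fin 4 => s)) _ _ fun κ => ?_).symm
    simp only [Equiv.coe_addRight, Pi.add_apply, Finset.prod_mul_distrib]
    have : ∀ i, M s (κ i + s) = M 0 (κ i) := fun i => by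
      have := translate_of_succ (powA_translate (N := N) ha ha4 (-(1 / 4))) 0 (κ i) s
      rwa [zero_add] at this
    simp only [← hM, this, map_mul, map_prod]
    ring
  · intro κ
    have := Nat.pos_of_ne_zero (NeZero.ne N)
    exact (min_le_right _ _).trans_lt (by omega)
  · intro κ
    rw [hsu]
    refine IsHomogeneous.C_mul ?_ _
    have := IsHomogeneous.prod (R := ℝ) Finset.univ (fun i : Fin 4 => (X (Sum.inl (κ i + sh κ)) : Poly N))
      (fun _ => 1) (fun i _ => isHomogeneous_X ℝ _)
    simpa using this
  · intro κ v hv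
    rw [hsu] at hv
    have h1 := vars_mul _ _ hv
    rw [vars_C, Finset.empty_union] at h1
    obtain ⟨i, -, hi⟩ := Finset.mem_biUnion.1 (vars_prod _ h1)
    rw [vars_X, Finset.mem_singleton] at hi
    rw [hi]
    exact hs κ i
  · intro n
    set y := √(2 * mu a) with hy
    have hy0 : 0 ≤ y := Real.sqrt_nonneg _
    have hyy : y * y = 2 * mu a := Real.mul_self_sqrt (by linarith)
    have hy1 : y ≤ 1 / 2 := by nlinarith
    rw [exp_neg_sigma1_mul ha, ← hy]
    have hb : ∀ κ ∈ Finset.univ.filter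
        (fun κ : Fin 4 → ZMod N => min (∑ i, zd (κ i)) (N - 1) = n),
        l1 (shift (sh κ) (u κ)) ≤ 64 * y ^ n * ∏ i, y ^ zd (κ i) := fun κ hκ => by
      have hκ' := (Finset.mem_filter.1 hκ).2
      refine (l1_shift_le _ _).trans ?_
      simp only [hu]
      rw [l1_C_mul, Real.norm_eq_abs, abs_mul, abs_of_pos (by norm_num : (0 : ℝ) < 1 / 4),
        Finset.abs_prod]
      have h1 : l1 (∏ i, X (Sum.inl (κ i)) : Poly N) ≤ 1 :=
        (l1_prod_le _ _).trans (by simp)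
      have h2 : ∏ i, |M 0 (κ i)| ≤ ∏ i, 4 * (y ^ zd (κ i) * y ^ zd (κ i)) := by
        refine Finset.prod_le_prod (fun i _ => abs_nonneg _) fun i _ => ?_
        have := abs_powA_le ha ha4 (p := -(1 / 4)) (by rw [abs_neg, abs_of_pos] <;> norm_num)
          (0 : ZMod N) (κ i)
        rwa [zero_sub, zd_neg, ← hyy, mul_pow] at this
      have h3 : ∏ i, y ^ zd (κ i) ≤ y ^ n := by
        rw [Finset.prod_pow_eq_pow_sum]
        exact pow_le_pow_of_le_one hy0 (by linarith) (by rw [← hκ']; exact min_le_left _ _)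
      have h4 : 0 ≤ ∏ i, y ^ zd (κ i) := Finset.prod_nonneg fun i _ => pow_nonneg hy0 _
      rw [Finset.prod_mul_distrib, Finset.prod_mul_distrib] at h2
      simp only [Finset.prod_const, Finset.card_univ, Fintype.card_fin] at h2
      have h5 : 0 ≤ ∏ i, |M 0 (κ i)| := Finset.prod_nonneg fun i _ => abs_nonneg _
      have h6 := l1_nonneg (∏ i, X (Sum.inl (κ i)) : Poly N)
      calc _ ≤ 1 / 4 * (∏ i, |M 0 (κ i)|) * 1 := by gcongr
        _ ≤ 1 / 4 * (4 ^ 4 * ((∏ i, y ^ zd (κ i)) * ∏ i, y ^ zd (κ i))) * 1 := by gcongr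
        _ ≤ 1 / 4 * (4 ^ 4 * (y ^ n * ∏ i, y ^ zd (κ i))) * 1 := by gcongr
        _ = _ := by ring
    refine (Finset.sum_le_sum hb).trans ?_
    rw [← Finset.mul_sum]
    -- The remaining weights factorize into four sums over the ring, each at most 4. The constant is
    -- 64 · 4⁴ = 16384.
    have h1 : ∑ κ : Fin 4 → ZMod N with min (∑ i, zd (κ i)) (N - 1) = n, ∏ i, y ^ zd (κ i)
        ≤ (∑ k : ZMod N, y ^ zd k) ^ 4 := by
      rw [Fintype.sum_pow]
      exact Finset.sum_le_univ_sum_of_nonneg fun κ =>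
        Finset.prod_nonneg fun i _ => pow_nonneg hy0 _
    have h2 : ∑ k : ZMod N, y ^ zd k ≤ 4 := by
      refine (sum_pow_zd_le hy0 (by linarith)).trans ?_
      rw [div_le_iff₀ (by linarith)]; linarith
    have h3 : (∑ k : ZMod N, y ^ zd k) ^ 4 ≤ 4 ^ 4 :=
      pow_le_pow_left₀ (Finset.sum_nonneg fun _ _ => pow_nonneg hy0 _) h2 4
    have h4 := pow_nonneg hy0 n
    nlinarith

theorem SeedOfClass.mono {d : ℕ} {F : Poly N} {f : ℕ → Poly N} {C C' σ : ℝ}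
    (h : SeedOfClass d F f C σ) (hC : C ≤ C') : SeedOfClass d F f C' σ :=
  ⟨h.1, fun m hm => ⟨(h.2 m hm).1, (h.2 m hm).2.1, (h.2 m hm).2.2.trans
    (mul_le_mul_of_nonneg_right hC (Real.exp_pos _).le)⟩⟩

end Seeds

/-! ### The Lie transform -/

section LieTransform

variable {N : ℕ} [NeZero N]

theorem sum_antidiagonal_assoc {M : Type*} [AddCommMonoid M] (n : ℕ) (f : ℕ → ℕ → ℕ → M) :
    ∑ p ∈ Finset.HasAntidiagonal.antidiagonal n, ∑ q ∈ Finset.HasAntidiagonal.antidiagonal p.1, f q.1 q.2 p.2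
      = ∑ p ∈ Finset.HasAntidiagonal.antidiagonal n, ∑ q ∈ Finset.HasAntidiagonal.antidiagonal p.2, f p.1 q.1 q.2 := by
  rw [Finset.sum_sigma', Finset.sum_sigma']
  refine Finset.sum_nbij' (fun x => ⟨(x.2.1, x.2.2 + x.1.2), (x.2.2, x.1.2)⟩)
    (fun x => ⟨(x.1.1 + x.2.1, x.2.2), (x.1.1, x.2.1)⟩) ?_ ?_ ?_ ?_ ?_
  all_goals
    rintro ⟨⟨a, b⟩, ⟨c, d⟩⟩ h
    simp only [Finset.mem_sigma, Finset.HasAntidiagonal.mem_antidiagonal] at h ⊢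
  · exact ⟨by omega, trivial⟩
  · exact ⟨by omega, trivial⟩
  · obtain ⟨h1, h2⟩ := h; subst h2; rfl
  · obtain ⟨h1, h2⟩ := h; subst h2; rfl

theorem lieE_zero (χ : ℕ → Poly N) (f : Poly N) : lieE χ 0 f = f := by rw [lieE]

theorem lieE_succ (χ : ℕ → Poly N) (s : ℕ) (f : Poly N) :
    lieE χ (s + 1) f = ∑ j ∈ Finset.range (s + 1),
      C (((j : ℝ) + 1) / (s + 1)) * pb (χ (j + 1)) (lieE χ (s - j) f) := by
  rw [lieE, ← Fin.sum_univ_eq_sum_range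
    (fun j : ℕ => C (((j : ℝ) + 1) / (s + 1)) * pb (χ (j + 1)) (lieE χ (s - j) f))]
  rfl

theorem lieE_congr {χ χ' : ℕ → Poly N} {s : ℕ} (h : ∀ j, 1 ≤ j → j ≤ s → χ j = χ' j) (f : Poly N) :
    lieE χ s f = lieE χ' s f := by
  induction s using Nat.strong_induction_on with
  | _ s ih =>
    cases s with
    | zero => rw [lieE_zero, lieE_zero]
    | succ s =>
      rw [lieE_succ, lieE_succ]
      refine Finset.sum_congr rfl fun j hj => ?_
      have hj' := Finset.mem_range.1 hj
      rw [h (j + 1) (by omega) (by omega),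
        ih (s - j) (by omega) fun i h1 h2 => h i h1 (by omega)]

theorem isHomogeneous_lieE {χ : ℕ → Poly N} {s : ℕ}
    (hχ : ∀ j, 1 ≤ j → j ≤ s → (χ j).IsHomogeneous (2 * j + 2)) {f : Poly N} {l : ℕ}
    (hf : f.IsHomogeneous (2 * l + 2)) : (lieE χ s f).IsHomogeneous (2 * (s + l) + 2) := by
  induction s using Nat.strong_induction_on with
  | _ s ih =>
    cases s with
    | zero => rw [lieE_zero]; simpa using hf
    | succ s =>
      rw [lieE_succ]
      refine IsHomogeneous.sum _ _ _ fun j hj => IsHomogeneous.C_mul ?_ _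
      have hj' := Finset.mem_range.1 hj
      have h1 := ih (s - j) (by omega) fun i h1 h2 => hχ i h1 (by omega)
      have h2 := isHomogeneous_pb (m := 2 * (j + 1) + 1) (hχ (j + 1) (by omega) (by omega))
        (n := 2 * (s - j + l) + 1) h1
      have e : 2 * (j + 1) + 1 + (2 * (s - j + l) + 1) = 2 * (s + 1 + l) + 2 := by omega
      rwa [e] at h2

/-- The map φ' on the generating functions may differ from φ by a sign, as it does for the reversal
of the momenta, which changes the sign of brackets. -/
theorem lieE_map {χ : ℕ → Poly N} (φ : Poly N →ₐ[ℝ] Poly N) (φ' : Poly N → Poly N)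
    (hφ : ∀ f g, φ (pb f g) = pb (φ' f) (φ g)) (s : ℕ) (f : Poly N) :
    φ (lieE χ s f) = lieE (fun j => φ' (χ j)) s (φ f) := by
  induction s using Nat.strong_induction_on with
  | _ s ih =>
    cases s with
    | zero => rw [lieE_zero, lieE_zero]
    | succ s =>
      rw [lieE_succ, lieE_succ, map_sum]
      refine Finset.sum_congr rfl fun j hj => ?_
      rw [map_mul, hφ, ih (s - j) (by omega), ← algebraMap_eq, φ.commutes]

theorem lieE_arg_zero (χ : ℕ → Poly N) (s : ℕ) : lieE χ s 0 = 0 := by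
  induction s using Nat.strong_induction_on with
  | _ s ih =>
    cases s with
    | zero => rw [lieE_zero]
    | succ s =>
      rw [lieE_succ]
      refine Finset.sum_eq_zero fun j _ => ?_
      rw [ih (s - j) (by omega), pb_zero_right, mul_zero]

/-- The recursion with its denominator cleared. The term j = 0 has weight zero, so the sum can run
over the full antidiagonal. -/
theorem lieE_recursion (χ : ℕ → Poly N) (s : ℕ) (f : Poly N) :
    C (s : ℝ) * lieE χ s f
      = ∑ p ∈ Finset.HasAntidiagonal.antidiagonal s, C (p.1 : ℝ) * pb (χ p.1) (lieE χ p.2 f) := by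
  cases s with
  | zero => simp
  | succ s =>
    rw [Finset.Nat.sum_antidiagonal_succ, Finset.Nat.sum_antidiagonal_eq_sum_range_succ_mk, lieE_succ,
      Finset.mul_sum]
    simp only [Nat.cast_zero, map_zero, zero_mul, zero_add]
    refine Finset.sum_congr rfl fun j _ => ?_
    rw [← mul_assoc, ← map_mul]
    congr 2
    have : (s : ℝ) + 1 ≠ 0 := by positivity
    push_cast
    field_simp

/-- The operators of the Lie transform satisfy the Leibniz rule for the Poisson bracket. -/
theorem lieE_pb (χ : ℕ → Poly N) (s : ℕ) (f g : Poly N) :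
    lieE χ s (pb f g) = ∑ p ∈ Finset.HasAntidiagonal.antidiagonal s, pb (lieE χ p.1 f) (lieE χ p.2 g) := by
  induction s using Nat.strong_induction_on with
  | _ s ih =>
    rcases Nat.eq_zero_or_pos s with rfl | hs
    · simp [lieE_zero]
    have hsC : (C (s : ℝ) : Poly N) ≠ 0 := by
      rw [Ne, C_eq_zero]; exact_mod_cast hs.ne'
    -- Multiplied by s, the recursion behaves like a derivative in the order parameter. Jacobi
    -- distributes {χ_j, ·} over the two factors, each factor is reassembled by its own recursion,
    -- and the weights of the two orders add up to s.
    refine mul_left_cancel₀ hsC ?_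
    have e1 : ∑ p ∈ Finset.HasAntidiagonal.antidiagonal s, C (p.1 : ℝ) * pb (χ p.1) (lieE χ p.2 (pb f g))
        = ∑ p ∈ Finset.HasAntidiagonal.antidiagonal s, ∑ q ∈ Finset.HasAntidiagonal.antidiagonal p.2,
          (C (p.1 : ℝ) * pb (pb (χ p.1) (lieE χ q.1 f)) (lieE χ q.2 g)
            + C (p.1 : ℝ) * pb (lieE χ q.1 f) (pb (χ p.1) (lieE χ q.2 g))) := by
      refine Finset.sum_congr rfl fun p hp => ?_
      rcases Nat.eq_zero_or_pos p.1 with h0 | h0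
      · simp [h0]
      · have := Finset.HasAntidiagonal.mem_antidiagonal.1 hp
        rw [ih p.2 (by omega), pb_sum_right, Finset.mul_sum]
        refine Finset.sum_congr rfl fun q _ => ?_
        rw [pb_jacobi, mul_add]
    rw [lieE_recursion, e1]
    simp only [Finset.sum_add_distrib]
    have e2 := sum_antidiagonal_assoc s fun j u v =>
      C (j : ℝ) * pb (pb (χ j) (lieE χ u f)) (lieE χ v g)
    have e3 : ∑ p ∈ Finset.HasAntidiagonal.antidiagonal s, ∑ q ∈ Finset.HasAntidiagonal.antidiagonal p.2,
          C (p.1 : ℝ) * pb (lieE χ q.1 f) (pb (χ p.1) (lieE χ q.2 g))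
        = ∑ p ∈ Finset.HasAntidiagonal.antidiagonal s, ∑ q ∈ Finset.HasAntidiagonal.antidiagonal p.2,
          C (q.1 : ℝ) * pb (lieE χ p.1 f) (pb (χ q.1) (lieE χ q.2 g)) := by
      rw [← sum_antidiagonal_assoc s fun j u v =>
          C (j : ℝ) * pb (lieE χ u f) (pb (χ j) (lieE χ v g)),
        ← sum_antidiagonal_assoc s fun u j v =>
          C (j : ℝ) * pb (lieE χ u f) (pb (χ j) (lieE χ v g))]
      refine Finset.sum_congr rfl fun p _ => ?_
      rw [← Finset.Nat.sum_antidiagonal_swap]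
      rfl
    rw [← e2, e3, ← Finset.sum_add_distrib, Finset.mul_sum]
    refine Finset.sum_congr rfl fun p hp => ?_
    have h1 : ∑ q ∈ Finset.HasAntidiagonal.antidiagonal p.1,
        C (q.1 : ℝ) * pb (pb (χ q.1) (lieE χ q.2 f)) (lieE χ p.2 g)
        = C (p.1 : ℝ) * pb (lieE χ p.1 f) (lieE χ p.2 g) := by
      rw [← pb_C_mul_left, lieE_recursion, pb_sum_left]
      simp only [pb_C_mul_left]
    have h2 : ∑ q ∈ Finset.HasAntidiagonal.antidiagonal p.2,
        C (q.1 : ℝ) * pb (lieE χ p.1 f) (pb (χ q.1) (lieE χ q.2 g))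
        = C (p.2 : ℝ) * pb (lieE χ p.1 f) (lieE χ p.2 g) := by
      rw [← pb_C_mul_right, lieE_recursion, pb_sum_right]
      simp only [pb_C_mul_right]
    rw [h1, h2, ← add_mul, ← map_add]
    have := Finset.HasAntidiagonal.mem_antidiagonal.1 hp
    rw [← this]
    push_cast
    rfl

end LieTransform

/-! ### Complex coordinates diagonalizing the bracket with H_Ω -/

section Complexification

variable {N : ℕ} [NeZero N] {a : ℝ}

/-- Complex canonical coordinates which diagonalize the bracket with `H_Ω`. -/
def theta : Poly N →ₐ[ℝ] MvPolynomial (Var N) ℂ :=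
  aeval (Sum.elim (fun l => X (Sum.inl l) + C (Complex.I / 2) * X (Sum.inr l))
    (fun l => C Complex.I * X (Sum.inl l) + C (1 / 2) * X (Sum.inr l)))

@[simp] theorem theta_X_inl (l : ZMod N) :
    theta (X (Sum.inl l) : Poly N) = X (Sum.inl l) + C (Complex.I / 2) * X (Sum.inr l) := by
  simp [theta]

@[simp] theorem theta_X_inr (l : ZMod N) :
    theta (X (Sum.inr l) : Poly N) = C Complex.I * X (Sum.inl l) + C (1 / 2) * X (Sum.inr l) := by
  simp [theta]

theorem theta_C (c : ℝ) : theta (C c : Poly N) = C (c : ℂ) := by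
  rw [← algebraMap_eq, AlgHom.commutes]; rfl

theorem C_I_mul_C_I {σ : Type*} : (C Complex.I : MvPolynomial σ ℂ) * C Complex.I = -1 := by
  rw [← map_mul, Complex.I_mul_I]; simp

theorem pb_X_inr_inl {R : Type*} [CommRing R] (i j : ZMod N) :
    pb (X (Sum.inr i) : MvPolynomial (Var N) R) (X (Sum.inl j)) = if j = i then -1 else 0 := by
  rw [pb_antisymm, pb_X_inl_inr]; split_ifs <;> simp

theorem pb_theta (f g : Poly N) : pb (theta f) (theta g) = theta (pb f g) := by
  rw [pb_algHom theta 1, one_mul]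
  · intro i j
    simp only [theta_X_inl, pb_add_left, pb_add_right, pb_C_mul_left, pb_C_mul_right, pb_X_inl_inl,
      pb_X_inr_inr, pb_X_inl_inr, pb_X_inr_inl]
    rcases eq_or_ne i j with rfl | h
    · simp
    · simp [h, h.symm]
  · intro i j
    simp only [theta_X_inr, pb_add_left, pb_add_right, pb_C_mul_left, pb_C_mul_right, pb_X_inl_inl,
      pb_X_inr_inr, pb_X_inl_inr, pb_X_inr_inl]
    rcases eq_or_ne i j with rfl | h
    · simp; ring
    · simp [h, h.symm]
  · intro i j
    simp only [theta_X_inr, theta_X_inl, pb_add_left, pb_add_right, pb_C_mul_left, pb_C_mul_right,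
      pb_X_inl_inl, pb_X_inr_inr, pb_X_inl_inr, pb_X_inr_inl]
    rcases eq_or_ne i j with rfl | h
    · simp only [if_true, mul_zero, zero_add, add_zero, mul_one, mul_neg, ← map_mul, ← map_neg,
        ← map_add]
      rw [← C_1]
      congr 1
      linear_combination (-1 / 2 : ℂ) * Complex.I_mul_I
    · simp [h, h.symm]

/-- Return from the complex coordinates, followed by a real substitution. -/
def backHom (φ : Poly N →ₐ[ℝ] Poly N) :
    MvPolynomial (Var N) ℂ →ₐ[ℂ] MvPolynomial (Var N) ℂ :=
  aeval (Sum.elim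
    (fun l => C (1 / 2) * MvPolynomial.map Complex.ofRealHom (φ (X (Sum.inl l)))
      - C (Complex.I / 2) * MvPolynomial.map Complex.ofRealHom (φ (X (Sum.inr l))))
    (fun l => MvPolynomial.map Complex.ofRealHom (φ (X (Sum.inr l)))
      - C Complex.I * MvPolynomial.map Complex.ofRealHom (φ (X (Sum.inl l)))))

/-- The inverse substitution is ξ = (q - ip)/2, η = p - iq. Composing it with φ inside one
homomorphism allows a single norm estimate for the return to the original variables. -/
theorem backHom_theta (φ : Poly N →ₐ[ℝ] Poly N) (f : Poly N) :
    backHom φ (theta f) = MvPolynomial.map Complex.ofRealHom (φ f) := by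
  have key : ((backHom φ).restrictScalars ℝ).comp theta
      = (mapAlgHom (Complex.ofRealAm : ℝ →ₐ[ℝ] ℂ)).comp φ := by
    refine algHom_ext fun v => ?_
    have e1 : ∀ c : ℂ, backHom φ (C c) = C c := fun c => by
      rw [← algebraMap_eq, AlgHom.commutes]
    have e2 : (C (Complex.I / 2) : MvPolynomial (Var N) ℂ) * C Complex.I = -C (1 / 2) := by
      rw [← map_mul, ← map_neg]; congr 1; linear_combination (1 / 2 : ℂ) * Complex.I_mul_I
    have e3 : (C (1 / 2) : MvPolynomial (Var N) ℂ) + C (1 / 2) = 1 := by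
      rw [← map_add, ← C_1]; congr 1; norm_num
    have e4 : (C Complex.I : MvPolynomial (Var N) ℂ) * C (1 / 2) = C (Complex.I / 2) := by
      rw [← map_mul]; congr 1; ring
    rcases v with l | l
    · simp only [AlgHom.comp_apply, AlgHom.restrictScalars_apply, theta_X_inl, map_add, map_mul, e1]
      simp only [backHom, aeval_X, Sum.elim_inl, Sum.elim_inr, mapAlgHom_apply]
      have : (Complex.ofRealAm : ℝ →ₐ[ℝ] ℂ).toRingHom = Complex.ofRealHom := rfl
      change _ = MvPolynomial.map Complex.ofRealHom _
      linear_combination (MvPolynomial.map Complex.ofRealHom (φ (X (Sum.inl l)))) * e3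
        - MvPolynomial.map Complex.ofRealHom (φ (X (Sum.inl l))) * e2
    · simp only [AlgHom.comp_apply, AlgHom.restrictScalars_apply, theta_X_inr, map_add, map_mul, e1]
      simp only [backHom, aeval_X, Sum.elim_inl, Sum.elim_inr, mapAlgHom_apply]
      change _ = MvPolynomial.map Complex.ofRealHom _
      linear_combination (MvPolynomial.map Complex.ofRealHom (φ (X (Sum.inr l)))) * e3
        - MvPolynomial.map Complex.ofRealHom (φ (X (Sum.inr l))) * e2
        + MvPolynomial.map Complex.ofRealHom (φ (X (Sum.inl l))) * e4
        - MvPolynomial.map Complex.ofRealHom (φ (X (Sum.inl l))) * e4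
  exact congrArg (fun ψ => ψ f) key

theorem theta_injective : Function.Injective (theta : Poly N →ₐ[ℝ] MvPolynomial (Var N) ℂ) := by
  intro f g h
  have h1 := congrArg (backHom (AlgHom.id ℝ (Poly N))) h
  rw [backHom_theta, backHom_theta] at h1
  exact map_injective _ Complex.ofRealHom.injective h1

theorem isHomogeneous_theta {f : Poly N} {n : ℕ} (hf : f.IsHomogeneous n) :
    (theta f).IsHomogeneous n := by
  have h : theta f = aeval (Sum.elim (fun l => X (Sum.inl l) + C (Complex.I / 2) * X (Sum.inr l))
      (fun l => C Complex.I * X (Sum.inl l) + C (1 / 2) * X (Sum.inr l))) f := rfl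
  rw [h, ← one_mul n]
  refine IsHomogeneous.aeval hf _ fun v => ?_
  rcases v with l | l
  · exact (isHomogeneous_X ℂ _).add ((isHomogeneous_X ℂ _).C_mul _)
  · exact ((isHomogeneous_X ℂ _).C_mul _).add ((isHomogeneous_X ℂ _).C_mul _)

/-- With q = ξ + iη/2 and p = iξ + η/2 the squares cancel in q² + p², and 2iξη remains. -/
theorem theta_HOmega : theta (HOmega N a) =
    ∑ l, C ((Omega N a : ℂ) * Complex.I) * (X (Sum.inl l) * X (Sum.inr l)) := by
  rw [HOmega, map_mul, theta_C, map_sum, Finset.mul_sum]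
  refine Finset.sum_congr rfl fun l _ => ?_
  rw [map_add, map_pow, map_pow, theta_X_inl, theta_X_inr]
  have e1 : (C (Complex.I / 2) : MvPolynomial (Var N) ℂ) = C Complex.I * C (1 / 2) := by
    rw [← map_mul]; congr 1; ring
  have e2 : (C ((Omega N a / 2 : ℝ) : ℂ) : MvPolynomial (Var N) ℂ) = C (Omega N a : ℂ) * C (1 / 2) := by
    rw [← map_mul]; congr 1; push_cast; ring
  have e3 : (C (1 / 2) : MvPolynomial (Var N) ℂ) + C (1 / 2) = 1 := by
    rw [← map_add, ← C_1]; congr 1; norm_num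
  have e4 := C_I_mul_C_I (σ := Var N)
  rw [e1, e2, map_mul]
  set I' := (C Complex.I : MvPolynomial (Var N) ℂ)
  set h := (C (1 / 2) : MvPolynomial (Var N) ℂ)
  set x := (X (Sum.inl l) : MvPolynomial (Var N) ℂ)
  set y := (X (Sum.inr l) : MvPolynomial (Var N) ℂ)
  set w := (C (Omega N a : ℂ) : MvPolynomial (Var N) ℂ)
  linear_combination (w * h * x ^ 2 + w * h * h * h * y ^ 2) * e4
    + (w * I' * x * y * (2 * h + 1)) * e3

/-- The eigenvalue of the monomial `d` with respect to the bracket with `H_Ω`, up to `i Ω`. -/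
def resonance (d : Var N →₀ ℕ) : ℤ := ∑ l, ((d (Sum.inr l) : ℤ) - d (Sum.inl l))

theorem coeff_X_mul_pderiv {σ K : Type*} [CommRing K] (v : σ) (f : MvPolynomial σ K) (d : σ →₀ ℕ) :
    coeff d (X v * pderiv v f) = d v * coeff d f := by
  classical
  rw [coeff_X_mul']
  split_ifs with h
  · have hd : d - Finsupp.single v 1 + Finsupp.single v 1 = d :=
      tsub_add_cancel_of_le (Finsupp.single_le_iff.2
        (Nat.one_le_iff_ne_zero.2 (Finsupp.mem_support_iff.1 h)))
    rw [coeff_pderiv, hd, mul_comm]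
    congr 1
    conv_rhs => rw [← hd]
    rw [Finsupp.add_apply, Finsupp.single_eq_same]
    push_cast; rfl
  · rw [Finsupp.notMem_support_iff.1 h]; simp

/-- Bracketing with iΩ ∑ ξ_l η_l counts the degree in η minus the degree in ξ, so every monomial is
an eigenvector. -/
theorem coeff_pb_HOmega (g : MvPolynomial (Var N) ℂ) (d : Var N →₀ ℕ) :
    coeff d (pb (theta (HOmega N a)) g)
      = (Omega N a : ℂ) * Complex.I * (resonance d : ℂ) * coeff d g := by
  have h : pb (theta (HOmega N a)) g = ∑ l, C ((Omega N a : ℂ) * Complex.I) *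
      (X (Sum.inr l) * pderiv (Sum.inr l) g - X (Sum.inl l) * pderiv (Sum.inl l) g) := by
    rw [theta_HOmega, pb_sum_left]
    refine Finset.sum_congr rfl fun l _ => ?_
    rw [pb_C_mul_left, pb_mul_left, pb_antisymm _ g, pb_antisymm _ g, pb_X_inr_right,
      pb_X_inl_right]
    ring
  rw [h, coeff_sum]
  simp only [coeff_C_mul, coeff_sub, coeff_X_mul_pderiv, resonance]
  push_cast
  rw [Finset.mul_sum, Finset.sum_mul]
  exact Finset.sum_congr rfl fun l _ => by ring

end Complexification

/-! ### Quadratic forms commuting with H_Ω -/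

section QuadraticFacts

variable {N : ℕ} [NeZero N] {a : ℝ}

theorem isHomogeneous_quadForm (M : Matrix (ZMod N) (ZMod N) ℝ) :
    (quadForm M).IsHomogeneous 2 :=
  (IsHomogeneous.sum _ _ _ fun _ _ => IsHomogeneous.sum _ _ _ fun _ _ =>
    (((isHomogeneous_X ℝ _).mul (isHomogeneous_X ℝ _)).add
      ((isHomogeneous_X ℝ _).mul (isHomogeneous_X ℝ _))).C_mul _).C_mul _

theorem isHomogeneous_HOmega : (HOmega N a).IsHomogeneous 2 := by
  rw [HOmega_eq]; exact isHomogeneous_quadForm _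

theorem isHomogeneous_linSubstHom {M M' : Matrix (ZMod N) (ZMod N) ℝ} {f : Poly N} {n : ℕ}
    (hf : f.IsHomogeneous n) : (linSubstHom M M' f).IsHomogeneous n := by
  rw [linSubstHom, ← one_mul n]
  refine IsHomogeneous.aeval hf _ fun v => ?_
  rcases v with l | l <;>
  exact IsHomogeneous.sum _ _ _ fun _ _ => (isHomogeneous_X ℝ _).C_mul _

theorem isHomogeneous_H1 : (H1 N).IsHomogeneous 4 := by
  refine IsHomogeneous.C_mul (IsHomogeneous.sum _ _ _ fun j _ => ?_) _
  simpa using (isHomogeneous_X ℝ (Sum.inl j : Var N)).pow 4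

theorem isHomogeneous_toNormal_H1 : (toNormal a (H1 N)).IsHomogeneous 4 :=
  isHomogeneous_linSubstHom isHomogeneous_H1

theorem isHomogeneous_toNormal_H0 (ha : 0 < a) : (toNormal a (H0 N a)).IsHomogeneous 2 := by
  rw [toNormal_H0 ha]; exact isHomogeneous_quadForm _

theorem isHomogeneous_Z0 (ha : 0 < a) : (Z0 N a).IsHomogeneous 2 := by
  rw [Z0_eq ha]; exact isHomogeneous_quadForm _

theorem pderiv_inl_quadForm {M : Matrix (ZMod N) (ZMod N) ℝ} (hM : ∀ i j, M i j = M j i)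
    (l : ZMod N) : pderiv (Sum.inl l) (quadForm M) = ∑ j, C (M l j) * X (Sum.inl j) := by
  have h : ∀ i j, pderiv (Sum.inl l) (C (M i j) *
      (X (Sum.inl i) * X (Sum.inl j) + X (Sum.inr i) * X (Sum.inr j)) : Poly N)
      = (if i = l then C (M i j) * X (Sum.inl j) else 0)
        + if j = l then C (M i j) * X (Sum.inl i) else 0 := fun i j => by
    rw [pderiv_C_mul, map_add, pderiv_mul, pderiv_mul]
    rw [pderiv_X_of_ne (i := Sum.inl l) (j := Sum.inr i) (by simp),
      pderiv_X_of_ne (i := Sum.inl l) (j := Sum.inr j) (by simp)]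
    have e : ∀ i, pderiv (Sum.inl l) (X (Sum.inl i) : Poly N) = if i = l then 1 else 0 := fun i => by
      rw [← pb_X_inr_right, pb_X_inl_inr]
    rw [e, e]
    split_ifs <;> ring
  rw [quadForm, pderiv_C_mul]
  simp only [map_sum, h, Finset.sum_add_distrib, Finset.sum_ite_eq', Finset.mem_univ, if_true]
  rw [Finset.sum_comm]
  simp only [Finset.sum_ite_eq', Finset.mem_univ, if_true, hM _ l]
  rw [← two_mul, ← mul_assoc]
  have : (C (1 / 2) : Poly N) * 2 = 1 := by
    rw [← map_ofNat C 2, ← map_mul, ← C_1]; norm_num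
  rw [this, one_mul]

theorem pderiv_inr_quadForm {M : Matrix (ZMod N) (ZMod N) ℝ} (hM : ∀ i j, M i j = M j i)
    (l : ZMod N) : pderiv (Sum.inr l) (quadForm M) = ∑ j, C (M l j) * X (Sum.inr j) := by
  have h : ∀ i j, pderiv (Sum.inr l) (C (M i j) *
      (X (Sum.inl i) * X (Sum.inl j) + X (Sum.inr i) * X (Sum.inr j)) : Poly N)
      = (if i = l then C (M i j) * X (Sum.inr j) else 0)
        + if j = l then C (M i j) * X (Sum.inr i) else 0 := fun i j => by
    rw [pderiv_C_mul, map_add, pderiv_mul, pderiv_mul]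
    rw [pderiv_X_of_ne (i := Sum.inr l) (j := Sum.inl i) (by simp),
      pderiv_X_of_ne (i := Sum.inr l) (j := Sum.inl j) (by simp)]
    have e : ∀ i, pderiv (Sum.inr l) (X (Sum.inr i) : Poly N) = if i = l then 1 else 0 := fun i => by
      classical
      rw [pderiv_X, Pi.single_apply]
      simp
    rw [e, e]
    split_ifs <;> ring
  rw [quadForm, pderiv_C_mul]
  simp only [map_sum, h, Finset.sum_add_distrib, Finset.sum_ite_eq', Finset.mem_univ, if_true]
  rw [Finset.sum_comm]
  simp only [Finset.sum_ite_eq', Finset.mem_univ, if_true, hM _ l]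
  rw [← two_mul, ← mul_assoc]
  have : (C (1 / 2) : Poly N) * 2 = 1 := by
    rw [← map_ofNat C 2, ← map_mul, ← C_1]; norm_num
  rw [this, one_mul]

/-- H_Ω rotates all planes (q_j, p_j) simultaneously, which preserves a form with the same symmetric
matrix in q and in p. -/
theorem pb_HOmega_quadForm {M : Matrix (ZMod N) (ZMod N) ℝ} (hM : ∀ i j, M i j = M j i) :
    pb (HOmega N a) (quadForm M) = 0 := by
  have hΩ : ∀ i j, (Omega N a • (1 : Matrix (ZMod N) (ZMod N) ℝ)) i j
      = (Omega N a • (1 : Matrix (ZMod N) (ZMod N) ℝ)) j i := fun i j => by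
    simp [Matrix.one_apply, eq_comm]
  have e : ∀ (l : ZMod N) (Q : ZMod N → Poly N),
      ∑ j, C ((Omega N a • (1 : Matrix (ZMod N) (ZMod N) ℝ)) l j) * Q j = C (Omega N a) * Q l :=
    fun l Q => by simp [Matrix.one_apply, apply_ite (C : ℝ → Poly N), ite_mul]
  rw [HOmega_eq, pb]
  simp only [pderiv_inl_quadForm hM, pderiv_inr_quadForm hM, pderiv_inl_quadForm hΩ,
    pderiv_inr_quadForm hΩ, e]
  rw [Finset.sum_sub_distrib, sub_eq_zero]
  simp only [Finset.mul_sum]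
  rw [Finset.sum_comm]
  refine Finset.sum_congr rfl fun i _ => Finset.sum_congr rfl fun j _ => ?_
  rw [hM]; ring

theorem pb_HOmega_H0 (ha : 0 < a) : pb (HOmega N a) (toNormal a (H0 N a)) = 0 := by
  rw [toNormal_H0 ha]; exact pb_HOmega_quadForm (powA_symm _)

theorem toNormal_H0_eq_add : toNormal a (H0 N a) = HOmega N a + Z0 N a := by rw [Z0]; ring

end QuadraticFacts

/-! ### The homological equation -/

section HomologicalEquation

variable {N : ℕ} [NeZero N] {a : ℝ}

/-- The interaction norm in the complex coordinates. -/
def gt (f : Poly N) : ℝ := gn (theta f)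

theorem gt_nonneg (f : Poly N) : 0 ≤ gt f := gn_nonneg _

theorem gt_sub_le (f g : Poly N) : gt (f - g) ≤ gt f + gt g := by
  rw [gt, map_sub]; exact gn_sub_le _ _

theorem gt_sum_le {ι : Type*} (s : Finset ι) (f : ι → Poly N) :
    gt (∑ i ∈ s, f i) ≤ ∑ i ∈ s, gt (f i) := by
  rw [gt, map_sum]; exact gn_sum_le _ _

theorem gt_C_mul_le (c : ℝ) (f : Poly N) : gt (C c * f) ≤ |c| * gt f := by
  rw [gt, map_mul, theta_C]
  refine (gn_C_mul_le _ _).trans_eq ?_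
  rw [Complex.norm_real, Real.norm_eq_abs, gt]

theorem gt_pb_le {f g : Poly N} {m n : ℕ} (hf : f.IsHomogeneous (m + 1))
    (hg : g.IsHomogeneous (n + 1)) : gt (pb f g) ≤ (m + n) * gt f * gt g := by
  rw [gt, ← pb_theta]
  exact gn_pb_le (isHomogeneous_theta hf) (isHomogeneous_theta hg)

theorem eq_zero_of_gt_eq_zero {f : Poly N} {n : ℕ} (hf : f.IsHomogeneous n) (hn : n ≠ 0)
    (h : gt f = 0) : f = 0 :=
  theta_injective (by rw [eq_zero_of_gn_eq_zero (isHomogeneous_theta hf) hn h, map_zero])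

theorem Omega_pos (ha : 0 < a) : 0 < Omega N a := lt_of_lt_of_le one_pos (Omega_bounds ha).1

theorem coeff_theta_of_range (g : Poly N) {d : Var N →₀ ℕ} (hd : resonance d = 0) :
    coeff d (theta (pb (HOmega N a) g)) = 0 := by
  rw [← pb_theta, coeff_pb_HOmega, hd]; simp

theorem coeff_theta_of_ker (ha : 0 < a) {z : Poly N} (hz : pb (HOmega N a) z = 0) {d : Var N →₀ ℕ}
    (hd : resonance d ≠ 0) : coeff d (theta z) = 0 := by
  have h := coeff_pb_HOmega (a := a) (theta z) d
  rw [pb_theta, hz, map_zero, coeff_zero] at h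
  have h1 : (Omega N a : ℂ) * Complex.I * (resonance d : ℂ) ≠ 0 :=
    mul_ne_zero (mul_ne_zero (by exact_mod_cast (Omega_pos ha).ne') Complex.I_ne_zero)
      (by exact_mod_cast hd)
  exact (mul_eq_zero.1 h.symm).resolve_left h1

/-- The kernel and the range of `{H_Ω, ·}` have disjoint supports. -/
theorem gt_le_of_add_eq (ha : 0 < a) {x z ψ : Poly N} (hx : ∃ g, x = pb (HOmega N a) g)
    (hz : pb (HOmega N a) z = 0) (h : x + z = ψ) : gt x ≤ gt ψ ∧ gt z ≤ gt ψ := by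
  obtain ⟨g, rfl⟩ := hx
  constructor <;> refine gn_mono fun d => ?_ <;> rw [← h, map_add, coeff_add] <;>
    by_cases hd : resonance d = 0
  · rw [coeff_theta_of_range g hd, norm_zero]; exact norm_nonneg _
  · rw [coeff_theta_of_ker ha hz hd, add_zero]
  · rw [coeff_theta_of_range g hd, zero_add]
  · rw [coeff_theta_of_ker ha hz hd, norm_zero]; exact norm_nonneg _

/-- On the range only monomials with nonzero integer resonance occur, so the bracket with H_Ω
multiplies each coefficient by at least Ω: there are no small divisors. -/
theorem gt_range_le (ha : 0 < a) (g : Poly N) :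
    Omega N a * gt (pb (HOmega N a) g) ≤ gt (pb (HOmega N a) (pb (HOmega N a) g)) := by
  have hΩ := Omega_pos (N := N) ha
  set χ := pb (HOmega N a) g with hχ
  have h : gn (theta χ) ≤ gn (C (((Omega N a)⁻¹ : ℝ) : ℂ) * theta (pb (HOmega N a) χ)) := by
    refine gn_mono fun d => ?_
    have h0 : resonance d = 0 → coeff d (theta χ) = 0 := coeff_theta_of_range g
    clear_value χ
    by_cases hd : resonance d = 0
    · rw [h0 hd, norm_zero]; exact norm_nonneg _
    · rw [coeff_C_mul, ← pb_theta, coeff_pb_HOmega]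
      simp only [norm_mul, Complex.norm_I, Complex.norm_real, Real.norm_eq_abs, abs_inv,
        abs_of_pos hΩ, Complex.norm_intCast, mul_one]
      rw [← mul_assoc, ← mul_assoc, inv_mul_cancel₀ hΩ.ne', one_mul]
      have : (1 : ℝ) ≤ |(resonance d : ℝ)| := by exact_mod_cast Int.one_le_abs hd
      nlinarith [norm_nonneg (coeff d (theta χ))]
  have h2 := h.trans (gn_C_mul_le _ _)
  rw [Complex.norm_real, Real.norm_eq_abs, abs_inv, abs_of_pos hΩ, inv_mul_eq_div,
    le_div_iff₀ hΩ] at h2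
  rw [mul_comm]; exact h2

/-- By Jacobi and {H_Ω, H₀} = 0, bracketing with H₀ preserves the range of {H_Ω, ·}. -/
theorem pb_range_H0 (ha : 0 < a) (g : Poly N) : pb (pb (HOmega N a) g) (toNormal a (H0 N a))
    = pb (HOmega N a) (pb g (toNormal a (H0 N a))) := by
  rw [pb_jacobi, pb_HOmega_H0 ha, pb_zero_right, add_zero]

/-- The smallness condition under which the homological equation of degree `n` is solvable. -/
def SmallCoupling (N : ℕ) [NeZero N] (a : ℝ) (n : ℕ) : Prop := n * gt (Z0 N a) ≤ Omega N a / 2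

theorem isHomogeneous_pb_quadratic {f q : Poly N} {n : ℕ} (hf : f.IsHomogeneous (n + 1))
    (hq : q.IsHomogeneous 2) : (pb f q).IsHomogeneous (n + 1) :=
  isHomogeneous_pb (n := 1) hf hq

theorem isHomogeneous_pb_quadratic' {f q : Poly N} {n : ℕ} (hf : f.IsHomogeneous (n + 1))
    (hq : q.IsHomogeneous 2) : (pb q f).IsHomogeneous (n + 1) := by
  rw [pb_antisymm]; exact (isHomogeneous_pb_quadratic hf hq).neg

/-- Up to sign, {χ, H₀} is {H_Ω, χ}, of norm at least Ω times that of χ, perturbed by {χ, Z₀}, which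
smallness limits to Ω/2 times it. The difference Ω/2 is at least 1/2. -/
theorem gt_le_gt_pb_H0 (ha : 0 < a) {n : ℕ} (hs : SmallCoupling N a (n + 1)) {χ : Poly N}
    (hχ : ∃ g : Poly N, g.IsHomogeneous (n + 1) ∧ χ = pb (HOmega N a) g) :
    gt χ ≤ 2 * gt (pb χ (toNormal a (H0 N a))) := by
  obtain ⟨g, hg, hχg⟩ := hχ
  have hhom : χ.IsHomogeneous (n + 1) := by
    rw [hχg]; exact isHomogeneous_pb_quadratic' hg isHomogeneous_HOmega
  have h1 : Omega N a * gt χ ≤ gt (pb (HOmega N a) χ) := by rw [hχg]; exact gt_range_le ha g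
  have h2 : pb (HOmega N a) χ = pb χ (Z0 N a) - pb χ (toNormal a (H0 N a)) := by
    rw [toNormal_H0_eq_add, pb_add_right, pb_antisymm (HOmega N a)]; ring
  have h3 : gt (pb χ (Z0 N a)) ≤ (n + (1 : ℕ)) * gt χ * gt (Z0 N a) :=
    gt_pb_le (n := 1) hhom (isHomogeneous_Z0 ha)
  have h4 := gt_sub_le (pb χ (Z0 N a)) (pb χ (toNormal a (H0 N a)))
  rw [← h2] at h4
  have h5 : gt χ * ((n + 1 : ℕ) * gt (Z0 N a)) ≤ gt χ * (Omega N a / 2) :=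
    mul_le_mul_of_nonneg_left hs (gt_nonneg χ)
  push_cast at h3 h5
  have hΩ := (Omega_bounds (N := N) ha).1
  nlinarith [gt_nonneg χ]

/-- {χ, H₀} stays in the range and z in the kernel. These have disjoint supports in the complex
coordinates, so both summands vanish separately. -/
theorem homological_unique (ha : 0 < a) {n : ℕ} (hs : SmallCoupling N a (n + 1)) {χ z : Poly N}
    (hχ : ∃ g : Poly N, g.IsHomogeneous (n + 1) ∧ χ = pb (HOmega N a) g)
    (hz : z.IsHomogeneous (n + 1)) (hz' : pb (HOmega N a) z = 0)
    (h : pb χ (toNormal a (H0 N a)) + z = 0) : χ = 0 ∧ z = 0 := by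
  have h1 := gt_le_gt_pb_H0 ha hs hχ
  obtain ⟨g, hg, rfl⟩ := hχ
  have h2 := gt_le_of_add_eq ha ⟨_, pb_range_H0 ha g⟩ hz' h
  have h0 : gt (0 : Poly N) = 0 := by rw [gt, map_zero, gn_zero]
  rw [h0] at h2
  refine ⟨eq_zero_of_gt_eq_zero (isHomogeneous_pb_quadratic' hg isHomogeneous_HOmega)
    (Nat.succ_ne_zero n) (le_antisymm (by linarith [h2.1]) (gt_nonneg _)),
    eq_zero_of_gt_eq_zero hz (Nat.succ_ne_zero n) (le_antisymm h2.2 (gt_nonneg _))⟩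

/-- Rank–nullity: the product of the range and the kernel has the dimension of V, so uniqueness
implies solvability. -/
theorem exists_range_add_ker {V : Type*} [AddCommGroup V] [Module ℝ V] [FiniteDimensional ℝ V]
    (L B : V →ₗ[ℝ] V) (h : ∀ x z, (∃ g, L g = x) → L z = 0 → B x + z = 0 → x = 0 ∧ z = 0) (v : V) :
    ∃ x z, (∃ g, L g = x) ∧ L z = 0 ∧ B x + z = v := by
  let Φ : (LinearMap.range L × LinearMap.ker L) →ₗ[ℝ] V :=
    (B.comp (LinearMap.range L).subtype).coprod (LinearMap.ker L).subtype
  have hinj : Function.Injective Φ := by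
    refine (injective_iff_map_eq_zero Φ).2 ?_
    rintro ⟨⟨x, hx⟩, ⟨z, hz⟩⟩ h0
    obtain ⟨rfl, rfl⟩ := h x z hx hz h0
    rfl
  have hdim : Module.finrank ℝ (LinearMap.range L × LinearMap.ker L) = Module.finrank ℝ V := by
    rw [Module.finrank_prod, LinearMap.finrank_range_add_finrank_ker]
  have hsurj := (LinearMap.injective_iff_surjective_of_finrank_eq_finrank (f := Φ) hdim).1 hinj
  obtain ⟨⟨⟨x, hx⟩, ⟨z, hz⟩⟩, h⟩ := hsurj v
  exact ⟨x, z, hx, hz, h⟩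

theorem homological_exists (ha : 0 < a) {n : ℕ} (hs : SmallCoupling N a (n + 1)) {ψ : Poly N}
    (hψ : ψ.IsHomogeneous (n + 1)) : ∃ χ z : Poly N,
      (∃ g : Poly N, g.IsHomogeneous (n + 1) ∧ χ = pb (HOmega N a) g) ∧
      z.IsHomogeneous (n + 1) ∧ pb (HOmega N a) z = 0 ∧ pb χ (toNormal a (H0 N a)) + z = ψ := by
  let V := homogeneousSubmodule (Var N) ℝ (n + 1)
  have hfin : FiniteDimensional ℝ V :=
    Module.Finite.iff_fg.2 (homogeneousSubmodule_fg (Var N) ℝ (n + 1))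
  let L : V →ₗ[ℝ] V := ((pbD (HOmega N a)).toLinearMap).restrict (p := V) (q := V) fun f hf => by
    change (pbD (HOmega N a) f).IsHomogeneous (n + 1)
    rw [pbD_apply]
    exact isHomogeneous_pb_quadratic' hf isHomogeneous_HOmega
  let B : V →ₗ[ℝ] V := (-(pbD (toNormal a (H0 N a))).toLinearMap).restrict (p := V) (q := V)
    fun f hf => by
      change (-(pbD (toNormal a (H0 N a)) f)).IsHomogeneous (n + 1)
      rw [pbD_apply, ← pb_antisymm]
      exact isHomogeneous_pb_quadratic hf (isHomogeneous_toNormal_H0 ha)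
  have hL : ∀ v : V, (L v : Poly N) = pb (HOmega N a) v := fun v => pbD_apply _ _
  have hB : ∀ v : V, (B v : Poly N) = pb v (toNormal a (H0 N a)) := fun v => by
    change -(pbD (toNormal a (H0 N a)) v) = _
    rw [pbD_apply, ← pb_antisymm]
  obtain ⟨x, z, ⟨g, hg⟩, hz, h⟩ := exists_range_add_ker L B (by
    rintro x z ⟨g, hg⟩ hz h
    have h2 := homological_unique ha hs (χ := x) (z := z) ⟨g, g.2, by rw [← hL, hg]⟩ z.2
      (by rw [← hL, hz]; rfl) (by rw [← hB]; exact congrArg Subtype.val h)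
    exact ⟨Subtype.ext h2.1, Subtype.ext h2.2⟩) ⟨ψ, hψ⟩
  exact ⟨x, z, ⟨g, g.2, by rw [← hL, hg]⟩, z.2, by rw [← hL, hz]; rfl,
    by rw [← hB]; exact congrArg Subtype.val h⟩

end HomologicalEquation

/-! ### Normal forms: existence, symmetries, formula for the remainder -/

section NormalForm

variable {N : ℕ} [NeZero N] {a : ℝ}

/-- The right-hand side of the homological equation of order `t + 1`. -/
def rhs (a : ℝ) (χ Z : ℕ → Poly N) (t : ℕ) : Poly N :=
  (if t = 0 then toNormal a (H1 N) else 0)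
    - ∑ l ∈ Finset.range t, lieE χ (t - l) (Z (l + 1))
    - ∑ j ∈ Finset.range t, C (((j : ℝ) + 1) / (t + 1)) * pb (χ (j + 1)) (lieE χ (t - j) (Z 0))

/-- Only the last term of E_{t+1} Z₀ contains χ_{t+1}, and only the last summand is Z_{t+1}.
Everything else has lower order and moves to the right-hand side. -/
theorem order_iff (χ Z : ℕ → Poly N) (t : ℕ) :
    (∑ l ∈ Finset.range (t + 1 + 1), lieE χ (t + 1 - l) (Z l) =
      if t + 1 = 1 then toNormal a (H1 N) else 0) ↔
    pb (χ (t + 1)) (Z 0) + Z (t + 1) = rhs a χ Z t := by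
  have h1 : ∑ l ∈ Finset.range (t + 1 + 1), lieE χ (t + 1 - l) (Z l)
      = pb (χ (t + 1)) (Z 0)
        + ∑ j ∈ Finset.range t, C (((j : ℝ) + 1) / (t + 1)) * pb (χ (j + 1)) (lieE χ (t - j) (Z 0))
        + ∑ l ∈ Finset.range t, lieE χ (t - l) (Z (l + 1)) + Z (t + 1) := by
    rw [Finset.sum_range_succ', Finset.sum_range_succ, Nat.sub_zero, lieE_succ,
      Finset.sum_range_succ, Nat.sub_self, Nat.sub_self, lieE_zero, lieE_zero]
    have : ((t : ℝ) + 1) / (t + 1) = 1 := div_self (by positivity)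
    rw [this, C_1]
    have h2 : ∀ l, t + 1 - (l + 1) = t - l := fun l => by omega
    simp only [h2]
    ring
  have h3 : (t + 1 = 1) ↔ t = 0 := by omega
  rw [h1, rhs, if_congr h3 rfl rfl]
  constructor
  · intro h; rw [← h]; ring
  · intro h; linear_combination h

theorem rhs_congr {χ χ' Z Z' : ℕ → Poly N} {t : ℕ} (hχ : ∀ j, 1 ≤ j → j ≤ t → χ j = χ' j)
    (hZ : ∀ j, j ≤ t → Z j = Z' j) : rhs a χ Z t = rhs a χ' Z' t := by
  have h1 : ∑ l ∈ Finset.range t, lieE χ (t - l) (Z (l + 1))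
      = ∑ l ∈ Finset.range t, lieE χ' (t - l) (Z' (l + 1)) := by
    refine Finset.sum_congr rfl fun l hl => ?_
    have := Finset.mem_range.1 hl
    rw [hZ (l + 1) (by omega), lieE_congr fun j h1 h2 => hχ j h1 (by omega)]
  have h2 : ∑ j ∈ Finset.range t,
        C (((j : ℝ) + 1) / (t + 1)) * pb (χ (j + 1)) (lieE χ (t - j) (Z 0))
      = ∑ j ∈ Finset.range t,
        C (((j : ℝ) + 1) / (t + 1)) * pb (χ' (j + 1)) (lieE χ' (t - j) (Z' 0)) := by
    refine Finset.sum_congr rfl fun l hl => ?_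
    have := Finset.mem_range.1 hl
    rw [hZ 0 (by omega), hχ (l + 1) (by omega) (by omega),
      lieE_congr fun j h1 h2 => hχ j h1 (by omega)]
  rw [rhs, rhs, h1, h2]

theorem isHomogeneous_rhs {χ Z : ℕ → Poly N} {t : ℕ}
    (hχ : ∀ j, 1 ≤ j → j ≤ t → (χ j).IsHomogeneous (2 * j + 2))
    (hZ : ∀ j, j ≤ t → (Z j).IsHomogeneous (2 * j + 2)) :
    (rhs a χ Z t).IsHomogeneous (2 * t + 3 + 1) := by
  refine (IsHomogeneous.sub ?_ ?_).sub ?_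
  · split_ifs with h
    · rw [h]; exact isHomogeneous_toNormal_H1
    · exact isHomogeneous_zero _ _ _
  · refine IsHomogeneous.sum _ _ _ fun l hl => ?_
    have hl' := Finset.mem_range.1 hl
    have := isHomogeneous_lieE (s := t - l) (fun j h1 h2 => hχ j h1 (by omega)) (hZ (l + 1) (by omega))
    have e : 2 * (t - l + (l + 1)) + 2 = 2 * t + 3 + 1 := by omega
    rwa [e] at this
  · refine IsHomogeneous.sum _ _ _ fun j hj => IsHomogeneous.C_mul ?_ _
    have hj' := Finset.mem_range.1 hj
    have h1 := isHomogeneous_lieE (s := t - j) (fun j h1 h2 => hχ j h1 (by omega)) (hZ 0 (by omega))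
    have := isHomogeneous_pb (m := 2 * (j + 1) + 1) (hχ (j + 1) (by omega) (by omega))
      (n := 2 * (t - j + 0) + 1) h1
    have e : 2 * (j + 1) + 1 + (2 * (t - j + 0) + 1) = 2 * t + 3 + 1 := by omega
    rwa [e] at this

/-- A symmetry of the Hamiltonian and of the bracket, up to a sign absorbed in `φ'`. -/
structure BracketSymmetry (N : ℕ) [NeZero N] (a : ℝ) (φ : Poly N →ₐ[ℝ] Poly N)
    (φ' : Poly N → Poly N) : Prop where
  pb_eq : ∀ f g, φ (pb f g) = pb (φ' f) (φ g)
  range_eq : ∀ g, φ' (pb (HOmega N a) g) = pb (HOmega N a) (φ g)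
  zero_eq : φ' 0 = 0
  hom : ∀ f : Poly N, ∀ n, f.IsHomogeneous n → (φ f).IsHomogeneous n
  H0_eq : φ (toNormal a (H0 N a)) = toNormal a (H0 N a)
  H1_eq : φ (toNormal a (H1 N)) = toNormal a (H1 N)

namespace BracketSymmetry

variable {φ : Poly N →ₐ[ℝ] Poly N} {φ' : Poly N → Poly N}

theorem rhs_eq (S : BracketSymmetry N a φ φ') (χ Z : ℕ → Poly N) (t : ℕ) :
    φ (rhs a χ Z t) = rhs a (fun j => φ' (χ j)) (fun j => φ (Z j)) t := by
  have hC : ∀ c : ℝ, φ (C c) = C c := fun c => by rw [← algebraMap_eq, φ.commutes]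
  have h0 : φ (if t = 0 then toNormal a (H1 N) else 0) = if t = 0 then toNormal a (H1 N) else 0 := by
    split_ifs
    · exact S.H1_eq
    · exact map_zero φ
  simp only [rhs, map_sub, map_sum, map_mul, lieE_map φ φ' S.pb_eq, S.pb_eq, hC, h0]

/-- Solutions of the homological equation inherit the symmetries of the right-hand side. -/
theorem solution_invariant (S : BracketSymmetry N a φ φ') (ha : 0 < a) {n : ℕ}
    (hs : SmallCoupling N a (n + 1)) {χ z ψ : Poly N}
    (hχ : ∃ g : Poly N, g.IsHomogeneous (n + 1) ∧ χ = pb (HOmega N a) g)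
    (hz : z.IsHomogeneous (n + 1)) (hz' : pb (HOmega N a) z = 0)
    (h : pb χ (toNormal a (H0 N a)) + z = ψ) (hψ : φ ψ = ψ) : φ' χ = χ ∧ φ z = z := by
  obtain ⟨g, hg, hχg⟩ := hχ
  have h1 : pb (φ' χ) (toNormal a (H0 N a)) + φ z = ψ := by
    rw [← hψ, ← h, map_add, S.pb_eq, S.H0_eq]
  have h2 := homological_unique ha hs (χ := φ' χ - χ) (z := φ z - z)
    ⟨φ g - g, (S.hom g _ hg).sub hg, by rw [hχg, S.range_eq, pb_sub_right]⟩
    ((S.hom z _ hz).sub hz)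
    (by rw [pb_sub_right, hz', ← S.range_eq, hz', S.zero_eq, sub_zero])
    (by rw [pb_sub_left]; linear_combination h1 - h)
  exact ⟨sub_eq_zero.1 h2.1, sub_eq_zero.1 h2.2⟩

end BracketSymmetry

theorem shiftHom_quadForm {M : Matrix (ZMod N) (ZMod N) ℝ}
    (hM : ∀ i j, M (i + 1) (j + 1) = M i j) : shiftHom 1 (quadForm M) = quadForm M := by
  simp only [quadForm, map_mul, map_sum, map_add, shiftHom_C, shiftHom_X_inl, shiftHom_X_inr]
  refine congrArg (C (1 / 2) * ·) ?_
  refine Fintype.sum_equiv (Equiv.addRight 1) _ _ fun i => ?_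
  refine Fintype.sum_equiv (Equiv.addRight 1) _ _ fun j => ?_
  simp only [Equiv.coe_addRight, hM]

theorem shiftHom_HOmega : shiftHom 1 (HOmega N a) = HOmega N a := by
  rw [HOmega_eq]
  exact shiftHom_quadForm fun i j => by simp [Matrix.one_apply]

theorem reversal_quadForm (M : Matrix (ZMod N) (ZMod N) ℝ) :
    reversal (quadForm M) = quadForm M := by
  simp [quadForm]

theorem shiftHom_H1 : shiftHom 1 (H1 N) = H1 N := by
  simp only [H1, map_mul, map_sum, map_pow, shiftHom_C, shiftHom_X_inl]
  exact congrArg (C (1 / 4) * ·) (Fintype.sum_equiv (Equiv.addRight 1) _ _ fun j => rfl)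

theorem isHomogeneous_shiftHom (s : ZMod N) {f : Poly N} {n : ℕ} (hf : f.IsHomogeneous n) :
    (shiftHom s f).IsHomogeneous n := hf.rename_isHomogeneous

theorem isHomogeneous_reversal {f : Poly N} {n : ℕ} (hf : f.IsHomogeneous n) :
    (reversal f).IsHomogeneous n := by
  rw [reversal, ← one_mul n]
  refine IsHomogeneous.aeval hf _ fun v => ?_
  rcases v with l | l
  · exact isHomogeneous_X ℝ _
  · exact (isHomogeneous_X ℝ _).neg

theorem shift_symmetry (ha : 0 < a) (ha' : a < 1 / 4) :
    BracketSymmetry N a (shiftHom 1) (shiftHom 1) where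
  pb_eq := shiftHom_pb 1
  range_eq g := by rw [shiftHom_pb, shiftHom_HOmega]
  zero_eq := map_zero _
  hom _ _ hf := isHomogeneous_shiftHom 1 hf
  H0_eq := by rw [toNormal_H0 ha]; exact shiftHom_quadForm (powA_translate ha ha' _)
  H1_eq := by
    rw [toNormal, linSubst_eq, shiftHom_linSubstHom (powA_translate ha ha' _)
      (powA_translate ha ha' _), shiftHom_H1]

/-- Reversal of the momenta changes the sign of every bracket. Giving that sign to the generating
functions makes it a symmetry, under which invariant generating functions are odd. -/
theorem reversal_symmetry (ha : 0 < a) :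
    BracketSymmetry N a reversal (fun f => -reversal f) where
  pb_eq f g := by rw [pb_neg_left, pb_reversal, neg_neg]
  range_eq g := by
    rw [← pb_reversal, HOmega_eq, reversal_quadForm]
  zero_eq := by simp
  hom _ _ hf := isHomogeneous_reversal hf
  H0_eq := by rw [toNormal_H0 ha, reversal_quadForm]
  H1_eq := by
    rw [toNormal, linSubst_eq, reversal_linSubstHom]
    congr 1
    simp [H1]

theorem SmallCoupling.mono {m n : ℕ} (h : SmallCoupling N a n) (hmn : m ≤ n) :
    SmallCoupling N a m :=
  (mul_le_mul_of_nonneg_right (Nat.cast_le.2 hmn) (gt_nonneg _)).trans h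

namespace IsNormalForm

variable {r : ℕ} {χ Z : ℕ → Poly N}

theorem chi_homogeneous (h : IsNormalForm N a r χ Z) (s : ℕ) (h1 : 1 ≤ s) (h2 : s ≤ r) :
    (χ s).IsHomogeneous (2 * s + 2) := by
  obtain ⟨g, hg, hχ⟩ := h.chi_range s h1 h2
  rw [hχ]
  exact isHomogeneous_pb_quadratic' (n := 2 * s + 1) hg isHomogeneous_HOmega

theorem Z_homogeneous' (h : IsNormalForm N a r χ Z) (ha : 0 < a) (s : ℕ) (h2 : s ≤ r) :
    (Z s).IsHomogeneous (2 * s + 2) := by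
  rcases Nat.eq_zero_or_pos s with rfl | h1
  · rw [h.zero]; exact isHomogeneous_toNormal_H0 ha
  · exact h.Z_homogeneous s h1 h2

theorem pb_HOmega_Z (h : IsNormalForm N a r χ Z) (ha : 0 < a) (s : ℕ) (h2 : s ≤ r) :
    pb (HOmega N a) (Z s) = 0 := by
  rcases Nat.eq_zero_or_pos s with rfl | h1
  · rw [h.zero]; exact pb_HOmega_H0 ha
  · exact h.Z_kernel s h1 h2

theorem homological (h : IsNormalForm N a r χ Z) {t : ℕ} (ht : t < r) :
    pb (χ (t + 1)) (toNormal a (H0 N a)) + Z (t + 1) = rhs a χ Z t := by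
  rw [← h.zero]
  exact (order_iff χ Z t).1 (h.order (t + 1) (by omega) ht)

/-- Induction on the order through uniqueness of the homological equation. It holds for an arbitrary
normal form, which matters because the final bound is claimed for every one. -/
theorem invariant (h : IsNormalForm N a r χ Z) (ha : 0 < a) (hs : SmallCoupling N a (2 * r + 2))
    {φ : Poly N →ₐ[ℝ] Poly N} {φ' : Poly N → Poly N} (S : BracketSymmetry N a φ φ') (s : ℕ)
    (h2 : s ≤ r) : (1 ≤ s → φ' (χ s) = χ s) ∧ φ (Z s) = Z s := by
  induction s using Nat.strong_induction_on with
  | _ s ih =>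
    cases s with
    | zero => exact ⟨fun h => absurd h (by omega), by rw [h.zero]; exact S.H0_eq⟩
    | succ t =>
      have h3 := S.solution_invariant ha (n := 2 * (t + 1) + 1) (hs.mono (by omega))
        (h.chi_range (t + 1) (by omega) h2) (h.Z_homogeneous (t + 1) (by omega) h2)
        (h.Z_kernel (t + 1) (by omega) h2) (h.homological h2)
        (by
          rw [S.rhs_eq]
          exact rhs_congr (fun j h1 h4 => (ih j (by omega) (by omega)).1 h1)
            fun j h4 => (ih j (by omega) (by omega)).2)
      exact ⟨fun _ => h3.1, h3.2⟩

end IsNormalForm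

theorem exists_normalForm (ha : 0 < a) (ha' : a < 1 / 4) {r : ℕ}
    (hs : SmallCoupling N a (2 * r + 2)) : ∃ χ Z : ℕ → Poly N, IsNormalForm N a r χ Z := by
  induction r with
  | zero =>
    -- At order 0 all the conditions with 1 ≤ s ≤ 0 are vacuous.
    refine ⟨0, fun _ => toNormal a (H0 N a), rfl, ?_, ?_, ?_, ?_, ?_, ?_⟩ <;>
      intro s h1 h2 <;> omega
  | succ t ih =>
    obtain ⟨χ, Z, h⟩ := ih (hs.mono (by omega))
    have hom := isHomogeneous_rhs (a := a) (t := t) h.chi_homogeneous (h.Z_homogeneous' ha)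
    obtain ⟨x, z, hx, hz, hz', hxz⟩ := homological_exists ha (n := 2 * t + 3) (hs.mono (by omega)) hom
    have hinv := (shift_symmetry (N := N) ha ha').solution_invariant ha (n := 2 * t + 3)
      (hs.mono (by omega)) hx hz hz' hxz (by
        rw [(shift_symmetry ha ha').rhs_eq]
        refine rhs_congr (fun j h1 h2 => h.chi_cyclic j h1 h2) fun j h2 => ?_
        rcases Nat.eq_zero_or_pos j with rfl | h1
        · rw [h.zero]; exact (shift_symmetry ha ha').H0_eq
        · exact h.Z_cyclic j h1 h2)
    set χ' := Function.update χ (t + 1) x with hχ'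
    set Z' := Function.update Z (t + 1) z with hZ'
    have eχ : ∀ j, j ≤ t → χ' j = χ j := fun j hj => Function.update_of_ne (by omega) _ _
    have eZ : ∀ j, j ≤ t → Z' j = Z j := fun j hj => Function.update_of_ne (by omega) _ _
    have eχt : χ' (t + 1) = x := Function.update_self _ _ _
    have eZt : Z' (t + 1) = z := Function.update_self _ _ _
    refine ⟨χ', Z', ?_, ?_, ?_, ?_, ?_, ?_, ?_⟩
    · rw [eZ 0 (by omega)]; exact h.zero
    all_goals
      intro s h1 h2
      rcases Nat.lt_or_ge s (t + 1) with h3 | h3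
    · rw [eχ s (by omega)]; exact h.chi_cyclic s h1 (by omega)
    · obtain rfl : s = t + 1 := by omega
      rw [eχt]; exact hinv.1
    · rw [eχ s (by omega)]; exact h.chi_range s h1 (by omega)
    · obtain rfl : s = t + 1 := by omega
      rw [eχt]; exact hx
    · rw [eZ s (by omega)]; exact h.Z_cyclic s h1 (by omega)
    · obtain rfl : s = t + 1 := by omega
      rw [eZt]; exact hinv.2
    · rw [eZ s (by omega)]; exact h.Z_homogeneous s h1 (by omega)
    · obtain rfl : s = t + 1 := by omega
      rw [eZt]; exact hz
    · rw [eZ s (by omega)]; exact h.Z_kernel s h1 (by omega)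
    · obtain rfl : s = t + 1 := by omega
      rw [eZt]; exact hz'
    · rw [← h.order s h1 (by omega)]
      refine Finset.sum_congr rfl fun l hl => ?_
      have := Finset.mem_range.1 hl
      rw [eZ l (by omega), lieE_congr fun j _ h5 => eχ j (by omega)]
    · obtain rfl : s = t + 1 := by omega
      rw [order_iff, eχt, eZt, eZ 0 (by omega), h.zero, hxz]
      exact rhs_congr (fun j _ h5 => (eχ j h5).symm) fun j h5 => (eZ j h5).symm

/-- The orders of the identity `{T_χ H_Ω, T_χ Z} = T_χ {H_Ω, Z} = 0`. -/
theorem IsNormalForm.pb_lieE_order {r : ℕ} {χ Z : ℕ → Poly N} (h : IsNormalForm N a r χ Z)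
    (ha : 0 < a) {s : ℕ} (hs : s < r) :
    pb (lieE χ (s + 1) (HOmega N a)) (toNormal a (H0 N a))
      + pb (lieE χ s (HOmega N a)) (toNormal a (H1 N)) = 0 := by
  -- T_χ Z agrees with H up to order r, so it has only the orders 0 and 1 there, and only two terms
  -- of the convolution survive.
  have hT : ∀ m, m ≤ r → ∑ q ∈ Finset.HasAntidiagonal.antidiagonal m, lieE χ q.1 (Z q.2)
      = if m = 0 then toNormal a (H0 N a) else if m = 1 then toNormal a (H1 N) else 0 := by
    intro m hm
    rcases Nat.eq_zero_or_pos m with rfl | h1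
    · simp [lieE_zero, h.zero]
    · rw [if_neg (by omega), ← h.order m h1 hm, ← Finset.Nat.sum_antidiagonal_swap,
        Finset.Nat.sum_antidiagonal_eq_sum_range_succ_mk]
      rfl
  have h1 : ∑ p ∈ Finset.HasAntidiagonal.antidiagonal (s + 1),
      pb (lieE χ p.1 (HOmega N a)) (∑ q ∈ Finset.HasAntidiagonal.antidiagonal p.2,
        lieE χ q.1 (Z q.2)) = 0 := by
    simp only [pb_sum_right]
    rw [← sum_antidiagonal_assoc (s + 1) fun u k l => pb (lieE χ u (HOmega N a)) (lieE χ k (Z l))]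
    refine Finset.sum_eq_zero fun p hp => ?_
    have := Finset.HasAntidiagonal.mem_antidiagonal.1 hp
    rw [← lieE_pb, h.pb_HOmega_Z ha _ (by omega), lieE_arg_zero]
  rw [Finset.Nat.sum_antidiagonal_eq_sum_range_succ_mk, Finset.sum_range_succ,
    Finset.sum_range_succ, Finset.sum_eq_zero, zero_add] at h1
  · rw [add_comm, ← h1]
    have e1 : s + 1 - s = 1 := by omega
    rw [e1, Nat.sub_self, hT 0 (by omega), hT 1 (by omega), if_pos rfl, if_neg one_ne_zero,
      if_pos rfl]
  · intro j hj
    have := Finset.mem_range.1 hj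
    rw [hT _ (by omega), if_neg (by omega), if_neg (by omega), pb_zero_right]

theorem toOriginal_toNormal (ha : 0 < a) (f : Poly N) : toOriginal a (toNormal a f) = f := by
  rw [toOriginal, toNormal, linSubst_eq, linSubst_eq, linSubstHom_comp, powA_mul ha, powA_mul ha,
    neg_add_cancel, add_neg_cancel, powA_zero, linSubstHom_one]

/-- The remainder is the bracket of the last term of `Φ` with `H₁`. -/
theorem IsNormalForm.remainder_eq {r : ℕ} {χ Z : ℕ → Poly N} (h : IsNormalForm N a r χ Z)
    (ha : 0 < a) :
    remainder N a r χ = toOriginal a (pb (lieE χ r (HOmega N a)) (toNormal a (H1 N))) := by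
  -- Telescoping: the bracket of E_{s+1} H_Ω with H₀ cancels the term left over at order s.
  have key : ∀ s, s ≤ r → pb (∑ k ∈ Finset.range (s + 1), lieE χ k (HOmega N a))
      (toNormal a (H0 N a) + toNormal a (H1 N)) = pb (lieE χ s (HOmega N a)) (toNormal a (H1 N)) := by
    intro s
    induction s with
    | zero =>
      intro _
      simp [lieE_zero, pb_add_right, pb_HOmega_H0 ha]
    | succ s ih =>
      intro hs
      have := h.pb_lieE_order ha (s := s) (by omega)
      rw [Finset.sum_range_succ, pb_add_left, ih (by omega), pb_add_right]
      linear_combination this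
  have hH : hamiltonian N a = toOriginal a (toNormal a (H0 N a) + toNormal a (H1 N)) := by
    have : toNormal a (H0 N a) + toNormal a (H1 N) = toNormal a (hamiltonian N a) := by
      simp only [toNormal, linSubst_eq, hamiltonian, map_add]
    rw [this, toOriginal_toNormal ha]
  rw [remainder, Phi, poisson_eq_pb, hH, toOriginal, toOriginal, linSubst_eq, linSubst_eq,
    pb_linSubstHom, key r le_rfl]
  · rfl
  · rw [powA_transpose, powA_mul ha, add_neg_cancel, powA_zero]

/-- The generating functions are odd, so E_r H_Ω is even, and its bracket with the even H₁ is odd.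
Consequently every monomial of R contains a momentum to an odd power. -/
theorem IsNormalForm.reversal_remainder {r : ℕ} {χ Z : ℕ → Poly N} (h : IsNormalForm N a r χ Z)
    (ha : 0 < a) (hs : SmallCoupling N a (2 * r + 2)) :
    reversal (remainder N a r χ) = -remainder N a r χ := by
  have S := reversal_symmetry (N := N) ha
  have h1 : reversal (lieE χ r (HOmega N a)) = lieE χ r (HOmega N a) := by
    rw [lieE_map reversal (fun f => -reversal f) S.pb_eq, HOmega_eq, reversal_quadForm]
    exact lieE_congr (fun j h1 h2 => (h.invariant ha hs S j h2).1 h1) _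
  rw [h.remainder_eq ha, toOriginal, linSubst_eq, reversal_linSubstHom, S.pb_eq, h1, S.H1_eq,
    pb_neg_left, map_neg]

theorem IsNormalForm.isHomogeneous_remainder {r : ℕ} {χ Z : ℕ → Poly N}
    (h : IsNormalForm N a r χ Z) (ha : 0 < a) :
    (remainder N a r χ).IsHomogeneous (2 * r + 4) := by
  rw [h.remainder_eq ha]
  have h1 := isHomogeneous_lieE (s := r) (l := 0) h.chi_homogeneous (isHomogeneous_HOmega (a := a))
  exact isHomogeneous_linSubstHom
    (isHomogeneous_pb (m := 2 * r + 1) (n := 3) h1 isHomogeneous_toNormal_H1)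

end NormalForm

/-! ### Growth of the majorant sequence -/

section Majorant

theorem sum_convolution_le {f g : ℕ → ℝ} (hf : ∀ i, 0 ≤ f i) (hg : ∀ i, 0 ≤ g i) (m : ℕ) :
    ∑ s ∈ Finset.range m, ∑ j ∈ Finset.range (s + 1), f j * g (s - j)
      ≤ (∑ j ∈ Finset.range m, f j) * ∑ j ∈ Finset.range m, g j := by
  rw [Finset.sum_range_diag_flip m fun j k => f j * g k, Finset.sum_mul_sum]
  refine Finset.sum_le_sum fun j _ => Finset.sum_le_sum_of_subset_of_nonneg ?_
    fun k _ _ => mul_nonneg (hf j) (hg k)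
  exact Finset.range_subset_range.2 (Nat.sub_le m j)

/-- The coefficients of the majorant series `1 / (1 - ∑ X_j t^{j+1})`. -/
def majorant (X : ℕ → ℝ) : ℕ → ℝ
  | 0 => 1
  | s + 1 => ∑ j : Fin (s + 1), X j * majorant X (s - j)
  termination_by s => s
  decreasing_by omega

theorem majorant_zero (X : ℕ → ℝ) : majorant X 0 = 1 := by rw [majorant]

theorem majorant_succ (X : ℕ → ℝ) (s : ℕ) :
    majorant X (s + 1) = ∑ j ∈ Finset.range (s + 1), X j * majorant X (s - j) := by
  rw [majorant, ← Fin.sum_univ_eq_sum_range (fun j : ℕ => X j * majorant X (s - j))]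

theorem majorant_nonneg {X : ℕ → ℝ} (hX : ∀ j, 0 ≤ X j) (s : ℕ) : 0 ≤ majorant X s := by
  induction s using Nat.strong_induction_on with
  | _ s ih =>
    cases s with
    | zero => rw [majorant_zero]; exact zero_le_one
    | succ s =>
      rw [majorant_succ]
      exact Finset.sum_nonneg fun j hj => mul_nonneg (hX j) (ih _ (by omega))

/-- Here P bounds the right-hand sides and X the generating functions, weighted by the degree n.
After rescaling order s by τ^s, the partial sums of both sequences stay bounded by a simultaneous
induction. The constant 48 is what closes it. Applied with n = 2r + 2, this gives growth r^{2r} up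
to a geometric factor. -/
theorem majorant_mul_pow_le {r : ℕ} {n h h₁ : ℝ} (hn : 1 ≤ n) (hh : 1 ≤ h) (hh₁ : 1 ≤ h₁)
    {P X : ℕ → ℝ} (hP0 : ∀ t, 0 ≤ P t) (hX0 : ∀ t, 0 ≤ X t)
    (hX : ∀ t, t < r → X t ≤ 2 * n * P t)
    (hP : ∀ t, t < r → P t ≤ (if t = 0 then h₁ else 0)
      + 3 * n * h * ∑ l ∈ Finset.range t, P l * majorant X (t - l)) :
    majorant X r ≤ (48 * n ^ 2 * h * h₁) ^ r := by
  have hn0 : 0 < n := by linarith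
  have hh0 : 0 < h := by linarith
  have hh10 : 0 < h₁ := by linarith
  set τ : ℝ := (48 * n ^ 2 * h * h₁)⁻¹ with hτ
  have hτ0 : 0 < τ := by positivity
  set p : ℕ → ℝ := fun t => P t * τ ^ (t + 1) with hp
  set ε : ℕ → ℝ := fun s => majorant X s * τ ^ s with hε
  have hp0 : ∀ t, 0 ≤ p t := fun t => mul_nonneg (hP0 t) (by positivity)
  have hε0 : ∀ t, 0 ≤ ε t := fun t => mul_nonneg (majorant_nonneg hX0 t) (by positivity)
  have hε1 : ∀ s, s < r → ε (s + 1) ≤ 2 * n * ∑ j ∈ Finset.range (s + 1), p j * ε (s - j) := by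
    intro s hs
    simp only [hε, hp, majorant_succ, Finset.mul_sum, Finset.sum_mul]
    refine Finset.sum_le_sum fun j hj => ?_
    have hj' := Finset.mem_range.1 hj
    have e : τ ^ (s + 1) = τ ^ (j + 1) * τ ^ (s - j) := by rw [← pow_add]; congr 1; omega
    rw [e]
    calc X j * majorant X (s - j) * (τ ^ (j + 1) * τ ^ (s - j))
        = X j * (majorant X (s - j) * (τ ^ (j + 1) * τ ^ (s - j))) := by ring
      _ ≤ 2 * n * P j * (majorant X (s - j) * (τ ^ (j + 1) * τ ^ (s - j))) :=
          mul_le_mul_of_nonneg_right (hX j (by omega))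
            (mul_nonneg (majorant_nonneg hX0 _) (by positivity))
      _ = _ := by ring
  have hp1 : ∀ t, t + 1 < r →
      p (t + 1) ≤ 3 * n * h * ∑ l ∈ Finset.range (t + 1), p l * ε (t - l + 1) := by
    intro t ht
    have h1 := mul_le_mul_of_nonneg_right (hP (t + 1) ht) (pow_pos hτ0 (t + 1 + 1)).le
    refine h1.trans_eq ?_
    rw [if_neg (Nat.succ_ne_zero t), zero_add, mul_assoc, Finset.sum_mul]
    refine congrArg _ (Finset.sum_congr rfl fun l hl => ?_)
    have hl' := Finset.mem_range.1 hl
    have e : τ ^ (t + 1 + 1) = τ ^ (l + 1) * τ ^ (t - l + 1) := by rw [← pow_add]; congr 1; omega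
    have e2 : t + 1 - l = t - l + 1 := by omega
    simp only [hp, hε]
    rw [e, e2]; ring
  have hp00 : 0 < r → p 0 ≤ h₁ * τ := fun h0 => by
    have := mul_le_mul_of_nonneg_right (hP 0 h0) hτ0.le
    simpa [hp] using this
  -- The radius τ is chosen for this identity. With δ = 2h₁τ, the first term of P uses half of δ and
  -- the convolution the other half.
  have hδ : 24 * n ^ 2 * h * (2 * (h₁ * τ)) = 1 := by
    rw [hτ]; field_simp; norm_num
  have key : ∀ m, m ≤ r → ∑ t ∈ Finset.range m, p t ≤ 2 * (h₁ * τ) ∧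
      ∑ s ∈ Finset.range m, ε (s + 1) ≤ 4 * n * (2 * (h₁ * τ)) := by
    set δ := 2 * (h₁ * τ) with hδdef
    have hδ0 : 0 < δ := by positivity
    have hnδ : 24 * n * δ ≤ 1 := by
      rw [← hδ]
      have : 1 ≤ n * h := one_le_mul_of_one_le_of_one_le hn hh
      nlinarith [mul_pos (show 0 < n by linarith) hδ0]
    have hS : ∀ m, m ≤ r → ∑ t ∈ Finset.range m, p t ≤ δ →
        ∑ s ∈ Finset.range m, ε (s + 1) ≤ 4 * n * δ := by
      intro m hm hΨ
      have h1 : ∑ s ∈ Finset.range m, ε (s + 1)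
          ≤ 2 * n * ((∑ t ∈ Finset.range m, p t) * ∑ s ∈ Finset.range m, ε s) := by
        refine le_trans ?_ (mul_le_mul_of_nonneg_left (sum_convolution_le hp0 hε0 m) (by linarith))
        rw [Finset.mul_sum]
        exact Finset.sum_le_sum fun s hs => hε1 s (by have := Finset.mem_range.1 hs; omega)
      have h2 : ∑ s ∈ Finset.range m, ε s ≤ 1 + ∑ s ∈ Finset.range m, ε (s + 1) := by
        have h3 : ∑ s ∈ Finset.range m, ε s ≤ ∑ s ∈ Finset.range (m + 1), ε s :=
          Finset.sum_le_sum_of_subset_of_nonneg (Finset.range_subset_range.2 (Nat.le_succ m))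
            fun k _ _ => hε0 k
        rw [Finset.sum_range_succ'] at h3
        have : ε 0 = 1 := by simp [hε, majorant_zero]
        linarith
      have h3 : 0 ≤ ∑ s ∈ Finset.range m, ε (s + 1) := Finset.sum_nonneg fun s _ => hε0 _
      have h4 : (∑ t ∈ Finset.range m, p t) * ∑ s ∈ Finset.range m, ε s
          ≤ δ * (1 + ∑ s ∈ Finset.range m, ε (s + 1)) :=
        mul_le_mul hΨ h2 (Finset.sum_nonneg fun s _ => hε0 _) hδ0.le
      have h5 := h1.trans (mul_le_mul_of_nonneg_left h4 (show 0 ≤ 2 * n by linarith))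
      -- The inequality S ≤ 2nδ (1 + S) is solved for S, using 24nδ ≤ 1.
      nlinarith
    intro m
    induction m with
    | zero => exact fun _ => ⟨by simpa using hδ0.le, by simp; positivity⟩
    | succ m ih =>
      intro hm
      obtain ⟨hΨ, hSm⟩ := ih (by omega)
      have hΨ' : ∑ t ∈ Finset.range (m + 1), p t ≤ δ := by
        rw [Finset.sum_range_succ']
        have h1 : ∑ t ∈ Finset.range m, p (t + 1)
            ≤ 3 * n * h * ((∑ t ∈ Finset.range m, p t) * ∑ s ∈ Finset.range m, ε (s + 1)) := by
          refine le_trans ?_ (mul_le_mul_of_nonneg_left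
            (sum_convolution_le (g := fun s => ε (s + 1)) hp0 (fun s => hε0 (s + 1)) m)
            (by positivity))
          rw [Finset.mul_sum]
          exact Finset.sum_le_sum fun s hs => hp1 s (by have := Finset.mem_range.1 hs; omega)
        have h2 : (∑ t ∈ Finset.range m, p t) * ∑ s ∈ Finset.range m, ε (s + 1)
            ≤ δ * (4 * n * δ) :=
          mul_le_mul hΨ hSm (Finset.sum_nonneg fun s _ => hε0 _) hδ0.le
        have h3 := h1.trans (mul_le_mul_of_nonneg_left h2 (show 0 ≤ 3 * n * h by positivity))
        have h4 : 3 * n * h * (δ * (4 * n * δ)) = δ / 2 * (24 * n ^ 2 * h * δ) := by ring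
        rw [h4, hδ, mul_one] at h3
        have h5 := hp00 (by omega)
        have h6 : h₁ * τ = δ / 2 := by rw [hδdef]; ring
        linarith
      exact ⟨hΨ', hS (m + 1) hm hΨ'⟩
  have hτr : majorant X r * τ ^ r ≤ 1 := by
    rcases Nat.eq_zero_or_pos r with rfl | hr
    · simp [majorant_zero]
    · obtain ⟨_, h2⟩ := key r le_rfl
      obtain ⟨s, rfl⟩ := Nat.exists_eq_succ_of_ne_zero hr.ne'
      have h3 : ε (s + 1) ≤ ∑ s ∈ Finset.range (s + 1), ε (s + 1) :=
        Finset.single_le_sum (f := fun s => ε (s + 1)) (fun i _ => hε0 _)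
          (Finset.mem_range.2 (Nat.lt_succ_self s))
      refine (h3.trans h2).trans ?_
      rw [← hδ]
      have : 1 ≤ n * h := one_le_mul_of_one_le_of_one_le hn hh
      have : 0 < n * (2 * (h₁ * τ)) := by positivity
      nlinarith
  rw [hτ, inv_pow] at hτr
  rwa [← div_eq_mul_inv, div_le_one (by positivity)] at hτr

end Majorant

/-! ### Norm of the remainder, uniformly in the number of sites -/

section Growth

variable {N : ℕ} [NeZero N] {a : ℝ}

theorem gn_quadForm_le {M : Matrix (ZMod N) (ZMod N) ℝ} (hM : ∀ i j, M i j = M j i) {c : ℝ}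
    (hc : ∀ i, ∑ j, |M i j| ≤ c) : gn (quadForm M) ≤ c := by
  refine gn_le fun v => ?_
  rcases v with l | l
  · rw [pderiv_inl_quadForm hM]
    refine ((l1_sum_le _ _).trans_eq ?_).trans (hc l)
    simp [l1_C_mul]
  · rw [pderiv_inr_quadForm hM]
    refine ((l1_sum_le _ _).trans_eq ?_).trans (hc l)
    simp [l1_C_mul]

/-- Each real variable has image of norm at most 3/2, and each complex variable occurs in the images
of its site with total weight at most 2. -/
theorem gt_le_gn {f : Poly N} {n : ℕ} (hf : f.IsHomogeneous n) :
    gt f ≤ 2 * (3 / 2) ^ (n - 1) * gn f := by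
  have h1 : ‖Complex.I / 2‖ = 1 / 2 := by simp
  have h2 : ‖(1 / 2 : ℂ)‖ = 1 / 2 := by simp
  refine gn_algHom_le theta ?_ ?_ hf
  · rintro (l | l)
    · rw [theta_X_inl]
      refine (l1_add_le _ _).trans_eq ?_
      rw [l1_C_mul, l1_X, l1_X, h1]; norm_num
    · rw [theta_X_inr]
      refine (l1_add_le _ _).trans_eq ?_
      rw [l1_C_mul, l1_C_mul, l1_X, l1_X, h2, Complex.norm_I]; norm_num
  · intro w
    rw [Fintype.sum_sum_type]
    simp only [theta_X_inl, theta_X_inr, map_add, pderiv_C_mul]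
    have e : ∀ u v : Var N, l1 (pderiv u (X v : MvPolynomial (Var N) ℂ)) = if v = u then 1 else 0 := by
      classical
      intro u v
      rw [pderiv_X, Pi.single_apply]
      split_ifs with h
      · rw [← C_1, l1_C, norm_one]
      · exact l1_zero
    have h3 : ∑ l : ZMod N, l1 (pderiv w (X (Sum.inl l)) + C (Complex.I / 2) *
        pderiv w (X (Sum.inr l)) : MvPolynomial (Var N) ℂ) ≤
        ∑ l : ZMod N, ((if (Sum.inl l : Var N) = w then (1 : ℝ) else 0)
          + 1 / 2 * if (Sum.inr l : Var N) = w then (1 : ℝ) else 0) :=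
      Finset.sum_le_sum fun l _ => (l1_add_le _ _).trans_eq (by rw [l1_C_mul, e, e, h1])
    have h4 : ∑ l : ZMod N, l1 (C Complex.I * pderiv w (X (Sum.inl l)) + C (1 / 2) *
        pderiv w (X (Sum.inr l)) : MvPolynomial (Var N) ℂ) ≤
        ∑ l : ZMod N, (1 * (if (Sum.inl l : Var N) = w then (1 : ℝ) else 0)
          + 1 / 2 * if (Sum.inr l : Var N) = w then (1 : ℝ) else 0) :=
      Finset.sum_le_sum fun l _ => (l1_add_le _ _).trans_eq (by
        rw [l1_C_mul, l1_C_mul, e, e, h2, Complex.norm_I])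
    refine (add_le_add h3 h4).trans ?_
    rcases w with k | k <;> simp <;> norm_num

theorem gn_H1_le : gn (H1 N) ≤ 1 := by
  have e : ∀ v : Var N, ∀ j : ZMod N, pderiv v (X (Sum.inl j) ^ 4 : Poly N)
      = if Sum.inl j = v then C 4 * X (Sum.inl j) ^ 3 else 0 := by
    classical
    intro v j
    rw [pderiv_pow, pderiv_X, Pi.single_apply, map_ofNat C 4]
    split_ifs <;> simp
  refine gn_le fun v => ?_
  rw [H1, pderiv_C_mul, map_sum, l1_C_mul]
  simp only [e]
  rcases v with l | l
  · simp only [Sum.inl.injEq, Finset.sum_ite_eq', Finset.mem_univ, if_true, l1_C_mul]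
    have := l1_pow_le (X (Sum.inl l) : Poly N) 3
    rw [l1_X] at this
    norm_num
    linarith
  · simp

section LinSubst

variable {M M' : Matrix (ZMod N) (ZMod N) ℝ} {c : ℝ}

theorem l1_linSubstHom_X_le (hc : ∀ i, ∑ j, |M i j| ≤ c) (hc' : ∀ i, ∑ j, |M' i j| ≤ c)
    (v : Var N) : l1 (linSubstHom M M' (X v)) ≤ c := by
  rcases v with l | l
  · rw [linSubstHom_X_inl]
    refine ((l1_sum_le _ _).trans_eq ?_).trans (hc l)
    simp [l1_C_mul]
  · rw [linSubstHom_X_inr]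
    refine ((l1_sum_le _ _).trans_eq ?_).trans (hc' l)
    simp [l1_C_mul]

theorem sum_l1_pderiv_linSubstHom_X_le (hM : ∀ i j, M i j = M j i) (hM' : ∀ i j, M' i j = M' j i)
    (hc : ∀ i, ∑ j, |M i j| ≤ c) (hc' : ∀ i, ∑ j, |M' i j| ≤ c) (w : Var N) :
    ∑ v, l1 (pderiv w (linSubstHom M M' (X v))) ≤ c := by
  classical
  have e : ∀ u v : Var N, ∀ x : ℝ,
      pderiv u (C x * X v : Poly N) = if v = u then C x else 0 := by
    intro u v x
    rw [pderiv_C_mul, pderiv_X, Pi.single_apply, mul_ite, mul_one, mul_zero]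
  rw [Fintype.sum_sum_type]
  simp only [linSubstHom_X_inl, linSubstHom_X_inr, map_sum, e]
  rcases w with k | k
  · refine le_trans (le_of_eq ?_) (hc k)
    simp [hM k]
  · refine le_trans (le_of_eq ?_) (hc' k)
    simp [hM' k]

end LinSubst

theorem l1_map_ofReal (f : Poly N) : l1 (MvPolynomial.map Complex.ofRealHom f) = l1 f := by
  rw [l1, support_map_of_injective _ Complex.ofRealHom.injective, l1]
  exact Finset.sum_congr rfl fun d _ => by rw [coeff_map]; exact Complex.norm_real _

theorem gn_map_ofReal (f : Poly N) : gn (MvPolynomial.map Complex.ofRealHom f) = gn f := by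
  simp only [gn, pderiv_map, l1_map_ofReal]

/-- Return from the complex coordinates. -/
theorem gn_algHom_le_gt (φ : Poly N →ₐ[ℝ] Poly N) {c c' : ℝ} (hc : ∀ v, l1 (φ (X v)) ≤ c)
    (hc' : ∀ w, ∑ v, l1 (pderiv w (φ (X v))) ≤ c') {f : Poly N} {n : ℕ} (hf : f.IsHomogeneous n) :
    gn (φ f) ≤ 3 / 2 * c' * (2 * c) ^ (n - 1) * gt f := by
  have h1 : ‖Complex.I / 2‖ = 1 / 2 := by simp
  have h2 : ‖(1 / 2 : ℂ)‖ = 1 / 2 := by simp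
  have hc0 : 0 ≤ c := (l1_nonneg _).trans (hc (Classical.arbitrary _))
  rw [← gn_map_ofReal, ← backHom_theta]
  have e1 : ∀ l : ZMod N, backHom φ (X (Sum.inl l))
      = C (1 / 2) * MvPolynomial.map Complex.ofRealHom (φ (X (Sum.inl l)))
        - C (Complex.I / 2) * MvPolynomial.map Complex.ofRealHom (φ (X (Sum.inr l))) := fun l => by
    simp [backHom]
  have e2 : ∀ l : ZMod N, backHom φ (X (Sum.inr l))
      = MvPolynomial.map Complex.ofRealHom (φ (X (Sum.inr l)))
        - C Complex.I * MvPolynomial.map Complex.ofRealHom (φ (X (Sum.inl l))) := fun l => by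
    simp [backHom]
  refine gn_algHom_le (backHom φ) ?_ ?_ (isHomogeneous_theta hf)
  · rintro (l | l)
    · rw [e1]
      refine (l1_sub_le _ _).trans ?_
      rw [l1_C_mul, l1_C_mul, h1, h2, l1_map_ofReal, l1_map_ofReal]
      linarith [hc (Sum.inl l), hc (Sum.inr l)]
    · rw [e2]
      refine (l1_sub_le _ _).trans ?_
      rw [l1_C_mul, Complex.norm_I, l1_map_ofReal, l1_map_ofReal]
      linarith [hc (Sum.inl l), hc (Sum.inr l)]
  · intro w
    have h3 := hc' w
    rw [Fintype.sum_sum_type] at h3 ⊢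
    simp only [e1, e2, map_sub, pderiv_C_mul, pderiv_map]
    have h4 : ∑ l : ZMod N, l1 (C (1 / 2) * MvPolynomial.map Complex.ofRealHom
          (pderiv w (φ (X (Sum.inl l)))) - C (Complex.I / 2) * MvPolynomial.map Complex.ofRealHom
          (pderiv w (φ (X (Sum.inr l)))))
        ≤ ∑ l : ZMod N, (1 / 2 * l1 (pderiv w (φ (X (Sum.inl l))))
          + 1 / 2 * l1 (pderiv w (φ (X (Sum.inr l))))) :=
      Finset.sum_le_sum fun l _ => (l1_sub_le _ _).trans_eq (by
        rw [l1_C_mul, l1_C_mul, h1, h2, l1_map_ofReal, l1_map_ofReal])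
    have h5 : ∑ l : ZMod N, l1 (MvPolynomial.map Complex.ofRealHom
          (pderiv w (φ (X (Sum.inr l)))) - C Complex.I * MvPolynomial.map Complex.ofRealHom
          (pderiv w (φ (X (Sum.inl l)))))
        ≤ ∑ l : ZMod N, (l1 (pderiv w (φ (X (Sum.inr l))))
          + l1 (pderiv w (φ (X (Sum.inl l))))) :=
      Finset.sum_le_sum fun l _ => (l1_sub_le _ _).trans_eq (by
        rw [l1_C_mul, Complex.norm_I, one_mul, l1_map_ofReal, l1_map_ofReal])
    rw [Finset.sum_add_distrib, ← Finset.mul_sum, ← Finset.mul_sum] at h4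
    rw [Finset.sum_add_distrib] at h5
    linarith

theorem gt_Z0_le (ha : 0 < a) (ha' : a < 1 / 4) : gt (Z0 N a) ≤ 96 * mu a := by
  have h1 := gt_le_gn (isHomogeneous_Z0 (N := N) ha)
  have h2 : gn (Z0 N a) ≤ 32 * mu a := by
    rw [Z0_eq ha]; exact gn_quadForm_le couplingMatrix_symm (sum_abs_couplingMatrix_le ha ha')
  norm_num at h1
  linarith

theorem gt_toNormal_H0_le (ha : 0 < a) (ha' : a < 1 / 4) : gt (toNormal a (H0 N a)) ≤ 48 := by
  have h1 := gt_le_gn (isHomogeneous_toNormal_H0 (N := N) ha)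
  have h2 : gn (toNormal a (H0 N a)) ≤ 16 := by
    rw [toNormal_H0 ha]
    exact gn_quadForm_le (powA_symm _) (sum_abs_powA_le ha ha' (by norm_num [abs_le]))
  norm_num at h1
  linarith

theorem gt_HOmega_le (ha : 0 < a) (ha' : a < 1 / 4) : gt (HOmega N a) ≤ 6 := by
  have h1 := gt_le_gn (isHomogeneous_HOmega (N := N) (a := a))
  have hΩ := Omega_bounds (N := N) ha
  have h3 : √(1 + 4 * a) ≤ 2 := by rw [Real.sqrt_le_left (by norm_num)]; linarith
  have h2 : gn (HOmega N a) ≤ 2 := by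
    rw [HOmega_eq]
    refine gn_quadForm_le (fun i j => by simp [Matrix.one_apply, eq_comm]) fun i => ?_
    simp only [Matrix.smul_apply, Matrix.one_apply, smul_eq_mul, mul_ite, mul_one, mul_zero,
      apply_ite (fun t : ℝ => |t|), abs_zero, Finset.sum_ite_eq, Finset.mem_univ, if_true]
    rw [abs_of_nonneg (by linarith)]; linarith
  norm_num at h1
  linarith

theorem gt_toNormal_H1_le (ha : 0 < a) (ha' : a < 1 / 4) : gt (toNormal a (H1 N)) ≤ 442368 := by
  have h1 := gt_le_gn (isHomogeneous_toNormal_H1 (N := N) (a := a))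
  have h2 : gn (toNormal a (H1 N)) ≤ 16 * 16 ^ (4 - 1) * gn (H1 N) := by
    have r1 := sum_abs_powA_le (N := N) ha ha' (p := -(1 / 4)) (by norm_num [abs_le])
    have r2 := sum_abs_powA_le (N := N) ha ha' (p := 1 / 4) (by norm_num [abs_le])
    exact gn_algHom_le (linSubstHom (powA N a (-(1 / 4))) (powA N a (1 / 4)))
      (l1_linSubstHom_X_le r1 r2)
      (sum_l1_pderiv_linSubstHom_X_le (powA_symm _) (powA_symm _) r1 r2) isHomogeneous_H1
  have h3 := gn_H1_le (N := N)
  norm_num at h1 h2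
  linarith

theorem gn_toOriginal_le (ha : 0 < a) (ha' : a < 1 / 4) {f : Poly N} {n : ℕ}
    (hf : f.IsHomogeneous n) : gn (toOriginal a f) ≤ 24 * 32 ^ (n - 1) * gt f := by
  have r1 := sum_abs_powA_le (N := N) ha ha' (p := -(1 / 4)) (by norm_num [abs_le])
  have r2 := sum_abs_powA_le (N := N) ha ha' (p := 1 / 4) (by norm_num [abs_le])
  have h := gn_algHom_le_gt (linSubstHom (powA N a (1 / 4)) (powA N a (-(1 / 4))))
    (l1_linSubstHom_X_le r2 r1)
    (sum_l1_pderiv_linSubstHom_X_le (powA_symm _) (powA_symm _) r2 r1) hf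
  norm_num at h
  exact h

theorem smallCoupling_of_le (ha : 0 < a) (ha' : a < 1 / 4) {n : ℕ}
    (h : n * (96 * mu a) ≤ 1 / 2) : SmallCoupling N a n :=
  (mul_le_mul_of_nonneg_left (gt_Z0_le ha ha') (Nat.cast_nonneg n)).trans
    (h.trans (by linarith [(Omega_bounds (N := N) ha).1]))

/-- As long as the order stays within r, the bracket estimate costs at most the factor 2r + 2, and
the weights j/s are at most 1. The recursion of E_s is then dominated by that of the majorant. -/
theorem gt_lieE_le {χ : ℕ → Poly N} {X : ℕ → ℝ} {r : ℕ}
    (hχ : ∀ j, 1 ≤ j → j ≤ r → (χ j).IsHomogeneous (2 * j + 2))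
    (hX : ∀ j, (2 * r + 2) * gt (χ (j + 1)) ≤ X j) {f : Poly N} {l : ℕ}
    (hf : f.IsHomogeneous (2 * l + 2)) {s : ℕ} (hs : s + l ≤ r) :
    gt (lieE χ s f) ≤ majorant X s * gt f := by
  have hX0 : ∀ j, 0 ≤ X j := fun j =>
    (mul_nonneg (by positivity) (gt_nonneg _)).trans (hX j)
  induction s using Nat.strong_induction_on with
  | _ s ih =>
    cases s with
    | zero => rw [lieE_zero, majorant_zero, one_mul]
    | succ s =>
      rw [lieE_succ, majorant_succ, Finset.sum_mul]
      refine (gt_sum_le _ _).trans (Finset.sum_le_sum fun j hj => ?_)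
      have hj' := Finset.mem_range.1 hj
      have h1 : (χ (j + 1)).IsHomogeneous (2 * (j + 1) + 1 + 1) := hχ _ (by omega) (by omega)
      have h2 := isHomogeneous_lieE (s := s - j) (fun j h1 h2 => hχ j h1 (by omega)) hf
      have h3 := gt_pb_le h1 (n := 2 * (s - j + l) + 1) h2
      have h4 : ((2 * (j + 1) + 1 : ℕ) + (2 * (s - j + l) + 1 : ℕ) : ℝ) ≤ 2 * r + 2 := by
        have : 2 * (j + 1) + 1 + (2 * (s - j + l) + 1) ≤ 2 * r + 2 := by omega
        exact_mod_cast this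
      have h5 : |((j : ℝ) + 1) / (s + 1)| ≤ 1 := by
        have : (j : ℝ) ≤ s := by exact_mod_cast Nat.lt_succ_iff.1 hj'
        rw [abs_of_nonneg (by positivity), div_le_one (by positivity)]
        linarith
      have g1 := gt_nonneg (χ (j + 1))
      have g2 := gt_nonneg (lieE χ (s - j) f)
      calc gt (C (((j : ℝ) + 1) / (s + 1)) * pb (χ (j + 1)) (lieE χ (s - j) f))
          ≤ 1 * gt (pb (χ (j + 1)) (lieE χ (s - j) f)) :=
            (gt_C_mul_le _ _).trans (mul_le_mul_of_nonneg_right h5 (gt_nonneg _))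
        _ ≤ (2 * r + 2) * gt (χ (j + 1)) * gt (lieE χ (s - j) f) := by
            rw [one_mul]
            refine h3.trans ?_
            rw [mul_assoc, mul_assoc]
            exact mul_le_mul_of_nonneg_right h4 (mul_nonneg g1 g2)
        _ ≤ X j * (majorant X (s - j) * gt f) :=
            mul_le_mul (hX j) (ih _ (by omega) (by omega)) g2 (hX0 j)
        _ = _ := by ring

/-- The homological equation bounds χ and Z of order t + 1 by the right-hand side, which the Lie
transforms of lower order control. This is the recursion of `majorant_mul_pow_le`, with 48 and
442368 bounding H₀ and H₁. -/
theorem IsNormalForm.gt_lieE_HOmega_le {r : ℕ} {χ Z : ℕ → Poly N} (h : IsNormalForm N a r χ Z)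
    (ha : 0 < a) (ha' : a < 1 / 4) (hs : SmallCoupling N a (2 * r + 2)) :
    gt (lieE χ r (HOmega N a)) ≤ (48 * (2 * r + 2) ^ 2 * 48 * 442368) ^ r * 6 := by
  set X : ℕ → ℝ := fun j => (2 * r + 2) * gt (χ (j + 1)) with hX
  have hX0 : ∀ j, 0 ≤ X j := fun j => mul_nonneg (by positivity) (gt_nonneg _)
  have hr0 : (0 : ℝ) ≤ r := Nat.cast_nonneg r
  have hlie : ∀ {f : Poly N} {l s : ℕ}, f.IsHomogeneous (2 * l + 2) → s + l ≤ r →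
      gt (lieE χ s f) ≤ majorant X s * gt f := fun hf hsl =>
    gt_lieE_le h.chi_homogeneous (fun j => le_rfl) hf hsl
  have hchi : ∀ t, t < r → gt (χ (t + 1)) ≤ 2 * gt (rhs a χ Z t) ∧
      gt (Z (t + 1)) ≤ gt (rhs a χ Z t) := by
    intro t ht
    obtain ⟨g, hg, hχg⟩ := h.chi_range (t + 1) (by omega) ht
    rw [poisson_eq_pb] at hχg
    have h1 := gt_le_of_add_eq ha (x := pb (χ (t + 1)) (toNormal a (H0 N a)))
      ⟨pb g (toNormal a (H0 N a)), by rw [hχg, pb_range_H0 ha]⟩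
      (h.pb_HOmega_Z ha (t + 1) ht) (h.homological ht)
    have h2 := gt_le_gt_pb_H0 ha (n := 2 * (t + 1) + 1) (hs.mono (by omega)) ⟨g, hg, hχg⟩
    exact ⟨by linarith [h1.1], h1.2⟩
  have hmaj := majorant_mul_pow_le (r := r) (n := 2 * r + 2) (h := 48) (h₁ := 442368)
    (P := fun t => gt (rhs a χ Z t)) (X := X) (by linarith) (by norm_num) (by norm_num)
    (fun t => gt_nonneg _) hX0
    (fun t ht => by
      have := mul_le_mul_of_nonneg_left (hchi t ht).1 (show (0 : ℝ) ≤ 2 * r + 2 by positivity)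
      simp only [hX]; linarith)
    (fun t ht => by
      have hZ0 : Z 0 = toNormal a (H0 N a) := h.zero
      have t1 : gt (if t = 0 then toNormal a (H1 N) else 0) ≤ if t = 0 then 442368 else 0 := by
        split_ifs
        · exact gt_toNormal_H1_le ha ha'
        · rw [gt, map_zero, gn_zero]
      have t2 : gt (∑ l ∈ Finset.range t, lieE χ (t - l) (Z (l + 1)))
          ≤ ∑ l ∈ Finset.range t, gt (rhs a χ Z l) * majorant X (t - l) := by
        refine (gt_sum_le _ _).trans (Finset.sum_le_sum fun l hl => ?_)
        have hl' := Finset.mem_range.1 hl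
        refine (hlie (h.Z_homogeneous' ha (l + 1) (by omega)) (by omega)).trans ?_
        rw [mul_comm]
        exact mul_le_mul_of_nonneg_right (hchi l (by omega)).2 (majorant_nonneg hX0 _)
      have t3 : gt (∑ j ∈ Finset.range t, C (((j : ℝ) + 1) / (t + 1)) *
            pb (χ (j + 1)) (lieE χ (t - j) (Z 0)))
          ≤ ∑ j ∈ Finset.range t, 2 * (2 * r + 2) * 48 * (gt (rhs a χ Z j) * majorant X (t - j)) := by
        refine (gt_sum_le _ _).trans (Finset.sum_le_sum fun j hj => ?_)
        have hj' := Finset.mem_range.1 hj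
        have h1 : (χ (j + 1)).IsHomogeneous (2 * (j + 1) + 1 + 1) :=
          h.chi_homogeneous _ (by omega) (by omega)
        have hz : (Z 0).IsHomogeneous (2 * 0 + 2) := h.Z_homogeneous' ha 0 (by omega)
        have h2 := isHomogeneous_lieE (s := t - j) (fun j h1 h2 => h.chi_homogeneous j h1 (by omega)) hz
        have h3 := gt_pb_le h1 (n := 2 * (t - j + 0) + 1) h2
        have h4 : ((2 * (j + 1) + 1 : ℕ) + (2 * (t - j + 0) + 1 : ℕ) : ℝ) ≤ 2 * r + 2 := by
          have : 2 * (j + 1) + 1 + (2 * (t - j + 0) + 1) ≤ 2 * r + 2 := by omega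
          exact_mod_cast this
        have h5 : |((j : ℝ) + 1) / (t + 1)| ≤ 1 := by
          have : (j : ℝ) ≤ t := by exact_mod_cast hj'.le
          rw [abs_of_nonneg (by positivity), div_le_one (by positivity)]
          linarith
        have h6 : gt (lieE χ (t - j) (Z 0)) ≤ majorant X (t - j) * 48 := by
          refine (hlie hz (by omega)).trans
            (mul_le_mul_of_nonneg_left ?_ (majorant_nonneg hX0 _))
          rw [hZ0]; exact gt_toNormal_H0_le ha ha'
        have g1 := gt_nonneg (χ (j + 1))
        have g2 := gt_nonneg (lieE χ (t - j) (Z 0))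
        calc gt (C (((j : ℝ) + 1) / (t + 1)) * pb (χ (j + 1)) (lieE χ (t - j) (Z 0)))
            ≤ 1 * gt (pb (χ (j + 1)) (lieE χ (t - j) (Z 0))) :=
              (gt_C_mul_le _ _).trans (mul_le_mul_of_nonneg_right h5 (gt_nonneg _))
          _ ≤ (2 * r + 2) * (gt (χ (j + 1)) * gt (lieE χ (t - j) (Z 0))) := by
              rw [one_mul]
              refine h3.trans ?_
              rw [mul_assoc]
              exact mul_le_mul_of_nonneg_right h4 (mul_nonneg g1 g2)
          _ ≤ (2 * r + 2) * (2 * gt (rhs a χ Z j) * (majorant X (t - j) * 48)) :=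
              mul_le_mul_of_nonneg_left (mul_le_mul (hchi j (by omega)).1 h6 g2
                (mul_nonneg zero_le_two (gt_nonneg _))) (by positivity)
          _ = _ := by ring
      rw [← Finset.mul_sum] at t3
      have t4 : gt (rhs a χ Z t) ≤ _ :=
        (gt_sub_le _ _).trans (add_le_add ((gt_sub_le _ _).trans (add_le_add t1 t2)) t3)
      refine t4.trans ?_
      have hS : 0 ≤ ∑ l ∈ Finset.range t, gt (rhs a χ Z l) * majorant X (t - l) :=
        Finset.sum_nonneg fun l _ => mul_nonneg (gt_nonneg _) (majorant_nonneg hX0 _)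
      -- The two sums carry the factors 1 and 2 · 48 (2r + 2), together at most 3 · 48 (2r + 2).
      have := mul_nonneg hr0 hS
      nlinarith)
  have h0 : (HOmega N a).IsHomogeneous (2 * 0 + 2) := isHomogeneous_HOmega
  exact (hlie h0 (by omega)).trans
    (mul_le_mul hmaj (gt_HOmega_le ha ha') (gt_nonneg _) (by positivity))

theorem IsNormalForm.gn_remainder_le {r : ℕ} {χ Z : ℕ → Poly N} (h : IsNormalForm N a r χ Z)
    (ha : 0 < a) (ha' : a < 1 / 4) (hs : SmallCoupling N a (2 * r + 2)) :
    gn (remainder N a r χ) ≤ 24 * 32 ^ (2 * r + 3) *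
      ((2 * r + 4) * ((48 * (2 * r + 2) ^ 2 * 48 * 442368) ^ r * 6) * 442368) := by
  rw [h.remainder_eq ha]
  have h1 := isHomogeneous_lieE (s := r) (l := 0) h.chi_homogeneous (isHomogeneous_HOmega (a := a))
  have h2 := isHomogeneous_pb (m := 2 * r + 1) (n := 3) h1
    (isHomogeneous_toNormal_H1 (a := a))
  have h3 := gt_pb_le (m := 2 * r + 1) (n := 3) h1 (isHomogeneous_toNormal_H1 (a := a))
  refine (gn_toOriginal_le ha ha' h2).trans
    (mul_le_mul_of_nonneg_left (h3.trans ?_) (by positivity))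
  have e : ((2 * r + 1 : ℕ) + (3 : ℕ) : ℝ) = 2 * r + 4 := by push_cast; ring
  rw [e]
  exact mul_le_mul (mul_le_mul_of_nonneg_left (h.gt_lieE_HOmega_le ha ha' hs) (by positivity))
    (gt_toNormal_H1_le ha ha') (gt_nonneg _) (by positivity)

end Growth

/-! ### Young-type inequalities -/

section Inequalities

theorem prod_abs_pow_le {ι : Type*} [Fintype ι] (z : ι → ℝ) (d : ι → ℕ) {n : ℕ} (hn : n ≠ 0)
    (hd : ∑ i, d i = n) : ∏ i, |z i| ^ d i ≤ ∑ i, (d i : ℝ) / n * |z i| ^ n := by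
  have hn' : (n : ℝ) ≠ 0 := Nat.cast_ne_zero.2 hn
  have h := Real.geom_mean_le_arith_mean_weighted Finset.univ (fun i => (d i : ℝ) / n)
    (fun i => |z i| ^ n) (fun i _ => by positivity)
    (by rw [← Finset.sum_div, ← Nat.cast_sum, hd, div_self hn']) (fun i _ => by positivity)
  refine le_trans (le_of_eq (Finset.prod_congr rfl fun i _ => ?_)) h
  rw [← Real.rpow_natCast (|z i|) n, ← Real.rpow_mul (abs_nonneg _), mul_div_cancel₀ _ hn',
    Real.rpow_natCast]

/-- Young's inequality for x^{2k+1} y, that is, convexity of the even power. It makes a harmonic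
pair force dissipative for every even moment. -/
theorem pow_sub_pow_div_le (x y : ℝ) (k : ℕ) :
    (x ^ (2 * k + 2) - y ^ (2 * k + 2)) / (2 * k + 2) ≤ x ^ (2 * k + 1) * (x - y) := by
  have h := prod_abs_pow_le ![x, y] ![2 * k + 1, 1] (n := 2 * k + 2) (by omega) (by simp)
  simp only [Fin.prod_univ_two, Fin.sum_univ_two, Matrix.cons_val_zero, Matrix.cons_val_one,
    pow_one] at h
  have e : Even (2 * k + 2) := ⟨k + 1, by ring⟩
  rw [e.pow_abs, e.pow_abs, ← abs_pow, ← abs_mul] at h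
  have h2 := (le_abs_self _).trans h
  push_cast at h2
  rw [div_le_iff₀ (by positivity)]
  have h3 := mul_le_mul_of_nonneg_right h2 (show (0 : ℝ) ≤ 2 * k + 2 by positivity)
  have h4 : ((2 * (k : ℝ) + 1) / (2 * k + 2) * x ^ (2 * k + 2) + 1 / (2 * k + 2) * y ^ (2 * k + 2))
      * (2 * k + 2) = (2 * k + 1) * x ^ (2 * k + 2) + y ^ (2 * k + 2) := by
    field_simp
  rw [h4] at h3
  have h5 : x ^ (2 * k + 2) = x ^ (2 * k + 1) * x := pow_succ _ _
  nlinarith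

end Inequalities

/-! ### Moments under a Gibbs weight -/

section GibbsIntegrals

variable {ι : Type*} [Fintype ι]

theorem hasLineDerivAt_eval [DecidableEq ι] (f : MvPolynomial ι ℝ) (i : ι) (z : ι → ℝ) :
    HasLineDerivAt ℝ (fun z => eval z f) (eval z (pderiv i f)) z (Pi.single i 1) := by
  unfold HasLineDerivAt
  induction f using MvPolynomial.induction_on with
  | C c => simpa using hasDerivAt_const (0 : ℝ) c
  | add p q hp hq =>
    simp only [map_add]
    exact hp.add hq
  | mul_X p j hp =>
    have h1 : HasDerivAt (fun t : ℝ => (z + t • (Pi.single i 1 : ι → ℝ)) j)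
        (eval z (pderiv i (X j : MvPolynomial ι ℝ))) 0 := by
      have h2 := ((hasDerivAt_id (0 : ℝ)).mul_const ((Pi.single i 1 : ι → ℝ) j)).const_add (z j)
      have e : eval z (pderiv i (X j : MvPolynomial ι ℝ)) = 1 * (Pi.single i 1 : ι → ℝ) j := by
        rw [pderiv_X, one_mul, Pi.single_apply, Pi.single_apply]
        by_cases h : i = j
        · simp [h]
        · simp [Ne.symm h]
      rw [e]
      exact h2
    have h3 := hp.mul h1
    have e0 : z + (0 : ℝ) • (Pi.single i 1 : ι → ℝ) = z := by simp
    rw [e0] at h3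
    simp only [pderiv_mul, map_add, map_mul, eval_X]
    exact h3

/-- A polynomial potential bounded below by `∑ z_i² / 2`. -/
def Coercive (V : MvPolynomial ι ℝ) : Prop := ∀ z : ι → ℝ, ∑ i, z i ^ 2 / 2 ≤ eval z V

/-- The unnormalized Gibbs average of a polynomial. -/
def gint (V : MvPolynomial ι ℝ) (β : ℝ) (f : MvPolynomial ι ℝ) : ℝ :=
  ∫ z : ι → ℝ, eval z f * Real.exp (-β * eval z V)

variable {V : MvPolynomial ι ℝ} {β : ℝ}

theorem integrable_pow_mul_gaussian {b : ℝ} (hb : 0 < b) (n : ℕ) :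
    Integrable fun x : ℝ => |x| ^ n * Real.exp (-b * x ^ 2) := by
  have h := (integrable_rpow_mul_exp_neg_mul_sq hb (s := n)
    (lt_of_lt_of_le (by norm_num) (Nat.cast_nonneg n))).norm
  refine h.congr (Eventually.of_forall fun x => ?_)
  simp only [Real.rpow_natCast, norm_mul, norm_pow, Real.norm_eq_abs, Real.abs_exp]

/-- A monomial times the weight is dominated by a product of one-dimensional Gaussian integrands. -/
theorem Coercive.integrable (hV : Coercive V) (hβ : 0 < β) (f : MvPolynomial ι ℝ) :
    Integrable fun z : ι → ℝ => eval z f * Real.exp (-β * eval z V) := by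
  induction f using MvPolynomial.induction_on' with
  | add p q hp hq =>
    refine (hp.add hq).congr (Eventually.of_forall fun z => ?_)
    simp only [Pi.add_apply, map_add, add_mul]
  | monomial d c =>
    have hg : Integrable fun z : ι → ℝ =>
        ∏ i, (|z i| ^ d i * Real.exp (-(β / 2) * z i ^ 2)) :=
      Integrable.fintype_prod (f := fun i x => |x| ^ d i * Real.exp (-(β / 2) * x ^ 2))
        fun i => integrable_pow_mul_gaussian (half_pos hβ) (d i)
    refine (hg.const_mul |c|).mono' ?_ (Eventually.of_forall fun z => ?_)
    · exact ((continuous_eval _).mul (Real.continuous_exp.comp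
        (continuous_const.mul (continuous_eval _)))).aestronglyMeasurable
    · rw [eval_monomial, Finsupp.prod_fintype _ _ fun i => pow_zero _, Finset.prod_mul_distrib,
        ← Real.exp_sum, norm_mul, norm_mul, Real.norm_eq_abs, Real.norm_eq_abs, Finset.abs_prod,
        Real.norm_eq_abs, Real.abs_exp, mul_assoc]
      simp only [abs_pow]
      refine mul_le_mul_of_nonneg_left (mul_le_mul_of_nonneg_left (Real.exp_le_exp.2 ?_)
        (by positivity)) (abs_nonneg c)
      have h1 := mul_le_mul_of_nonneg_left (hV z) hβ.le
      have h2 : ∑ i, -(β / 2) * z i ^ 2 = -(β * ∑ i, z i ^ 2 / 2) := by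
        rw [Finset.mul_sum, ← Finset.sum_neg_distrib]
        exact Finset.sum_congr rfl fun i _ => by ring
      rw [h2]; linarith

theorem Coercive.gint_add (hV : Coercive V) (hβ : 0 < β) (f g : MvPolynomial ι ℝ) :
    gint V β (f + g) = gint V β f + gint V β g := by
  rw [gint, gint, gint, ← integral_add (hV.integrable hβ f) (hV.integrable hβ g)]
  simp only [map_add, add_mul]

theorem gint_C_mul (c : ℝ) (f : MvPolynomial ι ℝ) : gint V β (C c * f) = c * gint V β f := by
  simp only [gint, map_mul, eval_C, mul_assoc, integral_const_mul]

theorem Coercive.gint_sum (hV : Coercive V) (hβ : 0 < β) {κ : Type*} (s : Finset κ)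
    (f : κ → MvPolynomial ι ℝ) : gint V β (∑ i ∈ s, f i) = ∑ i ∈ s, gint V β (f i) := by
  simp only [gint, map_sum, Finset.sum_mul]
  exact integral_finsetSum _ fun i _ => hV.integrable hβ (f i)

theorem Coercive.gint_mono (hV : Coercive V) (hβ : 0 < β) {f g : MvPolynomial ι ℝ}
    (h : ∀ z, eval z f ≤ eval z g) : gint V β f ≤ gint V β g :=
  integral_mono (hV.integrable hβ f) (hV.integrable hβ g) fun z =>
    mul_le_mul_of_nonneg_right (h z) (Real.exp_pos _).le

theorem Coercive.gint_one_pos (hV : Coercive V) (hβ : 0 < β) : 0 < gint V β 1 := by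
  have h := hV.integrable hβ 1
  simp only [map_one, one_mul] at h
  simp only [gint, map_one, one_mul]
  exact integral_exp_pos h

/-- The integral of the total derivative of f e^{-βV} vanishes. -/
theorem Coercive.gint_pderiv (hV : Coercive V) (hβ : 0 < β) (f : MvPolynomial ι ℝ) (i : ι) :
    gint V β (pderiv i f) = β * gint V β (f * pderiv i V) := by
  classical
  have hd : ∀ z : ι → ℝ, HasLineDerivAt ℝ (fun z => eval z f * Real.exp (-β * eval z V))
      (eval z (pderiv i f - C β * (f * pderiv i V)) * Real.exp (-β * eval z V)) z
      (Pi.single i 1) := fun z => by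
    have h1 := hasLineDerivAt_eval f i z
    have h2 := ((hasLineDerivAt_eval V i z).const_mul (-β)).exp
    have h3 := HasDerivAt.mul h1 h2
    have e : ∀ x y : ℝ, x = y → HasLineDerivAt ℝ (fun z => eval z f * Real.exp (-β * eval z V))
      x z (Pi.single i 1) → HasLineDerivAt ℝ (fun z => eval z f * Real.exp (-β * eval z V))
      y z (Pi.single i 1) := fun x y h => by rw [h]; exact id
    refine e _ _ ?_ h3
    simp only [zero_smul, add_zero, map_sub, map_mul, eval_C]
    ring
  -- Integration by parts against the constant function 1, so that no boundary term and no second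
  -- factor remain.
  have h := integral_bilinear_hasLineDerivAt_right_eq_neg_left_of_integrable
    (μ := (volume : Measure (ι → ℝ))) (f := fun _ => (1 : ℝ)) (f' := fun _ => 0)
    (B := ContinuousLinearMap.mul ℝ ℝ) (v := Pi.single i 1)
    (g := fun z => eval z f * Real.exp (-β * eval z V))
    (g' := fun z => eval z (pderiv i f - C β * (f * pderiv i V)) * Real.exp (-β * eval z V))
    (by simp) (by
      simp only [ContinuousLinearMap.mul_apply', one_mul]; exact hV.integrable hβ _)
    (by simp only [ContinuousLinearMap.mul_apply', one_mul]; exact hV.integrable hβ f)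
    (fun x _ => by simpa [HasLineDerivAt] using hasDerivAt_const (0 : ℝ) (1 : ℝ))
    (fun x _ => hd x)
  simp only [ContinuousLinearMap.mul_apply', one_mul, zero_mul, integral_zero, neg_zero] at h
  have h2 : gint V β (pderiv i f - C β * (f * pderiv i V)) = 0 := h
  rw [sub_eq_add_neg, hV.gint_add hβ, ← neg_one_mul, ← C_1, ← C_neg, gint_C_mul, gint_C_mul] at h2
  linarith

/-- A potential whose drift is `z_i` plus attractive pair interactions. -/
structure Dissipative (V : MvPolynomial ι ℝ) : Prop where
  coercive : Coercive V
  drift : ∃ W : ι → ι → ℝ, (∀ i j, 0 ≤ W i j) ∧ ∀ (k : ℕ) (z : ι → ℝ) (i : ι),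
    z i ^ (2 * k + 2) + ∑ j, W i j * ((z i ^ (2 * k + 2) - z j ^ (2 * k + 2)) / (2 * k + 2))
      ≤ z i ^ (2 * k + 1) * eval z (pderiv i V)

/-- At the site where the moment of order 2k + 2 is largest, the average of every pair term in the
drift is nonnegative. Dropping these terms leaves the Gaussian recursion β ⟨z^{2k+2}⟩ ≤ (2k+1)
⟨z^{2k}⟩, whatever the coupling and the number of sites. -/
theorem Dissipative.moment_le (hV : Dissipative V) (hβ : 0 < β) (k : ℕ) (i : ι) :
    gint V β (X i ^ (2 * k)) ≤ (∏ l ∈ Finset.range k, (2 * (l : ℝ) + 1)) / β ^ k * gint V β 1 := by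
  classical
  have hC := hV.coercive
  obtain ⟨W, hW0, hW⟩ := hV.drift
  induction k generalizing i with
  | zero => simp
  | succ k ih =>
    have : Nonempty ι := ⟨i⟩
    obtain ⟨m, _, hm⟩ := Finset.exists_max_image Finset.univ
      (fun i => gint V β (X i ^ (2 * k + 2))) Finset.univ_nonempty
    refine (hm i (Finset.mem_univ i)).trans ?_
    have h1 := hC.gint_pderiv hβ (X m ^ (2 * k + 1)) m
    have e1 : pderiv m (X m ^ (2 * k + 1) : MvPolynomial ι ℝ)
        = C ((2 * k + 1 : ℕ) : ℝ) * X m ^ (2 * k) := by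
      rw [pderiv_pow, pderiv_X_self, mul_one, Nat.add_sub_cancel, C_eq_coe_nat]
    rw [e1, gint_C_mul] at h1
    have h2 : gint V β (X m ^ (2 * k + 2) + ∑ j, C (W m j / (2 * k + 2)) *
        (X m ^ (2 * k + 2) + C (-1) * X j ^ (2 * k + 2)))
        ≤ gint V β (X m ^ (2 * k + 1) * pderiv m V) := by
      refine hC.gint_mono hβ fun z => le_trans (le_of_eq ?_) ((hW k z m).trans_eq ?_)
      · simp only [map_add, map_sum, map_mul, map_pow, eval_X, eval_C]
        refine congrArg _ (Finset.sum_congr rfl fun j _ => ?_)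
        ring
      · simp
    rw [hC.gint_add hβ, hC.gint_sum hβ] at h2
    have h3 : 0 ≤ ∑ j, gint V β (C (W m j / (2 * k + 2)) *
        (X m ^ (2 * k + 2) + C (-1) * X j ^ (2 * k + 2))) := by
      refine Finset.sum_nonneg fun j _ => ?_
      rw [gint_C_mul, hC.gint_add hβ, gint_C_mul]
      have := hm j (Finset.mem_univ j)
      exact mul_nonneg (div_nonneg (hW0 m j) (by positivity)) (by linarith)
    have h4 : β * gint V β (X m ^ (2 * k + 2)) ≤ (2 * k + 1) * gint V β (X m ^ (2 * k)) := by
      push_cast at h1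
      rw [h1]
      exact mul_le_mul_of_nonneg_left (by linarith) hβ.le
    have h5 := h4.trans (mul_le_mul_of_nonneg_left (ih m) (by positivity))
    rw [mul_comm, ← le_div_iff₀ hβ] at h5
    refine h5.trans_eq ?_
    rw [Finset.prod_range_succ, pow_succ]
    field_simp

/-- Weighted arithmetic–geometric means reduce a mixed moment to single-site moments of the same
degree. -/
theorem Dissipative.abs_gint_monomial_le (hV : Dissipative V) (hβ : 0 < β) {n : ℕ} (hn : n ≠ 0)
    {d : ι →₀ ℕ} (hd : ∑ i, d i = 2 * n) : |gint V β (monomial d 1)|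
      ≤ (∏ l ∈ Finset.range n, (2 * (l : ℝ) + 1)) / β ^ n * gint V β 1 := by
  have hC := hV.coercive
  have h1 : |gint V β (monomial d 1)|
      ≤ gint V β (∑ i, C ((d i : ℝ) / (2 * n : ℕ)) * X i ^ (2 * n)) := by
    refine abs_integral_le_integral_abs.trans ?_
    refine integral_mono (hC.integrable hβ _).abs (hC.integrable hβ _) fun z => ?_
    simp only [abs_mul, Real.abs_exp]
    refine mul_le_mul_of_nonneg_right ?_ (Real.exp_pos _).le
    rw [eval_monomial, Finsupp.prod_fintype _ _ fun i => pow_zero _, one_mul, Finset.abs_prod]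
    simp only [abs_pow, map_sum, map_mul, eval_C, map_pow, eval_X]
    refine (prod_abs_pow_le z d (by omega) hd).trans_eq (Finset.sum_congr rfl fun i _ => ?_)
    rw [(even_two_mul n).pow_abs]
  refine h1.trans ?_
  rw [hC.gint_sum hβ]
  set m := (∏ l ∈ Finset.range n, (2 * (l : ℝ) + 1)) / β ^ n * gint V β 1
  calc ∑ i, gint V β (C ((d i : ℝ) / (2 * n : ℕ)) * X i ^ (2 * n))
      ≤ ∑ i, (d i : ℝ) / (2 * n : ℕ) * m := Finset.sum_le_sum fun i _ => by
        rw [gint_C_mul]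
        exact mul_le_mul_of_nonneg_left (hV.moment_le hβ n i) (by positivity)
    _ = m := by
        rw [← Finset.sum_mul, ← Finset.sum_div, ← Nat.cast_sum, hd, div_self, one_mul]
        exact Nat.cast_ne_zero.2 (by omega)

theorem gint_monomial_eq_zero [DecidableEq ι] {v : ι}
    (hV : ∀ z, eval (fun i => if i = v then -z i else z i) V = eval z V) {d : ι →₀ ℕ}
    (hd : Odd (d v)) : gint V β (monomial d 1) = 0 := by
  have hmp : MeasurePreserving (fun (z : ι → ℝ) i => if i = v then -z i else z i) volume volume :=
    volume_preserving_pi (f := fun i x => if i = v then -x else x) fun i => by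
      by_cases h : i = v
      · simp only [h, if_true]; exact Measure.measurePreserving_neg volume
      · simp only [h, if_false]; exact MeasurePreserving.id _
  have hcont : Continuous (fun (z : ι → ℝ) i => if i = v then -z i else z i) := by
    refine continuous_pi fun i => ?_
    split_ifs
    · exact (continuous_apply i).neg
    · exact continuous_apply i
  have hinv : ∀ z : ι → ℝ, (fun i => if i = v then -(fun i => if i = v then -z i else z i) i
      else (fun i => if i = v then -z i else z i) i) = z := fun z => by
    funext i
    by_cases h : i = v <;> simp [h]
  -- The reflection is packaged as a homeomorphism to have the measurable embedding required by the
  -- change of variables.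
  let e : (ι → ℝ) ≃ₜ (ι → ℝ) :=
    { toFun := fun z i => if i = v then -z i else z i
      invFun := fun z i => if i = v then -z i else z i
      left_inv := hinv
      right_inv := hinv
      continuous_toFun := hcont
      continuous_invFun := hcont }
  have h := hmp.integral_comp e.measurableEmbedding
    fun z => eval z (monomial d (1 : ℝ)) * Real.exp (-β * eval z V)
  have hmon : ∀ z : ι → ℝ, eval (fun i => if i = v then -z i else z i) (monomial d (1 : ℝ))
      = -eval z (monomial d (1 : ℝ)) := fun z => by
    rw [eval_monomial, eval_monomial, Finsupp.prod_fintype _ _ fun i => pow_zero _,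
      Finsupp.prod_fintype _ _ fun i => pow_zero _, one_mul, one_mul,
      ← Finset.mul_prod_erase _ _ (Finset.mem_univ v),
      ← Finset.mul_prod_erase _ (fun i => z i ^ d i) (Finset.mem_univ v), if_pos rfl, hd.neg_pow,
      neg_mul]
    refine congrArg (fun t => -(z v ^ d v * t)) (Finset.prod_congr rfl fun i hi => ?_)
    rw [if_neg (Finset.ne_of_mem_erase hi)]
  simp only [hV, hmon, neg_mul, integral_neg] at h
  have h2 : -gint V β (monomial d 1) = gint V β (monomial d 1) := by
    simpa only [gint, neg_mul] using h
  linarith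

/-- For a fixed monomial d, odd in a variable v that the potential sees only through its square,
only the monomials d' containing v correlate with d. Their coefficients sum to at most `l1 (pderiv v
R)`. So one of the two sums is local, and only the other can grow with the number of sites. -/
theorem Dissipative.gint_sq_le [Nonempty ι] [DecidableEq ι] (hV : Dissipative V) (hβ : 0 < β)
    {n : ℕ} (hn : n ≠ 0) {R : MvPolynomial ι ℝ} (hR : R.IsHomogeneous n)
    (hodd : ∀ d ∈ R.support, ∃ v, Odd (d v) ∧
      ∀ z, eval (fun i => if i = v then -z i else z i) V = eval z V) :
    gint V β (R ^ 2) ≤ l1 R * gn R *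
      ((∏ l ∈ Finset.range n, (2 * (l : ℝ) + 1)) / β ^ n * gint V β 1) := by
  have hC := hV.coercive
  set m := (∏ l ∈ Finset.range n, (2 * (l : ℝ) + 1)) / β ^ n * gint V β 1 with hm
  have hm0 : 0 ≤ m := mul_nonneg
    (div_nonneg (Finset.prod_nonneg fun l _ => by positivity) (by positivity))
    (hC.gint_one_pos hβ).le
  have hdeg : ∀ d ∈ R.support, ∑ i, d i = n := fun d hd => by
    have := hR (mem_support_iff.1 hd)
    rw [Finsupp.weight_apply, Finsupp.sum_fintype _ _ fun i => by simp] at this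
    simpa using this
  have hexp : R ^ 2 = ∑ d ∈ R.support, ∑ d' ∈ R.support,
      C (R.coeff d * R.coeff d') * monomial (d + d') 1 := by
    conv_lhs => rw [sq, R.as_sum, Finset.sum_mul_sum]
    refine Finset.sum_congr rfl fun d _ => Finset.sum_congr rfl fun d' _ => ?_
    rw [monomial_mul, C_mul_monomial, mul_one]
  rw [hexp, hC.gint_sum hβ]
  calc ∑ d ∈ R.support, gint V β (∑ d' ∈ R.support,
        C (R.coeff d * R.coeff d') * monomial (d + d') 1)
      ≤ ∑ d ∈ R.support, |R.coeff d| * (gn R * m) := Finset.sum_le_sum fun d hd => ?_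
    _ = l1 R * gn R * m := by
      rw [← Finset.sum_mul, l1, mul_assoc]
      simp only [Real.norm_eq_abs]
  obtain ⟨v, hv, hVv⟩ := hodd d hd
  rw [hC.gint_sum hβ]
  calc ∑ d' ∈ R.support, gint V β (C (R.coeff d * R.coeff d') * monomial (d + d') 1)
      ≤ ∑ d' ∈ R.support, |R.coeff d| * (((d' v : ℝ) * ‖R.coeff d'‖) * m) :=
        Finset.sum_le_sum fun d' hd' => by
          rw [gint_C_mul]
          -- If d' does not contain v, then d + d' is odd in v and the average vanishes. Otherwise
          -- inserting the factor d' v ≥ 1 produces the norm of the derivative.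
          rcases Nat.eq_zero_or_pos (d' v) with h0 | h0
          · rw [gint_monomial_eq_zero hVv (by simpa [h0] using hv), h0]
            simp
          · have h1 := hV.abs_gint_monomial_le hβ hn (d := d + d') (by
              simp only [Finsupp.add_apply, Finset.sum_add_distrib, hdeg d hd, hdeg d' hd']
              ring)
            have h2 : (1 : ℝ) ≤ d' v := by exact_mod_cast h0
            calc _ ≤ |R.coeff d * R.coeff d' * gint V β (monomial (d + d') 1)| := le_abs_self _
              _ = |R.coeff d| * (|R.coeff d'| * |gint V β (monomial (d + d') 1)|) := by
                rw [abs_mul, abs_mul, mul_assoc]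
              _ ≤ _ := by
                refine mul_le_mul_of_nonneg_left ?_ (abs_nonneg _)
                rw [Real.norm_eq_abs]
                refine mul_le_mul ?_ h1 (abs_nonneg _) (by positivity)
                exact le_mul_of_one_le_left (abs_nonneg _) h2
    _ = |R.coeff d| * (l1 (pderiv v R) * m) := by
        rw [← Finset.mul_sum, ← Finset.sum_mul, l1_pderiv]
    _ ≤ |R.coeff d| * (gn R * m) :=
        mul_le_mul_of_nonneg_left (mul_le_mul_of_nonneg_right (l1_pderiv_le_gn R v) hm0)
          (abs_nonneg _)

end GibbsIntegrals

/-! ### Chain potentials are dissipative -/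

section ChainPotential

variable {ι : Type*} [Fintype ι]

/-- The potential of anharmonic oscillators with harmonic pair interactions. -/
def chainPot (c : ι → ℝ) (w : ι → ι → ℝ) : MvPolynomial ι ℝ :=
  ∑ i, (C (1 / 2) * X i ^ 2 + C (c i / 4) * X i ^ 4)
    + ∑ i, ∑ j, C (w i j / 2) * (X i - X j) ^ 2

theorem eval_chainPot (c : ι → ℝ) (w : ι → ι → ℝ) (z : ι → ℝ) : eval z (chainPot c w)
    = ∑ i, (z i ^ 2 / 2 + c i / 4 * z i ^ 4) + ∑ i, ∑ j, w i j / 2 * (z i - z j) ^ 2 := by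
  simp only [chainPot, map_add, map_sum, map_mul, map_pow, map_sub, eval_X, eval_C]
  congr 1
  exact Finset.sum_congr rfl fun i _ => by ring

theorem eval_pderiv_chainPot (c : ι → ℝ) (w : ι → ι → ℝ) (z : ι → ℝ) (k : ι) :
    eval z (pderiv k (chainPot c w))
      = z k + c k * z k ^ 3 + ∑ j, (w k j + w j k) * (z k - z j) := by
  classical
  have e : ∀ i, eval z (pderiv k (X i : MvPolynomial ι ℝ)) = if i = k then 1 else 0 := fun i => by
    rw [pderiv_X, Pi.single_apply]; split_ifs <;> simp
  have h1 : ∀ i, eval z (pderiv k (C (1 / 2) * X i ^ 2 + C (c i / 4) * X i ^ 4))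
      = if i = k then z i + c i * z i ^ 3 else 0 := fun i => by
    simp only [map_add, pderiv_C_mul, pderiv_pow, map_mul, eval_C, e, map_pow, eval_X, map_natCast]
    split_ifs
    · push_cast; ring
    · simp
  have h2 : ∀ i j, eval z (pderiv k (C (w i j / 2) * (X i - X j) ^ 2))
      = (if i = k then w i j * (z i - z j) else 0) - if j = k then w i j * (z i - z j) else 0 :=
    fun i j => by
      simp only [map_sub, pderiv_C_mul, pderiv_pow, map_mul, eval_C, e, map_pow, eval_X,
        map_natCast]
      split_ifs <;> push_cast <;> ring
  simp only [chainPot, map_add _ (∑ i, _) (∑ i, _), map_sum, h1, h2, Finset.sum_sub_distrib,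
    Finset.sum_ite_eq', Finset.mem_univ, if_true]
  rw [Finset.sum_comm]
  simp only [Finset.sum_ite_eq', Finset.mem_univ, if_true]
  rw [← Finset.sum_sub_distrib]
  refine congrArg _ (Finset.sum_congr rfl fun j _ => ?_)
  ring

/-- The quartic force only increases the drift. The pair forces are symmetrized, since w is indexed
by ordered pairs, and each is handled by Young's inequality. -/
theorem dissipative_chainPot {c : ι → ℝ} {w : ι → ι → ℝ} (hc : ∀ i, 0 ≤ c i)
    (hw : ∀ i j, 0 ≤ w i j) : Dissipative (chainPot c w) where
  coercive z := by
    rw [eval_chainPot]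
    have h1 : 0 ≤ ∑ i, ∑ j, w i j / 2 * (z i - z j) ^ 2 := Finset.sum_nonneg fun i _ =>
      Finset.sum_nonneg fun j _ => mul_nonneg (div_nonneg (hw i j) zero_le_two) (sq_nonneg _)
    have h2 : ∑ i, z i ^ 2 / 2 ≤ ∑ i, (z i ^ 2 / 2 + c i / 4 * z i ^ 4) :=
      Finset.sum_le_sum fun i _ => le_add_of_nonneg_right
        (mul_nonneg (div_nonneg (hc i) (by norm_num)) (by positivity))
    linarith
  drift := by
    refine ⟨fun i j => w i j + w j i, fun i j => add_nonneg (hw i j) (hw j i), fun k z i => ?_⟩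
    rw [eval_pderiv_chainPot, mul_add, Finset.mul_sum]
    have h1 : z i ^ (2 * k + 2) ≤ z i ^ (2 * k + 1) * (z i + c i * z i ^ 3) := by
      have : 0 ≤ c i * z i ^ (2 * (k + 2)) := mul_nonneg (hc i) (by rw [pow_mul]; positivity)
      calc z i ^ (2 * k + 2) ≤ z i ^ (2 * k + 2) + c i * z i ^ (2 * (k + 2)) :=
            le_add_of_nonneg_right this
        _ = _ := by ring
    refine add_le_add h1 (Finset.sum_le_sum fun j _ => ?_)
    have := mul_le_mul_of_nonneg_left (pow_sub_pow_div_le (z i) (z j) k)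
      (add_nonneg (hw i j) (hw j i))
    refine this.trans_eq ?_
    ring

end ChainPotential

/-! ### Second moment of the remainder -/

section SecondMoment

variable {N : ℕ} [NeZero N] {a β : ℝ}

/-- Momenta are treated as further sites, without quartic term or coupling, so one moment bound
serves for all canonical variables. -/
theorem hamiltonian_eq : hamiltonian N a = chainPot (Sum.elim (fun _ => 1) fun _ => 0)
    (Sum.elim (fun i => Sum.elim (fun j => if j = i - 1 then a else 0) fun _ => 0)
      fun _ _ => 0) := by
  refine MvPolynomial.funext fun z => ?_
  rw [eval_chainPot]
  simp only [hamiltonian, H0, H1, map_add, map_mul, map_sum, eval_C, map_pow, map_sub, eval_X,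
    Fintype.sum_sum_type, Sum.elim_inl, Sum.elim_inr, Finset.sum_const_zero, zero_div, zero_mul,
    add_zero, ite_div, ite_mul, Finset.sum_ite_eq', Finset.mem_univ, if_true, Finset.mul_sum,
    ← Finset.sum_add_distrib]
  exact Finset.sum_congr rfl fun i _ => by ring

theorem dissipative_hamiltonian (ha : 0 < a) : Dissipative (hamiltonian N a) := by
  rw [hamiltonian_eq]
  refine dissipative_chainPot ?_ ?_
  · rintro (i | i) <;> simp
  · rintro (i | i) (j | j) <;> simp
    split_ifs <;> simp [ha.le]

theorem eval_flip_hamiltonian (l : ZMod N) (z : Var N → ℝ) :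
    eval (fun i => if i = Sum.inr l then -z i else z i) (hamiltonian N a)
      = eval z (hamiltonian N a) := by
  simp only [hamiltonian, H0, H1, map_add, map_mul, map_sum, eval_C, map_pow, map_sub, eval_X,
    reduceCtorEq, if_false]
  have : ∀ j : ZMod N, (if (Sum.inr j : Var N) = Sum.inr l then -z (Sum.inr j) else z (Sum.inr j)) ^ 2
      = z (Sum.inr j) ^ 2 := fun j => by split_ifs <;> ring
  simp only [this]

theorem coeff_reversal (f : Poly N) (d : Var N →₀ ℕ) :
    coeff d (reversal f) = (-1) ^ (∑ l, d (Sum.inr l)) * coeff d f := by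
  classical
  induction f using MvPolynomial.induction_on' with
  | add p q hp hq => rw [map_add, coeff_add, hp, hq, coeff_add, mul_add]
  | monomial u c =>
    have h : reversal (monomial u c : Poly N)
        = C ((-1) ^ (∑ l, u (Sum.inr l))) * monomial u c := by
      rw [reversal, aeval_monomial, Finsupp.prod_fintype _ _ fun i => pow_zero _,
        Fintype.prod_sum_type, monomial_eq, Finsupp.prod_fintype _ _ fun i => pow_zero _,
        Fintype.prod_sum_type]
      simp only [Sum.elim_inl, Sum.elim_inr, algebraMap_eq]
      have e : ∀ l : ZMod N, (-X (Sum.inr l) : Poly N) ^ u (Sum.inr l)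
          = C ((-1) ^ u (Sum.inr l)) * X (Sum.inr l) ^ u (Sum.inr l) := fun l => by
        rw [neg_pow, map_pow, map_neg, C_1]
      simp only [e, Finset.prod_mul_distrib, ← map_prod, Finset.prod_pow_eq_pow_sum]
      ring
    rw [h, coeff_C_mul, coeff_monomial]
    split_ifs with hu
    · rw [hu]
    · simp

theorem exists_odd_of_reversal {R : Poly N} (hR : reversal R = -R) {d : Var N →₀ ℕ}
    (hd : d ∈ R.support) : ∃ l, Odd (d (Sum.inr l)) := by
  by_contra! h
  have h1 : Even (∑ l, d (Sum.inr l)) :=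
    Finset.even_sum _ fun l _ => Nat.not_odd_iff_even.1 (h l)
  have h2 := coeff_reversal R d
  rw [hR, coeff_neg, h1.neg_one_pow, one_mul] at h2
  exact mem_support_iff.1 hd (by linarith)

theorem second_moment_le (ha : 0 < a) (hβ : 0 < β) {n : ℕ} (hn : 2 ≤ n) {R : Poly N}
    (hR : R.IsHomogeneous n) (hrev : reversal R = -R) :
    Integrable (fun z => eval z R ^ 2) (gibbs N a β) ∧
    ∫ z, eval z R ^ 2 ∂(gibbs N a β)
      ≤ N * (gn R ^ 2 * ((∏ l ∈ Finset.range n, (2 * (l : ℝ) + 1)) / β ^ n)) := by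
  classical
  have hV := dissipative_hamiltonian (N := N) ha
  have hC := hV.coercive
  have h1 := hC.integrable hβ 1
  simp only [map_one, one_mul] at h1
  have hpos := hC.gint_one_pos hβ
  have hI : gint (hamiltonian N a) β 1 = ∫ z, Real.exp (-β * eval z (hamiltonian N a)) := by
    simp [gint]
  constructor
  · rw [gibbs, integrable_tilted_iff h1]
    refine (hC.integrable hβ (R ^ 2)).congr (Eventually.of_forall fun z => ?_)
    simp only [map_pow, smul_eq_mul]; ring
  · have h2 : ∫ z, eval z R ^ 2 ∂(gibbs N a β)
        = gint (hamiltonian N a) β (R ^ 2) / gint (hamiltonian N a) β 1 := by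
      rw [gibbs, integral_tilted, ← hI]
      generalize gint (hamiltonian N a) β 1 = c
      rw [gint, ← integral_div]
      refine integral_congr_ae (Eventually.of_forall fun z => ?_)
      simp only [map_pow, smul_eq_mul]; ring
    rw [h2, div_le_iff₀ hpos]
    refine (hV.gint_sq_le hβ (by omega) hR fun d hd => ?_).trans ?_
    · obtain ⟨l, hl⟩ := exists_odd_of_reversal hrev hd
      exact ⟨Sum.inr l, hl, eval_flip_hamiltonian l⟩
    · have h3 := mul_l1_le_gn hR
      have hcard : (Fintype.card (Var N) : ℝ) = 2 * N := by
        rw [Fintype.card_sum, ZMod.card]; push_cast; ring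
      rw [hcard] at h3
      have h4 : (2 : ℝ) ≤ n := by exact_mod_cast hn
      -- There are 2N variables, and the degree n ≥ 2 compensates the factor 2.
      have h5 : l1 R ≤ N * gn R := by nlinarith [l1_nonneg R]
      have h6 : 0 ≤ (∏ l ∈ Finset.range n, (2 * (l : ℝ) + 1)) / β ^ n :=
        div_nonneg (Finset.prod_nonneg fun l _ => by positivity) (by positivity)
      have h7 := mul_le_mul_of_nonneg_right h5
        (mul_nonneg (gn_nonneg R) (mul_nonneg h6 hpos.le))
      calc _ = l1 R * (gn R * ((∏ l ∈ Finset.range n, (2 * (l : ℝ) + 1)) / β ^ n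
            * gint (hamiltonian N a) β 1)) := by ring
        _ ≤ _ := h7
        _ = _ := by ring

/-- Every factor is at most 4r + 7 ≤ 11r, and the surplus r⁴ is absorbed by 16^r. -/
theorem prod_odd_le {r : ℕ} (hr : 1 ≤ r) :
    ∏ l ∈ Finset.range (2 * r + 4), (2 * (l : ℝ) + 1) ≤ (11 ^ 6 * 16) ^ r * (r : ℝ) ^ (2 * r) := by
  have hr1 : (1 : ℝ) ≤ r := by exact_mod_cast hr
  have h1 : ∏ l ∈ Finset.range (2 * r + 4), (2 * (l : ℝ) + 1) ≤ (11 * r) ^ (2 * r + 4) := by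
    refine (Finset.prod_le_prod (g := fun _ => 11 * (r : ℝ)) (fun l _ => by positivity)
      fun l hl => ?_).trans_eq (by simp)
    have : (l : ℝ) ≤ 2 * r + 3 := by
      have := Finset.mem_range.1 hl
      exact_mod_cast (show l ≤ 2 * r + 3 by omega)
    linarith
  have h2 : (11 : ℝ) ^ (2 * r + 4) ≤ (11 ^ 6) ^ r := by
    rw [← pow_mul]; exact pow_le_pow_right₀ (by norm_num) (by omega)
  have h3 : (r : ℝ) ^ 4 ≤ 16 ^ r := by
    have h : (r : ℝ) ≤ 2 ^ r := by exact_mod_cast (Nat.lt_two_pow_self (n := r)).le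
    calc (r : ℝ) ^ 4 ≤ (2 ^ r) ^ 4 := pow_le_pow_left₀ (by positivity) h 4
      _ = 16 ^ r := by rw [← pow_mul, mul_comm, pow_mul]; norm_num
  calc _ ≤ _ := h1
    _ = 11 ^ (2 * r + 4) * ((r : ℝ) ^ 4 * (r : ℝ) ^ (2 * r)) := by rw [mul_pow]; ring
    _ ≤ (11 ^ 6) ^ r * (16 ^ r * (r : ℝ) ^ (2 * r)) := by gcongr
    _ = _ := by rw [mul_pow]; ring

theorem growth_le {r : ℕ} (hr : 1 ≤ r) {K L : ℝ} (hK : 0 ≤ K) (hL : 1 ≤ L) :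
    24 * 32 ^ (2 * r + 3) * ((2 * r + 4) * ((48 * (2 * r + 2) ^ 2 * K) ^ r * L))
      ≤ (24 * 32 ^ 5 * 12 * (768 * K) * L) ^ r * (r : ℝ) ^ (2 * r) := by
  have hr1 : (1 : ℝ) ≤ r := by exact_mod_cast hr
  have hr0 : r ≠ 0 := by omega
  have h1 : (24 : ℝ) ≤ 24 ^ r := le_self_pow₀ (by norm_num) hr0
  have h2 : (32 : ℝ) ^ (2 * r + 3) ≤ (32 ^ 5) ^ r := by
    rw [← pow_mul]; exact pow_le_pow_right₀ (by norm_num) (by omega)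
  have h3 : (2 * (r : ℝ) + 4) ≤ 12 ^ r := by
    have h : (r : ℝ) ≤ 2 ^ r := by exact_mod_cast (Nat.lt_two_pow_self (n := r)).le
    have h' : (6 : ℝ) ≤ 6 ^ r := le_self_pow₀ (by norm_num) hr0
    calc 2 * (r : ℝ) + 4 ≤ 6 * r := by linarith
      _ ≤ 6 ^ r * 2 ^ r := by gcongr
      _ = 12 ^ r := by rw [← mul_pow]; norm_num
  have h4 : (48 * (2 * (r : ℝ) + 2) ^ 2 * K) ^ r ≤ (768 * K) ^ r * (r : ℝ) ^ (2 * r) := by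
    rw [pow_mul, ← mul_pow]
    refine pow_le_pow_left₀ (by positivity) ?_ r
    have : (2 * (r : ℝ) + 2) ^ 2 ≤ 16 * r ^ 2 := by nlinarith
    nlinarith
  have h5 : L ≤ L ^ r := le_self_pow₀ hL hr0
  calc _ ≤ 24 ^ r * (32 ^ 5) ^ r * (12 ^ r * ((768 * K) ^ r * (r : ℝ) ^ (2 * r) * L ^ r)) := by
        gcongr
    _ = _ := by simp only [mul_pow]; ring

/-- The second moment of the remainder, with constants independent of the number of sites. -/
theorem exists_second_moment_remainder_le : ∃ M : ℝ, 1 ≤ M ∧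
    ∀ (N : ℕ) [NeZero N] (a β : ℝ) (r : ℕ) (χ Z : ℕ → Poly N), 0 < a → a < 1 / 4 → 0 < β →
      1 ≤ r → SmallCoupling N a (2 * r + 2) → IsNormalForm N a r χ Z →
      Integrable (fun z => eval z (remainder N a r χ) ^ 2) (gibbs N a β) ∧
      ∫ z, eval z (remainder N a r χ) ^ 2 ∂(gibbs N a β)
        ≤ N * (M ^ r * (r : ℝ) ^ (6 * r) / β ^ (2 * r + 4)) := by
  obtain ⟨A, hA1, hA⟩ : ∃ A : ℝ, 1 ≤ A ∧ ∀ r : ℕ, 1 ≤ r →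
      24 * 32 ^ (2 * r + 3) * ((2 * (r : ℝ) + 4) *
        ((48 * (2 * r + 2) ^ 2 * (48 * 442368)) ^ r * (6 * 442368))) ≤ A ^ r * (r : ℝ) ^ (2 * r) :=
    ⟨_, by norm_num, fun r hr => growth_le hr (K := 48 * 442368) (L := 6 * 442368)
      (by norm_num) (by norm_num)⟩
  refine ⟨A ^ 2 * (11 ^ 6 * 16), ?_, ?_⟩
  · nlinarith
  intro N _ a β r χ Z ha ha' hβ hr hs h
  have hR := h.isHomogeneous_remainder ha
  obtain ⟨hint, hle⟩ := second_moment_le ha hβ (n := 2 * r + 4) (by omega) hR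
    (h.reversal_remainder ha hs)
  refine ⟨hint, hle.trans (mul_le_mul_of_nonneg_left ?_ (Nat.cast_nonneg N))⟩
  have h1 : gn (remainder N a r χ) ≤ A ^ r * (r : ℝ) ^ (2 * r) := by
    refine le_trans (le_trans (h.gn_remainder_le ha ha' hs) (le_of_eq ?_)) (hA r hr)
    rw [mul_assoc (48 * (2 * (r : ℝ) + 2) ^ 2)]
    ring
  have h2 := prod_odd_le hr
  have h3 : gn (remainder N a r χ) ^ 2 ≤ (A ^ r * (r : ℝ) ^ (2 * r)) ^ 2 :=
    pow_le_pow_left₀ (gn_nonneg _) h1 2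
  rw [mul_div_assoc']
  refine div_le_div_of_nonneg_right ?_ (by positivity)
  calc gn (remainder N a r χ) ^ 2 * ∏ l ∈ Finset.range (2 * r + 4), (2 * (l : ℝ) + 1)
      ≤ (A ^ r * (r : ℝ) ^ (2 * r)) ^ 2 * ((11 ^ 6 * 16) ^ r * (r : ℝ) ^ (2 * r)) :=
        mul_le_mul h3 h2 (Finset.prod_nonneg fun l _ => by positivity) (by positivity)
    _ = (A ^ 2 * (11 ^ 6 * 16)) ^ r * (r : ℝ) ^ (6 * r) := by
        simp only [mul_pow]
        have e : (r : ℝ) ^ (6 * r) = ((r : ℝ) ^ (2 * r)) ^ 2 * (r : ℝ) ^ (2 * r) := by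
          rw [← pow_mul, ← pow_add]; congr 1; ring
        rw [e]; ring

end SecondMoment

/-! ### Bounds on the partition functions -/

section PartitionFunctions

/-- The potential of the chain with periodic ends. -/
def periodicPot (l : ℕ) [NeZero l] (a : ℝ) : MvPolynomial (ZMod l) ℝ :=
  chainPot (fun _ => 1) fun i j => if j = i - 1 then a else 0

/-- The potential of the chain with free ends. -/
def freePot (l : ℕ) [NeZero l] (a : ℝ) : MvPolynomial (ZMod l) ℝ :=
  chainPot (fun _ => 1) fun i j => if j = i - 1 then (if i = 0 then 0 else a) else 0

variable {l : ℕ} [NeZero l] {a β : ℝ}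

theorem eval_periodicPot (x : ZMod l → ℝ) : eval x (periodicPot l a)
    = ∑ j, (x j ^ 2 / 2 + a / 2 * (x j - x (j - 1)) ^ 2 + x j ^ 4 / 4) := by
  rw [periodicPot, eval_chainPot, ← Finset.sum_add_distrib]
  refine Finset.sum_congr rfl fun i _ => ?_
  simp only [ite_div, ite_mul, zero_div, zero_mul, Finset.sum_ite_eq', Finset.mem_univ, if_true]
  ring

theorem eval_freePot (x : ZMod l → ℝ) : eval x (freePot l a)
    = ∑ j, (x j ^ 2 / 2 + (if j = 0 then 0 else a / 2 * (x j - x (j - 1)) ^ 2) + x j ^ 4 / 4) := by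
  rw [freePot, eval_chainPot, ← Finset.sum_add_distrib]
  refine Finset.sum_congr rfl fun i _ => ?_
  simp only [ite_div, ite_mul, zero_div, zero_mul, Finset.sum_ite_eq', Finset.mem_univ, if_true]
  split_ifs <;> ring

theorem partitionPeriodic_eq : partitionPeriodic l β a = gint (periodicPot l a) β 1 := by
  simp only [partitionPeriodic, gint, map_one, one_mul, eval_periodicPot]

theorem partitionFree_eq : partitionFree l β a = gint (freePot l a) β 1 := by
  simp only [partitionFree, gint, map_one, one_mul, eval_freePot]

theorem dissipative_periodicPot (ha : 0 < a) : Dissipative (periodicPot l a) :=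
  dissipative_chainPot (fun _ => zero_le_one) fun i j => by split_ifs <;> simp [ha.le]

theorem dissipative_freePot (ha : 0 < a) : Dissipative (freePot l a) :=
  dissipative_chainPot (fun _ => zero_le_one) fun i j => by split_ifs <;> simp [ha.le]

/-- A perturbation of the potential by two site energies barely changes the partition function. -/
theorem Dissipative.gint_perturbation_ge {ι : Type*} [Fintype ι] {V : MvPolynomial ι ℝ}
    (hV : Dissipative V) (hβ : 0 < β) (ha : 0 < a) (u v : ι) :
    (1 - 2 * a) * gint V β 1 ≤ gint V β (1 - C (β * a) * (X u ^ 2 + X v ^ 2)) := by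
  have hC := hV.coercive
  have h1 := fun i => hV.moment_le hβ 1 i
  simp only [Finset.prod_range_one, mul_one, pow_one, CharP.cast_eq_zero, mul_zero, zero_add] at h1
  have e : (1 - C (β * a) * (X u ^ 2 + X v ^ 2) : MvPolynomial ι ℝ)
      = 1 + C (-(β * a)) * (X u ^ 2 + X v ^ 2) := by rw [C_neg]; ring
  rw [e, hC.gint_add hβ, gint_C_mul, hC.gint_add hβ]
  have h2 := mul_le_mul_of_nonneg_left (add_le_add (h1 u) (h1 v)) (mul_pos hβ ha).le
  have h3 : β * a * (1 / β * gint V β 1 + 1 / β * gint V β 1) = 2 * a * gint V β 1 := by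
    field_simp; ring
  linarith

/-- Closing the chain multiplies the integrand by the exponential of the added spring energy. Using
e^{-t} ≥ 1 - t, the loss is controlled by the second moments of the two end sites, each at most 1/β.
-/
theorem partitionFree_le (ha : 0 < a) (hβ : 0 < β) :
    (1 - 2 * a) * partitionFree l β a ≤ partitionPeriodic l β a := by
  have hV := dissipative_freePot (l := l) ha
  rw [partitionFree_eq, partitionPeriodic_eq]
  refine (hV.gint_perturbation_ge hβ ha 0 (0 - 1)).trans ?_
  refine integral_mono (hV.coercive.integrable hβ _)
    ((dissipative_periodicPot ha).coercive.integrable hβ _) fun x => ?_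
  have h1 : eval x (periodicPot l a) = eval x (freePot l a) + a / 2 * (x 0 - x (0 - 1)) ^ 2 := by
    rw [eval_periodicPot, eval_freePot]
    have : a / 2 * (x 0 - x (0 - 1)) ^ 2
        = ∑ j, if j = 0 then a / 2 * (x j - x (j - 1)) ^ 2 else 0 := by simp
    rw [this, ← Finset.sum_add_distrib]
    refine Finset.sum_congr rfl fun j _ => ?_
    split_ifs <;> ring
  simp only [map_sub, map_one, map_mul, eval_C, map_add, map_pow, eval_X, one_mul]
  rw [h1]
  generalize x 0 = u
  generalize x (0 - 1) = v
  have h2 : a / 2 * (u - v) ^ 2 ≤ a * (u ^ 2 + v ^ 2) := by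
    nlinarith [mul_nonneg ha.le (sq_nonneg (u + v))]
  have h3 := Real.add_one_le_exp (-β * (a / 2 * (u - v) ^ 2))
  have h4 : Real.exp (-β * (eval x (freePot l a) + a / 2 * (u - v) ^ 2))
      = Real.exp (-β * (a / 2 * (u - v) ^ 2)) * Real.exp (-β * eval x (freePot l a)) := by
    rw [← Real.exp_add]; congr 1; ring
  rw [h4]
  refine mul_le_mul_of_nonneg_right (le_trans ?_ h3) (Real.exp_pos _).le
  nlinarith

theorem integral_fin_cons {n : ℕ} (f : (Fin (n + 1) → ℝ) → ℝ) :
    ∫ x, f x = ∫ p : ℝ × (Fin n → ℝ), f (Fin.cons p.1 p.2) := by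
  have h := (volume_preserving_piFinSuccAbove (fun _ : Fin (n + 1) => ℝ) 0).symm.integral_comp' f
  rw [← h]
  refine integral_congr_ae (Eventually.of_forall fun p => ?_)
  simp [MeasurableEquiv.piFinSuccAbove, Fin.insertNthEquiv]

theorem integrable_fin_cons {n : ℕ} {f : (Fin (n + 1) → ℝ) → ℝ} (hf : Integrable f) :
    Integrable fun p : ℝ × (Fin n → ℝ) => f (Fin.cons p.1 p.2) := by
  have h := (volume_preserving_piFinSuccAbove (fun _ : Fin (n + 1) => ℝ) 0).symm.integrable_comp_emb
    (MeasurableEquiv.measurableEmbedding _) |>.2 hf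
  refine h.congr (Eventually.of_forall fun p => ?_)
  simp [MeasurableEquiv.piFinSuccAbove, Fin.insertNthEquiv]

theorem sum_periodic_eq (n : ℕ) (x : ZMod (n + 1) → ℝ) :
    ∑ j : ZMod (n + 1), (x j ^ 2 / 2 + a / 2 * (x j - x (j - 1)) ^ 2 + x j ^ 4 / 4)
      = ∑ j : Fin (n + 1), (x j ^ 2 / 2 + x j ^ 4 / 4)
        + a / 2 * (x (0 : Fin (n + 1)) - x (Fin.last n)) ^ 2
        + ∑ j : Fin n, a / 2 * (x j.succ - x j.castSucc) ^ 2 := by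
  have h1 : ∑ j : ZMod (n + 1), (x j ^ 2 / 2 + a / 2 * (x j - x (j - 1)) ^ 2 + x j ^ 4 / 4)
      = ∑ j : ZMod (n + 1), (x j ^ 2 / 2 + x j ^ 4 / 4)
        + ∑ j : ZMod (n + 1), a / 2 * (x j - x (j - 1)) ^ 2 := by
    rw [← Finset.sum_add_distrib]
    exact Finset.sum_congr rfl fun j _ => by ring
  have h2 : (0 : Fin (n + 1)) - 1 = Fin.last n := by
    ext; rw [Fin.coe_sub_one]; simp
  have h3 : ∀ j : Fin n, j.succ - 1 = j.castSucc := fun j => by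
    ext; rw [Fin.coe_sub_one]; simp
  have h4 := Fin.sum_univ_succ fun j : Fin (n + 1) => a / 2 * (x j - x (j - 1 : Fin (n + 1))) ^ 2
  simp only [h2, h3] at h4
  rw [h1, add_assoc]
  exact congrArg _ h4

/-- Inserting a site y between u and v replaces one spring by two: half the sum of (y-u)² and (y-v)²
minus half of (u-v)² is (y-u)(y-v). -/
theorem eval_periodicPot_succ (n : ℕ) {y : ℝ} {x : ZMod (n + 1) → ℝ} {x' : ZMod (n + 2) → ℝ}
    (h0 : x' (0 : Fin (n + 2)) = y) (hs : ∀ j : Fin (n + 1), x' j.succ = x j) {i j : ZMod (n + 1)}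
    (hi : i = (0 : Fin (n + 1))) (hj : j = Fin.last n) :
    eval x' (periodicPot (n + 2) a) = eval x (periodicPot (n + 1) a) + (y ^ 2 / 2 + y ^ 4 / 4)
      + a * ((y - x i) * (y - x j)) := by
  have h1 : x' (Fin.last (n + 1)) = x (Fin.last n) := by rw [← hs, Fin.succ_last]
  have h2 := sum_periodic_eq (a := a) (n + 1) x'
  rw [Fin.sum_univ_succ fun j : Fin (n + 1 + 1) => x' j ^ 2 / 2 + x' j ^ 4 / 4,
    Fin.sum_univ_succ fun j : Fin (n + 1) => a / 2 * (x' j.succ - x' j.castSucc) ^ 2] at h2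
  simp only [h0, h1, hs, Fin.castSucc_zero, ← Fin.succ_castSucc] at h2
  rw [eval_periodicPot, eval_periodicPot, hi, hj]
  refine h2.trans ?_
  rw [sum_periodic_eq]
  ring

/-- On |y| ≤ β^{-1/2} the exponent is at least -(1/2 + 1/4 + 1/4) = -1. -/
theorem le_integral_site (hβ : 1 < β) (ha0 : 0 < a) (ha : a ≤ 1 / 8) :
    2 * Real.exp (-1) / √β
      ≤ ∫ y : ℝ, Real.exp (-β * ((1 / 2 + 2 * a) * y ^ 2 + y ^ 4 / 4)) := by
  have hβ0 : 0 < β := by linarith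
  have hint : Integrable fun y : ℝ => Real.exp (-β * ((1 / 2 + 2 * a) * y ^ 2 + y ^ 4 / 4)) := by
    refine (integrable_exp_neg_mul_sq (half_pos hβ0)).mono' ?_ (Eventually.of_forall fun y => ?_)
    · exact (by fun_prop : Continuous fun y : ℝ =>
        Real.exp (-β * ((1 / 2 + 2 * a) * y ^ 2 + y ^ 4 / 4))).aestronglyMeasurable
    · rw [Real.norm_eq_abs, Real.abs_exp]
      refine Real.exp_le_exp.2 ?_
      have : 0 ≤ β * (2 * a * y ^ 2 + y ^ 4 / 4) := by positivity
      linarith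
  set s := 1 / √β with hs
  have hs0 : 0 < s := by positivity
  have hs2 : β * s ^ 2 = 1 := by
    rw [hs, div_pow, Real.sq_sqrt hβ0.le]; field_simp
  have h1 : ∫ _y in Set.Icc (-s) s, Real.exp (-1)
      ≤ ∫ y in Set.Icc (-s) s, Real.exp (-β * ((1 / 2 + 2 * a) * y ^ 2 + y ^ 4 / 4)) := by
    refine setIntegral_mono_on (by simp) hint.integrableOn measurableSet_Icc fun y hy => ?_
    refine Real.exp_le_exp.2 ?_
    have hy2 : y ^ 2 ≤ s ^ 2 := sq_le_sq' hy.1 hy.2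
    have hy2' : β * y ^ 2 ≤ 1 := hs2 ▸ mul_le_mul_of_nonneg_left hy2 hβ0.le
    have hy1 : y ^ 2 ≤ 1 := by nlinarith [sq_nonneg y]
    have hy4 : β * y ^ 4 ≤ 1 := by
      have : β * y ^ 4 = (β * y ^ 2) * y ^ 2 := by ring
      rw [this]; nlinarith [sq_nonneg y, mul_nonneg hβ0.le (sq_nonneg y)]
    nlinarith [mul_nonneg hβ0.le (sq_nonneg y)]
  have h2 : ∫ _y in Set.Icc (-s) s, Real.exp (-1) = 2 * Real.exp (-1) / √β := by
    rw [setIntegral_const, Real.volume_real_Icc_of_le (by linarith), smul_eq_mul, hs]; ring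
  rw [← h2]
  exact h1.trans (setIntegral_le_integral hint (Eventually.of_forall fun y => (Real.exp_pos _).le))

/-- The bound (y-u)(y-v) ≤ 2y² + u² + v² decouples the new site from the old ones, and e^{-t} ≥ 1 -
t then turns the cost to the old chain into a quadratic polynomial. -/
theorem site_insertion_le (hβ : 0 < β) (ha : 0 < a) (y u v F : ℝ) :
    Real.exp (-β * ((1 / 2 + 2 * a) * y ^ 2 + y ^ 4 / 4)) *
      ((1 - β * a * (u ^ 2 + v ^ 2)) * Real.exp (-β * F)) ≤
    Real.exp (-β * (F + (y ^ 2 / 2 + y ^ 4 / 4) + a * ((y - u) * (y - v)))) := by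
  have h1 := Real.add_one_le_exp (-(β * a * (u ^ 2 + v ^ 2)))
  calc _ ≤ Real.exp (-β * ((1 / 2 + 2 * a) * y ^ 2 + y ^ 4 / 4)) *
        (Real.exp (-(β * a * (u ^ 2 + v ^ 2))) * Real.exp (-β * F)) :=
        mul_le_mul_of_nonneg_left (mul_le_mul_of_nonneg_right (by linarith) (Real.exp_pos _).le)
          (Real.exp_pos _).le
    _ ≤ _ := by
        rw [← Real.exp_add, ← Real.exp_add]
        refine Real.exp_le_exp.2 ?_
        have h2 : (y - u) * (y - v) ≤ 2 * y ^ 2 + u ^ 2 + v ^ 2 := by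
          nlinarith [sq_nonneg (y + (u + v) / 2), sq_nonneg (u - v), sq_nonneg (u + v)]
        nlinarith [mul_le_mul_of_nonneg_left h2 (mul_pos hβ ha).le]

theorem le_partitionPeriodic_succ (n : ℕ) (hβ : 0 < β) (ha : 0 < a) :
    (∫ y : ℝ, Real.exp (-β * ((1 / 2 + 2 * a) * y ^ 2 + y ^ 4 / 4)))
        * ((1 - 2 * a) * partitionPeriodic (n + 1) β a)
      ≤ partitionPeriodic (n + 2) β a := by
  have hV := dissipative_periodicPot (l := n + 1) ha
  have hV' := dissipative_periodicPot (l := n + 2) ha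
  have hsite : Integrable fun y : ℝ => Real.exp (-β * ((1 / 2 + 2 * a) * y ^ 2 + y ^ 4 / 4)) := by
    refine (integrable_exp_neg_mul_sq (half_pos hβ)).mono' ?_ (Eventually.of_forall fun y => ?_)
    · exact (by fun_prop : Continuous fun y : ℝ =>
        Real.exp (-β * ((1 / 2 + 2 * a) * y ^ 2 + y ^ 4 / 4))).aestronglyMeasurable
    · rw [Real.norm_eq_abs, Real.abs_exp]
      refine Real.exp_le_exp.2 ?_
      have : 0 ≤ β * (2 * a * y ^ 2 + y ^ 4 / 4) := by positivity
      linarith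
  -- `ZMod (n + 1)` is definitionally `Fin (n + 1)`. The neighbours of the new site are named as
  -- elements of the former, so that the variables X i and X j belong to the right polynomial ring.
  obtain ⟨i, hi⟩ : ∃ i : ZMod (n + 1), i = (0 : Fin (n + 1)) := ⟨_, rfl⟩
  obtain ⟨j, hj⟩ : ∃ j : ZMod (n + 1), j = Fin.last n := ⟨_, rfl⟩
  have h0 := hV.gint_perturbation_ge hβ ha i j
  rw [partitionPeriodic_eq, partitionPeriodic_eq]
  refine (mul_le_mul_of_nonneg_left h0 (integral_nonneg fun y => (Real.exp_pos _).le)).trans ?_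
  have hI := hV.coercive.integrable hβ
    (1 - C (β * a) * (X i ^ 2 + X j ^ 2))
  have hI' := hV'.coercive.integrable hβ 1
  have e1 : gint (periodicPot (n + 2) a) β 1 = ∫ p : ℝ × (Fin (n + 1) → ℝ),
      (fun x : ZMod (n + 2) → ℝ => eval x 1 * Real.exp (-β * eval x (periodicPot (n + 2) a)))
        (Fin.cons p.1 p.2) :=
    integral_fin_cons fun x : ZMod (n + 2) → ℝ =>
      eval x 1 * Real.exp (-β * eval x (periodicPot (n + 2) a))
  rw [e1, gint, ← integral_prod_mul]
  refine integral_mono (hsite.mul_prod hI) (integrable_fin_cons hI') fun p => ?_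
  obtain ⟨y, x⟩ := p
  have e3 : eval x (1 - C (β * a) * (X i ^ 2 + X j ^ 2) :
      MvPolynomial (ZMod (n + 1)) ℝ)
      = 1 - β * a * (x i ^ 2 + x j ^ 2) := by
    simp only [map_sub, map_one, map_mul, eval_C, map_add, map_pow, eval_X]
  have key : ∀ x' : ZMod (n + 2) → ℝ, x' (0 : Fin (n + 2)) = y →
      (∀ j : Fin (n + 1), x' j.succ = x j) →
      Real.exp (-β * ((1 / 2 + 2 * a) * y ^ 2 + y ^ 4 / 4)) *
        (eval x (1 - C (β * a) * (X i ^ 2 + X j ^ 2) : MvPolynomial (ZMod (n + 1)) ℝ) *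
          Real.exp (-β * eval x (periodicPot (n + 1) a))) ≤
      eval x' 1 * Real.exp (-β * eval x' (periodicPot (n + 2) a)) := by
    intro x' hx0 hxs
    rw [eval_periodicPot_succ (a := a) n hx0 hxs hi hj, e3, map_one, one_mul]
    exact site_insertion_le hβ ha _ _ _ _
  exact key (Fin.cons y x : Fin (n + 2) → ℝ) rfl fun j => rfl

/-- For a < 1/8 the perturbation factor 1 - 2a is at least 3/4. Then K₁ = 8 suffices for the site
insertion, because √(2π)/8 ≤ 3/8 and (2/e)(3/4) ≥ 1/2, and (2K₁)^{1+4a₀} ≥ 2 covers the free ends.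
-/
theorem partitionBounds {a₀ : ℝ} (h₀ : 0 < a₀) (h₀' : a₀ ≤ 1 / 8) : PartitionBounds 1 a₀ 8 := by
  intro β a hβ ha ha₀ l
  have ha' : a < 1 / 8 := ha₀.trans_le h₀'
  have hβ0 : 0 < β := by linarith
  have hp : 0 < partitionPeriodic (l + 1) β a := by
    rw [partitionPeriodic_eq]; exact (dissipative_periodicPot ha).coercive.gint_one_pos hβ0
  constructor
  · refine le_trans ?_ (le_partitionPeriodic_succ l hβ0 ha)
    have h1 := le_integral_site hβ ha ha'.le
    have h2 : 1 / 8 * √(2 * Real.pi / β) ≤ 2 * Real.exp (-1) / √β * (3 / 4) := by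
      have h3 : √(2 * Real.pi) ≤ 3 := by
        rw [Real.sqrt_le_left (by norm_num)]; linarith [Real.pi_lt_d2]
      have h4 : 1 / 3 ≤ Real.exp (-1) := by
        rw [Real.exp_neg, one_div]
        exact inv_anti₀ (Real.exp_pos _) (Real.exp_one_lt_d9.le.trans (by norm_num))
      calc 1 / 8 * √(2 * Real.pi / β) = 1 / 8 * √(2 * Real.pi) / √β := by
            rw [Real.sqrt_div (by positivity)]; ring
        _ ≤ 2 * Real.exp (-1) * (3 / 4) / √β :=
            div_le_div_of_nonneg_right (by linarith) (Real.sqrt_nonneg β)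
        _ = _ := by ring
    have h5 : 2 * Real.exp (-1) / √β * (3 / 4) ≤
        (∫ y : ℝ, Real.exp (-β * ((1 / 2 + 2 * a) * y ^ 2 + y ^ 4 / 4))) * (1 - 2 * a) :=
      mul_le_mul h1 (by linarith) (by norm_num) (integral_nonneg fun y => (Real.exp_pos _).le)
    have h6 := mul_le_mul_of_nonneg_left (h2.trans h5) hp.le
    linarith
  · have h1 := partitionFree_le (l := l + 1) ha hβ0
    have h2 : (2 : ℝ) ≤ (2 * 8) ^ (1 + 4 * a₀) := by
      calc (2 : ℝ) ≤ (2 * 8) ^ (1 : ℝ) := by norm_num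
        _ ≤ _ := Real.rpow_le_rpow_of_exponent_le (by norm_num) (by linarith)
    have hf : 0 < partitionFree (l + 1) β a := by
      rw [partitionFree_eq]; exact (dissipative_freePot ha).coercive.gint_one_pos hβ0
    have h3 : partitionFree (l + 1) β a ≤ partitionPeriodic (l + 1) β a * 2 := by nlinarith
    exact h3.trans (mul_le_mul_of_nonneg_left h2 hp.le)

end PartitionFunctions

/-! ### From the moment bound to the two claimed forms -/

section Numerics

variable {M C₁ B K₄ β : ℝ} {r : ℕ}

/-- Here B stands for β^*. K₄ is of order C₁^{-2}, so two powers of C₁ pay for it and the others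
absorb M^r. -/
theorem pow_le_pow_mul_of_one_le (hM : 1 ≤ M) (hC : M ≤ C₁) (hB : C₁ ≤ B) (hK : 1 ≤ C₁ ^ 2 * K₄) :
    M ^ r ≤ B ^ (2 * r + 4) * K₄ := by
  have hC1 : 1 ≤ C₁ := hM.trans hC
  have hC0 : 0 < C₁ := by linarith
  have hK0 : 0 < K₄ := by
    by_contra! h
    nlinarith [mul_nonneg (sq_nonneg C₁) (neg_nonneg.2 h)]
  calc M ^ r ≤ C₁ ^ r := pow_le_pow_left₀ (by linarith) hC r
    _ ≤ C₁ ^ (2 * r + 2) := pow_le_pow_right₀ hC1 (by omega)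
    _ ≤ C₁ ^ (2 * r + 2) * (C₁ ^ 2 * K₄) := le_mul_of_one_le_right (by positivity) hK
    _ = C₁ ^ (2 * r + 4) * K₄ := by ring
    _ ≤ B ^ (2 * r + 4) * K₄ := by gcongr

theorem power_law_bound {ν : ℝ} (hM : 1 ≤ M) (hC : M ≤ C₁) (hB : C₁ ≤ B)
    (hK : 1 ≤ C₁ ^ 2 * K₄) (hr : 1 ≤ r) (hν : 0 < ν) (hβ0 : 0 < β)
    (hβ : (B * (r : ℝ) ^ 3) ^ (1 / ν) < β) :
    M ^ r * (r : ℝ) ^ (6 * r) / β ^ (2 * r + 4) ≤ 1 / β ^ lambda1 r ν * (K₄ * B ^ 3) := by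
  have hB0 : 0 < B := by linarith
  have hr1 : (1 : ℝ) ≤ r := by exact_mod_cast hr
  have h1 : B * (r : ℝ) ^ 3 ≤ β ^ ν := by
    have h := Real.rpow_le_rpow (by positivity) hβ.le hν.le
    rwa [← Real.rpow_mul (by positivity), one_div_mul_cancel hν.ne', Real.rpow_one] at h
  -- This identity fixes the value of λ₁. The powers of β^ν consume (B r³)^{2r+1}, and B³ remains of
  -- the available B^{2r+4}.
  have h2 : β ^ (2 * r + 4) = β ^ lambda1 r ν * (β ^ ν) ^ (2 * r + 1) := by
    rw [← Real.rpow_natCast (β ^ ν), ← Real.rpow_mul hβ0.le, ← Real.rpow_add hβ0,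
      ← Real.rpow_natCast β, lambda1]
    congr 1; push_cast; ring
  have hlam : 0 < β ^ lambda1 r ν := Real.rpow_pos_of_pos hβ0 _
  have h3 : (B * (r : ℝ) ^ 3) ^ (2 * r + 1) ≤ (β ^ ν) ^ (2 * r + 1) :=
    pow_le_pow_left₀ (by positivity) h1 _
  have h4 := pow_le_pow_mul_of_one_le (r := r) hM hC hB hK
  have hK0 : 0 < K₄ := by
    by_contra! h
    nlinarith [mul_nonneg (sq_nonneg C₁) (neg_nonneg.2 h)]
  rw [div_le_iff₀ (by positivity), h2]
  calc M ^ r * (r : ℝ) ^ (6 * r) ≤ B ^ (2 * r + 4) * K₄ * (r : ℝ) ^ (6 * r + 3) :=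
        mul_le_mul h4 (pow_le_pow_right₀ hr1 (by omega)) (by positivity) (by positivity)
    _ = K₄ * B ^ 3 * (B * (r : ℝ) ^ 3) ^ (2 * r + 1) := by rw [mul_pow]; ring
    _ ≤ K₄ * B ^ 3 * (β ^ ν) ^ (2 * r + 1) := by gcongr
    _ = _ := by field_simp

/-- Here q = 2κ/3 and r is the integer part of q/2. Since 2r ≤ q, r^{6r} is at most q^{6r}/64^r, so
β ≥ e B q³ leaves e^{-(2r+4)} q^{-12} and a gain 64^{-r}. That gain pays for replacing e^{-2r} by
e^{-3q/2}. -/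
theorem exponential_bound {q : ℝ} (hM : 1 ≤ M) (hC : M ≤ C₁) (hB : C₁ ≤ B)
    (hK : 1 ≤ C₁ ^ 2 * K₄) (hr : 2 * r ≤ q) (hq : q < 2 * r + 2) (hq2 : 2 ≤ q)
    (hβ : Real.exp 1 * B * q ^ 3 ≤ β) :
    M ^ r * (r : ℝ) ^ (6 * r) / β ^ (2 * r + 4)
      ≤ Real.exp (-(3 / 2 * q)) / (3 / 2 * q) ^ 9 * (3 ^ 8 * K₄ / (2 * Real.exp 4)) := by
  have hB0 : 0 < B := by linarith
  have hq0 : 0 < q := by linarith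
  have he := Real.exp_pos 1
  have hβ0 : 0 < β := lt_of_lt_of_le (by positivity) hβ
  have hK0 : 0 < K₄ := by
    by_contra! h
    nlinarith [mul_nonneg (sq_nonneg C₁) (neg_nonneg.2 h)]
  have h1 := pow_le_pow_mul_of_one_le (r := r) hM hC hB hK
  have h2 : (r : ℝ) ^ (6 * r) * 64 ^ r ≤ (q ^ 3) ^ (2 * r) := by
    have : (64 : ℝ) ^ r = 2 ^ (6 * r) := by rw [pow_mul]; norm_num
    rw [this, ← mul_pow, ← pow_mul, ← mul_assoc]
    exact pow_le_pow_left₀ (by positivity) (by linarith) _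
  -- The loss e^{3q/2 - 2r} is at most e^{r+3} because q < 2r + 2. The factor q³ comes from asking
  -- for κ^{-9} where q^{-12} is available, and 256/3 is the inverse of 3⁸/2 · (2/3)⁹ inverted
  -- numerically, i.e. of 3/256.
  have h3 : 1 ≤ 64 ^ r * (Real.exp (2 * r - 3 / 2 * q) * q ^ 3 * (256 / 3)) := by
    have e1 : Real.exp 1 ≤ 3 := Real.exp_one_lt_d9.le.trans (by norm_num)
    have e2 : Real.exp (r + 3) ≤ 3 ^ r * 27 := by
      have : ((r : ℝ) + 3) = ((r + 3 : ℕ) : ℝ) * 1 := by push_cast; ring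
      rw [this, Real.exp_nat_mul]
      calc Real.exp 1 ^ (r + 3) ≤ 3 ^ (r + 3) := pow_le_pow_left₀ he.le e1 _
        _ = 3 ^ r * 27 := by ring
    have e3 : 1 ≤ Real.exp (2 * r - 3 / 2 * q) * (3 ^ r * 27) := by
      calc 1 ≤ Real.exp (2 * r - 3 / 2 * q) * Real.exp (r + 3) := by
            rw [← Real.exp_add]; exact Real.one_le_exp (by linarith)
        _ ≤ _ := mul_le_mul_of_nonneg_left e2 (Real.exp_pos _).le
    have e4 : (3 : ℝ) ^ r ≤ 64 ^ r := pow_le_pow_left₀ (by norm_num) (by norm_num) r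
    have e5 : (8 : ℝ) ≤ q ^ 3 := by
      calc (8 : ℝ) = 2 ^ 3 := by norm_num
        _ ≤ q ^ 3 := pow_le_pow_left₀ (by norm_num) hq2 3
    calc 1 ≤ Real.exp (2 * r - 3 / 2 * q) * (3 ^ r * 27) := e3
      _ ≤ Real.exp (2 * r - 3 / 2 * q) * (64 ^ r * (q ^ 3 * (256 / 3))) := by
          gcongr; linarith
      _ = _ := by ring
  rw [div_le_iff₀ (by positivity)]
  have h4 : Real.exp (2 * r - 3 / 2 * q) * Real.exp 4
      = Real.exp (-(3 / 2 * q)) * Real.exp 1 ^ (2 * r + 4) := by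
    rw [← Real.exp_nat_mul, ← Real.exp_add, ← Real.exp_add]
    congr 1; push_cast; ring
  calc M ^ r * (r : ℝ) ^ (6 * r) ≤ B ^ (2 * r + 4) * K₄ * (r : ℝ) ^ (6 * r) := by gcongr
    _ ≤ B ^ (2 * r + 4) * K₄ * (r : ℝ) ^ (6 * r)
        * (64 ^ r * (Real.exp (2 * r - 3 / 2 * q) * q ^ 3 * (256 / 3))) :=
        le_mul_of_one_le_right (by positivity) h3
    _ = B ^ (2 * r + 4) * K₄ * ((r : ℝ) ^ (6 * r) * 64 ^ r)
        * (Real.exp (2 * r - 3 / 2 * q) * q ^ 3 * (256 / 3)) := by ring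
    _ ≤ B ^ (2 * r + 4) * K₄ * (q ^ 3) ^ (2 * r)
        * (Real.exp (2 * r - 3 / 2 * q) * q ^ 3 * (256 / 3)) := by gcongr
    _ = B ^ (2 * r + 4) * K₄ * (q ^ 3) ^ (2 * r)
        * (Real.exp (2 * r - 3 / 2 * q) * Real.exp 4 * q ^ 3 * (256 / 3)) / Real.exp 4 := by
        field_simp
    _ = Real.exp (-(3 / 2 * q)) / (3 / 2 * q) ^ 9 * (3 ^ 8 * K₄ / (2 * Real.exp 4))
        * (Real.exp 1 * B * q ^ 3) ^ (2 * r + 4) := by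
        rw [h4, mul_pow (Real.exp 1 * B), mul_pow (Real.exp 1), pow_add (q ^ 3)]
        field_simp
        ring
    _ ≤ _ := by gcongr

end Numerics

/-! ### Estimates of the constants of the statement -/

section Constants

variable {N : ℕ} [NeZero N] {a : ℝ}

theorem exp_neg_sigma0 (ha : 0 < a) : Real.exp (-sigma0 a) = √(2 * mu a) ^ 2 := by
  have h := exp_neg_sigma0_mul ha 1
  rw [Real.sq_sqrt (by linarith [mu_pos ha])]
  simpa using h

theorem exp_neg_sigma1 (ha : 0 < a) : Real.exp (-sigma1 a) = √(2 * mu a) := by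
  simpa using exp_neg_sigma1_mul ha 1

theorem sigma0_pos (ha : 0 < a) (ha' : a < 1 / 4) : 0 < sigma0 a := by
  rw [sigma0, neg_pos]
  exact Real.log_neg (by linarith [mu_pos ha]) (by linarith [mu_le ha])

theorem muStar_factors (ha : 0 < a) (ha' : a < 1 / 4) :
    0 ≤ Real.exp (-(sigma0 a - sigmaStar a)) ∧
      Real.exp (-(sigma0 a - sigmaStar a)) ≤ √(2 * mu a) := by
  refine ⟨(Real.exp_pos _).le, ?_⟩
  rw [← exp_neg_sigma1 ha]
  refine Real.exp_le_exp.2 ?_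
  have := sigma0_pos ha ha'
  rw [sigmaStar, sigma1]; linarith

theorem muStar_eq (ha : 0 < a) (C₀ : ℝ) : muStar N a C₀ = Omega N a * (1 - √(2 * mu a) ^ 2) *
    (1 - Real.exp (-(sigma0 a - sigmaStar a))) * √(2 * mu a) / (8 * C₀) := by
  have h : Real.exp (sigma1 a) = (√(2 * mu a))⁻¹ := by
    rw [← exp_neg_sigma1 ha, Real.exp_neg, inv_inv]
  have hs : 0 < √(2 * mu a) := Real.sqrt_pos.2 (by linarith [mu_pos ha])
  rw [muStar, exp_neg_sigma0 ha, h]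
  field_simp

/-- Because of e^{σ₁}, μ_* is of order √(2μ). The first bound gives the smallness condition for all
admissible r. The second makes the cap on κ at least 3, and is what forces a₀ to be as small as
10^{-8}. -/
theorem muStar_bounds (ha : 0 < a) (ha' : a < 1 / 10 ^ 8) :
    muStar N a 96 ≤ 1 / 384 ∧ 2 * mu a ≤ muStar N a 96 := by
  have hμ := mu_pos ha
  have hμ' := mu_le ha
  have ha4 : a < 1 / 4 := by linarith
  obtain ⟨ht0, ht⟩ := muStar_factors ha ha4
  have hΩ := Omega_bounds (N := N) ha
  have hΩ2 : Omega N a ≤ 2 := hΩ.2.trans (by rw [Real.sqrt_le_left (by norm_num)]; linarith)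
  have hs0 : 0 < √(2 * mu a) := Real.sqrt_pos.2 (by linarith)
  have hs2 : √(2 * mu a) ^ 2 = 2 * mu a := Real.sq_sqrt (by linarith)
  have hs : √(2 * mu a) ≤ 1 / 5000 := by
    rw [Real.sqrt_le_left (by norm_num)]; linarith
  rw [muStar_eq ha]
  generalize √(2 * mu a) = s at *
  generalize Real.exp (-(sigma0 a - sigmaStar a)) = t at *
  generalize Omega N a = w at *
  rw [← hs2]
  have f1 : 0 ≤ 1 - s ^ 2 ∧ 1 - s ^ 2 ≤ 1 ∧ 1 / 2 ≤ 1 - s ^ 2 := by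
    refine ⟨?_, ?_, ?_⟩ <;> nlinarith
  have f2 : 0 ≤ 1 - t ∧ 1 - t ≤ 1 ∧ 1 / 2 ≤ 1 - t := by
    refine ⟨?_, ?_, ?_⟩ <;> linarith
  constructor
  · have h1 : w * (1 - s ^ 2) ≤ 2 * 1 := mul_le_mul hΩ2 f1.2.1 f1.1 (by norm_num)
    have h2 : w * (1 - s ^ 2) * (1 - t) ≤ 2 * 1 * 1 := mul_le_mul h1 f2.2.1 f2.1 (by norm_num)
    have h3 : w * (1 - s ^ 2) * (1 - t) * s ≤ 2 * 1 * 1 * (1 / 5000) :=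
      mul_le_mul h2 hs hs0.le (by norm_num)
    rw [div_le_iff₀ (by norm_num)]
    linarith
  · have h1 : 1 * (1 / 2) ≤ w * (1 - s ^ 2) :=
      mul_le_mul hΩ.1 f1.2.2 (by norm_num) (by linarith)
    have h2 : 1 * (1 / 2) * (1 / 2) ≤ w * (1 - s ^ 2) * (1 - t) :=
      mul_le_mul h1 f2.2.2 (by norm_num) (by linarith)
    rw [le_div_iff₀ (by norm_num)]
    nlinarith

/-- Since 2r + 2 ≤ 4r, the required (2r+2) · 96μ ≤ 1/2 follows from 2μr ≤ μ_* ≤ 1/384. -/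
theorem smallCoupling_of_le_muStar (ha : 0 < a) (ha' : a < 1 / 10 ^ 8) {r : ℕ} (hr : 1 ≤ r)
    (h : (r : ℝ) ≤ muStar N a 96 / (2 * mu a)) : SmallCoupling N a (2 * r + 2) := by
  have hμ := mu_pos ha
  rw [le_div_iff₀ (by positivity)] at h
  have hr1 : (1 : ℝ) ≤ r := by exact_mod_cast hr
  refine smallCoupling_of_le ha (by linarith) ?_
  have := (muStar_bounds (N := N) ha ha').1
  push_cast
  nlinarith

/-- The denominators in the prefactor are at most 1 and 2⁶/e exceeds 2, which compensates Ω ≤ 2. -/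
theorem le_betaStar (ha : 0 < a) (ha' : a < 1 / 10 ^ 8) {C₁ : ℝ} (hC : 0 < C₁) :
    C₁ ≤ betaStar N a C₁ := by
  have ha4 : a < 1 / 4 := by linarith
  have hσ := sigma0_pos ha ha4
  have hΩ := Omega_bounds (N := N) ha
  have hΩ2 : Omega N a ≤ 2 := hΩ.2.trans (by rw [Real.sqrt_le_left (by norm_num)]; linarith)
  have hm : muFlat a < 1 := Real.exp_lt_one_iff.2 (by rw [sigmaStar]; linarith)
  have hm0 : 0 < muFlat a := Real.exp_pos _
  have hA : A2sq a = 1 - 2 * a := Real.sq_sqrt (by linarith)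
  have hCt : 0 ≤ Ctilde a := by
    have h1 : Real.exp (-sigma0 a) < 1 := Real.exp_lt_one_iff.2 (by linarith)
    have h2 : Real.exp (-(sigma0 a - sigmaStar a)) < 1 :=
      Real.exp_lt_one_iff.2 (by rw [sigmaStar]; linarith)
    exact div_nonneg (by positivity) (mul_nonneg (by linarith) (by linarith))
  have h1 : 1 / 3 ≤ Real.exp (Ctilde a - 1) := by
    calc (1 : ℝ) / 3 ≤ Real.exp (-1) := by
          rw [Real.exp_neg, one_div]
          exact inv_anti₀ (Real.exp_pos _) (Real.exp_one_lt_d9.le.trans (by norm_num))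
      _ ≤ _ := Real.exp_le_exp.2 (by linarith)
  have hd0 : 0 < (1 - muFlat a ^ 2) * (1 - muFlat a) * A2sq a := by
    rw [hA]
    exact mul_pos (mul_pos (by nlinarith) (by linarith)) (by linarith)
  have hd1 : (1 - muFlat a ^ 2) * (1 - muFlat a) * A2sq a ≤ 1 := by
    rw [hA]
    exact mul_le_one₀ (mul_le_one₀ (by nlinarith) (by linarith) (by linarith)) (by linarith)
      (by linarith)
  have h2 : (2 : ℝ) ≤ 2 ^ 6 * Real.exp (Ctilde a - 1) /
      ((1 - muFlat a ^ 2) * (1 - muFlat a) * A2sq a) := by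
    rw [le_div_iff₀ hd0]
    linarith
  have h3 : C₁ / 2 ≤ C₁ / Omega N a :=
    div_le_div_of_nonneg_left hC.le (by linarith) hΩ2
  calc C₁ = 2 * (C₁ / 2) := by ring
    _ ≤ _ := mul_le_mul h2 h3 (by positivity) (by linarith)

/-- C₁² cancels, and the numerical factor 2⁸ 8⁴ · 4 · 3³/2⁹ is far above 1. -/
theorem one_le_sq_mul_constK4 (ha : 0 < a) {a₀ C₁ : ℝ} (h₀ : 0 < a₀) (h₀' : a₀ < 1 / 2)
    (hC : 0 < C₁) : 1 ≤ C₁ ^ 2 * constK4 N a a₀ 8 C₁ := by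
  have hΩ := (Omega_bounds (N := N) ha).1
  have h1 : 1 ≤ Omega N a ^ 6 := one_le_pow₀ hΩ
  have h2 : 1 ≤ Real.exp 6 := Real.one_le_exp (by norm_num)
  have h3 : 4 ≤ constK2 a₀ 8 := by
    have e1 : (1 : ℝ) ≤ (2 * 8) ^ (2 + 8 * a₀) := Real.one_le_rpow (by norm_num) (by linarith)
    have e2 : (1 - 2 * a₀) ^ 4 ≤ 1 := pow_le_one₀ (by linarith) (by linarith)
    have e3 : (1 - a₀) ^ 6 ≤ 1 := pow_le_one₀ (by linarith) (by linarith)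
    have e4 : 0 < (1 - 2 * a₀) ^ 4 := pow_pos (by linarith) 4
    have e5 : 0 < (1 - a₀) ^ 6 := pow_pos (by linarith) 6
    rw [constK2, le_div_iff₀ (mul_pos e4 e5)]
    have := mul_le_one₀ e2 e5.le e3
    linarith
  have h4 : C₁ ^ 2 * constK4 N a a₀ 8 C₁
      = constK3 a₀ 8 * (3 ^ 3 / 2 ^ 9) * (Real.exp 6 * Omega N a ^ 6) := by
    rw [constK4]; field_simp
  have h5 : 1 ≤ Real.exp 6 * Omega N a ^ 6 := one_le_mul_of_one_le_of_one_le h2 h1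
  have h6 : 1 ≤ constK3 a₀ 8 * (3 ^ 3 / 2 ^ 9) := by rw [constK3]; linarith
  rw [h4]
  exact one_le_mul_of_one_le_of_one_le h6 h5

end Constants

/-! ### The exponent κ -/

section Kappa

variable {N : ℕ} [NeZero N] {a β C₁ : ℝ}

/-- Both branches of κ are 3q/2 with q at most μ_*/μ and e β^* q³ ≤ β, which is all that is used
later. The bound q ≥ 2 comes from the factor 64 = 4³ in the first branch and from `muStar_bounds` in
the second. -/
theorem exists_kappa_eq (ha : 0 < a) (ha' : a < 1 / 10 ^ 8) (hC : 0 < C₁)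
    (hβ : 64 * Real.exp 1 * betaStar N a C₁ ≤ β) : ∃ q : ℝ, kappa N a β 96 C₁ = 3 / 2 * q ∧
      2 ≤ q ∧ q ≤ muStar N a 96 / mu a ∧ Real.exp 1 * betaStar N a C₁ * q ^ 3 ≤ β := by
  have hB : 0 < betaStar N a C₁ := hC.trans_le (le_betaStar ha ha' hC)
  have hμ := mu_pos ha
  have hm := (muStar_bounds (N := N) ha ha').2
  have he : 0 < Real.exp 1 * betaStar N a C₁ := mul_pos (Real.exp_pos 1) hB
  have h2 : 2 ≤ muStar N a 96 / mu a := by rwa [le_div_iff₀ hμ]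
  rw [kappa]
  split_ifs with h
  · set t := β / (Real.exp 1 * betaStar N a C₁) with ht
    have ht64 : 64 ≤ t := by rw [ht, le_div_iff₀ he]; linarith
    have ht3 : (t ^ (1 / 3 : ℝ)) ^ 3 = t := by
      rw [← Real.rpow_natCast, ← Real.rpow_mul (by linarith)]; norm_num
    refine ⟨t ^ (1 / 3 : ℝ), rfl, ?_, ?_, ?_⟩
    · by_contra! h3
      have := pow_lt_pow_left₀ h3 (Real.rpow_nonneg (by linarith) _) (three_ne_zero)
      rw [ht3] at this
      linarith
    · by_contra! h3
      have := pow_lt_pow_left₀ h3 (by linarith) (three_ne_zero)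
      rw [ht3, ht, lt_div_iff₀ he] at this
      linarith
    · rw [ht3, ht, mul_div_cancel₀ _ he.ne']
  · exact ⟨_, rfl, h2, le_rfl, not_lt.1 h⟩

end Kappa

end

end KleinGordon

/-! ### Choice of the constants and conclusion -/

open KleinGordon in
theorem proposition5p3 :
    ∃ (β₀ a₀ K₁ : ℝ) (C₀ C₁ : ℝ → ℝ),
      0 < β₀ ∧ 0 < a₀ ∧ a₀ < 1 / 2 ∧ 2 < K₁ ∧ PartitionBounds β₀ a₀ K₁ ∧
      Asymptotics.IsBigO (𝓝[>] (0 : ℝ)) C₀ (fun _ => (1 : ℝ)) ∧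
      Asymptotics.IsBigO (𝓝[>] (0 : ℝ)) C₁ (fun _ => (1 : ℝ)) ∧
      (∀ a : ℝ, 0 < a → a < a₀ → 0 < C₀ a ∧ 0 < C₁ a ∧
        ∀ (N : ℕ) [NeZero N],
          (∃ ζ : ℕ → Poly N, ζ 0 = 0 ∧ SeedOfClass 2 (Z0 N a) ζ (C₀ a) (sigma0 a)) ∧
          (∃ h : ℕ → Poly N, SeedOfClass 4 (toNormal a (H1 N)) h (C₁ a) (sigma1 a))) ∧
      ∀ (N : ℕ) [NeZero N] (a β : ℝ), 0 < a → a < min a₀ (1 / 4) →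
        constD K₁ a β ^ 2 * muFlat a < 1 →
        (∀ (ν : ℝ) (r : ℕ), 0 < ν → ν ≤ 1 → 1 ≤ r →
          (r : ℝ) < muStar N a (C₀ a) / (2 * mu a) →
          max β₀ (max ((betaStar N a (C₁ a) * (r : ℝ) ^ 3) ^ (1 / ν)) (√(3 / 2))) < β →
          RemainderBound N a β r
            (N / β ^ lambda1 r ν *
              (constK4 N a a₀ K₁ (C₁ a) * betaStar N a (C₁ a) ^ 3 /
                (1 - constD K₁ a β ^ 2 * muFlat a) ^ 2))) ∧
        (max β₀ (max (64 * Real.exp 1 * betaStar N a (C₁ a)) (√(3 / 2))) ≤ β →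
          RemainderBound N a β ⌊kappa N a β (C₀ a) (C₁ a) / 3⌋₊
            (N * (Real.exp (-kappa N a β (C₀ a) (C₁ a)) / kappa N a β (C₀ a) (C₁ a) ^ 9) *
              (3 ^ 8 * constK4 N a a₀ K₁ (C₁ a) /
                (2 * Real.exp 4 * (1 - constD K₁ a β ^ 2 * muFlat a) ^ 2)))) := by
  obtain ⟨M, hM, hmom⟩ := exists_second_moment_remainder_le
  -- C₁ may be any upper bound for the seed norm 16384 of H₁, so it is also made large enough to
  -- dominate the growth constant M.
  set c : ℝ := max M 16384 with hc
  have hMc : M ≤ c := le_max_left _ _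
  have hc0 : 0 < c := by linarith
  refine ⟨1, 1 / 10 ^ 8, 8, fun _ => 96, fun _ => c, one_pos, by norm_num, by norm_num,
    by norm_num, partitionBounds (by norm_num) (by norm_num),
    Asymptotics.isBigO_const_const _ one_ne_zero _, Asymptotics.isBigO_const_const _ one_ne_zero _,
    fun a ha ha' => ⟨by norm_num, hc0, fun N _ => ⟨?_, ?_⟩⟩, ?_⟩
  · obtain ⟨ζ, h0, h⟩ := exists_seed_Z0 (N := N) ha (by linarith)
    exact ⟨ζ, h0, h.mono (by norm_num)⟩
  · obtain ⟨h, hh⟩ := exists_seed_H1 (N := N) ha (by linarith)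
    exact ⟨h, hh.mono (le_max_right _ _)⟩
  intro N _ a β ha ha' hD
  replace ha' : a < 1 / 10 ^ 8 := ha'.trans_le (min_le_left _ _)
  have ha4 : a < 1 / 4 := by linarith
  have hμ := mu_pos ha
  have hB := le_betaStar (N := N) ha ha' hc0
  have hK := one_le_sq_mul_constK4 (N := N) ha (a₀ := 1 / 10 ^ 8) (by norm_num) (by norm_num) hc0
  have hD0 : 0 ≤ constD 8 a β ^ 2 * muFlat a := mul_nonneg (sq_nonneg _) (Real.exp_pos _).le
  -- From here on only 0 ≤ x < 1 matters: dividing by (1 - x)² ≤ 1 enlarges the bound.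
  generalize constD 8 a β ^ 2 * muFlat a = x at *
  have hx0 : 0 < (1 - x) ^ 2 := pow_pos (by linarith) 2
  have hx1 : (1 - x) ^ 2 ≤ 1 := pow_le_one₀ (by linarith) (by linarith)
  have hK0 : 0 < constK4 N a (1 / 10 ^ 8) 8 c := by
    by_contra! h
    nlinarith [mul_nonneg (sq_nonneg c) (neg_nonneg.2 h)]
  have main : ∀ (r : ℕ) (b : ℝ), 0 < β → 1 ≤ r → (r : ℝ) ≤ muStar N a 96 / (2 * mu a) →
      M ^ r * (r : ℝ) ^ (6 * r) / β ^ (2 * r + 4) ≤ b → RemainderBound N a β r (N * b) := by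
    intro r b hβ hr hr' hb
    have hs := smallCoupling_of_le_muStar ha ha' hr hr'
    refine ⟨exists_normalForm ha ha4 hs, fun χ Z h => ?_⟩
    obtain ⟨h1, h2⟩ := hmom N a β r χ Z ha ha4 hβ hr hs h
    exact ⟨h1, h2.trans (mul_le_mul_of_nonneg_left hb (Nat.cast_nonneg N))⟩
  refine ⟨fun ν r hν _ hr hr' hβ => ?_, fun hβ => ?_⟩
  · have hβ0 : 0 < β := one_pos.trans ((le_max_left _ _).trans_lt hβ)
    have hβ1 := ((le_max_left _ _).trans (le_max_right _ _)).trans_lt hβ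
    have h := power_law_bound hM hMc hB hK hr hν hβ0 hβ1
    have hlam : 0 < β ^ lambda1 r ν := Real.rpow_pos_of_pos hβ0 _
    have hB0 : 0 < betaStar N a c := hc0.trans_le hB
    have h' := main r _ hβ0 hr hr'.le (h.trans (mul_le_mul_of_nonneg_left
      (le_div_self (by positivity) hx0 hx1) (by positivity)))
    rwa [← mul_assoc, mul_one_div] at h'
  · have hβ0 : 0 < β := one_pos.trans_le ((le_max_left _ _).trans hβ)
    obtain ⟨q, hq, hq2, hqm, hqβ⟩ := exists_kappa_eq ha ha' hc0
      (((le_max_left _ _).trans (le_max_right _ _)).trans hβ)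
    simp only [hq]
    have e : 3 / 2 * q / 3 = q / 2 := by ring
    rw [e]
    -- κ/3 = q/2, so q ≥ 2 guarantees r ≥ 1, and q ≤ μ_*/μ gives the admissible range of r.
    set r := ⌊q / 2⌋₊ with hr
    have hr1 : 1 ≤ r := Nat.le_floor (by push_cast; linarith)
    have hr2 : (r : ℝ) ≤ q / 2 := Nat.floor_le (by linarith)
    have hr3 : q / 2 < r + 1 := Nat.lt_floor_add_one _
    have h := exponential_bound hM hMc hB hK (r := r) (q := q) (by linarith) (by linarith) hq2 hqβ
    have hr4 : (r : ℝ) ≤ muStar N a 96 / (2 * mu a) := by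
      have : muStar N a 96 / (2 * mu a) = muStar N a 96 / mu a / 2 := by field_simp
      rw [this]; linarith
    have hq0 : 0 < q := by linarith
    have h' := main r _ hβ0 hr1 hr4 (h.trans (mul_le_mul_of_nonneg_left
      (le_div_self (by positivity) hx0 hx1) (by positivity)))
    rwa [← mul_assoc, div_div] at h'
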